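/- Write $e(z)=e^{2\pi i z}$, $\zeta_n=e(1/n)$, $q=e(\tau)$, $q^{r}=e(r\tau)$ for $\tau=u+iv\in\mathbb{H}$; square roots are principal branches. With $(a;x)_n=\prod_{k=0}^{n-1}(1-ax^k)$ let $$\phi(x)=\sum_{n\ge 0}\frac{x^{n^2}}{(-x^2;x^2)_n},\qquad \psi(x)=\sum_{n\ge 1}\frac{x^{n^2}}{(x;x^2)_n},\qquad \nu(x)=\sum_{n\ge 0}\frac{x^{n(n+1)}}{(-x;x^2)_{n+1}}\qquad(|x|<1)$$ be the third order mock theta functions, and let $\theta_{12,a}(z)=\sum_{n\in\mathbb{Z},\,n\equiv a\,(24)} n\,e(n^2z/48)$. Put $$F_{(3)}(\tau)=\Big(q^{-\frac1{48}}\phi(q^{\frac12}),\ q^{-\frac1{48}}\phi(-q^{\frac12}),\ 2q^{-\frac1{48}}\psi(q^{\frac12}),\ 2q^{-\frac1{48}}\psi(-q^{\frac12}),\ \sqrt2\,q^{\frac16}\nu(q^{\frac12}),\ \sqrt2\,q^{\frac16}\nu(-q^{\frac12})\Big)^{T},$$ $$G_{(3)}(\tau)=\frac{i}{\sqrt{24}}\int_{-\overline{\tau}}^{i\infty}\frac{g_{(3)}(z)}{\sqrt{-i(z+\tau)}}\,dz$$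 (integrated componentwise along the vertical half-line $z=-\overline\tau+it$, $t>0$), where $g_{(3)}=(-s_+,\,-s_-,\,s_+,\,s_-,\,-r,\,r)^T$ with $s_{\pm}=\theta_{12,1}\pm\theta_{12,5}+\theta_{12,7}\pm\theta_{12,11}$ and $r=\sqrt2\,(\theta_{12,4}+\theta_{12,8})$. Let $H_{(3)}=F_{(3)}-G_{(3)}$. The metaplectic group $\mathrm{Mp}_2(\mathbb{Z})$ consists of the pairs $(\gamma,\varphi)$ with $\gamma=\begin{pmatrix}a&b\\c&d\end{pmatrix}\in\mathrm{SL}_2(\mathbb{Z})$ and $\varphi:\mathbb{H}\to\mathbb{C}$ holomorphic, $\varphi(\tau)^2=c\tau+d$, with product $(\gamma,\varphi(\tau))(\gamma',\varphi'(\tau))=(\gamma\gamma',\varphi(\gamma'\tau)\varphi'(\tau))$; put $T=\left(\begin{pmatrix}1&1\\0&1\end{pmatrix},1\right)$, $S=\left(\begin{pmatrix}0&-1\\1&0\end{pmatrix},\sqrt\tau\right)$. For $k\in\frac12\mathbb{Z}$, a unitary representation $\rho$ of $\mathrm{Mp}_2(\mathbb{Z})$ on $\mathbb{C}^d$ with $\rho(T)^N=\mathrm{Id}$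 for some $N\ge1$, and a finite index subgroup $\Gamma$, a twice continuously differentiable $f:\mathbb{H}\to\mathbb{C}^d$ is a *harmonic weak Maass form* of weight $k$ for $\rho$ and $\Gamma$ if 1. $f(\gamma\tau)=\varphi(\tau)^{2k}\rho(\gamma,\varphi)f(\tau)$ for all $(\gamma,\varphi)\in\Gamma$; 2. there is $C>0$ such that for every $(\delta,\varphi)\in\mathrm{Mp}_2(\mathbb{Z})$ one has $\varphi(\tau)^{-2k}\rho(\delta,\varphi)^{-1}f(\delta\tau)=O(e^{Cv})$ as $v\to\infty$, uniformly in $u$; 3. $\Delta_kf=0$, where $\Delta_k=-v^2\left(\frac{\partial^2}{\partial u^2}+\frac{\partial^2}{\partial v^2}\right)+ikv\left(\frac{\partial}{\partial u}+i\frac{\partial}{\partial v}\right)$. A *scalar valued* harmonic weak Maass form for $\Gamma$ is a twice continuously differentiable $f:\mathbb{H}\to\mathbb{C}$ satisfying 1–3 with a unitary character $\chi$ of $\Gamma$ of finite order in place of $\rho$ in 1, and with the factor $\rho^{-1}$ omitted in 2. **Theorem.** All series and integrals above converge absolutely, and for all $\tau\in\mathbb{H}$ $$H_{(3)}(\tau+1)=M_T\,H_{(3)}(\tau),\qquad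 H_{(3)}\!\left(-\tfrac1\tau\right)=\sqrt{-i\tau}\;M_S\,H_{(3)}(\tau),$$ $$M_T=\begin{pmatrix}0&\zeta_{48}^{-1}&0&0&0&0\\ \zeta_{48}^{-1}&0&0&0&0&0\\0&0&0&\zeta_{48}^{-1}&0&0\\0&0&\zeta_{48}^{-1}&0&0&0\\0&0&0&0&0&\zeta_6\\0&0&0&0&\zeta_6&0\end{pmatrix},\qquad M_S=\begin{pmatrix}0&0&1&0&0&0\\0&0&0&0&0&1\\1&0&0&0&0&0\\0&0&0&0&1&0\\0&0&0&1&0&0\\0&1&0&0&0&0\end{pmatrix}.$$ There is a unitary representation $\rho$ of $\mathrm{Mp}_2(\mathbb{Z})$ on $\mathbb{C}^6$ with $\rho(T)=M_T$ and $\rho(S)=e(-1/8)M_S$, and $H_{(3)}$ is a vector valued harmonic weak Maass form of weight $\frac12$ for $\rho$ and the whole group $\mathrm{Mp}_2(\mathbb{Z})$. Moreover, each of the six components of $H_{(3)}$ is a scalar valued harmonic weak Maass form of weight $\frac12$ for the subgroup $\{(\gamma,\varphi)\in\mathrm{Mp}_2(\mathbb{Z})\mid\gamma\in\Gamma(2)\}$,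 with some unitary character of finite order of that subgroup. -/

import Mathlib

open UpperHalfPlane
open scoped MatrixGroups Manifold Matrix

noncomputable section

namespace MockThetaThree

/-- `e(z) = exp(2πiz)`; in particular `q ^ r = e(r τ)` and `ζ_n = e(1/n)`. -/
def e (z : ℂ) : ℂ := Complex.exp (2 * Real.pi * Complex.I * z)

/-- The principal branch of the square root (`Complex.cpow` is the principal power). -/
def csqrt (z : ℂ) : ℂ := z ^ (1 / 2 : ℂ)

/-! ### The metaplectic group `Mp₂(ℤ)` -/

/-- Elements of `Mp₂(ℤ)`: pairs `(γ, φ)` with `γ = (a b; c d) ∈ SL₂(ℤ)` and `φ : ℍ → ℂ`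
holomorphic with `φ(τ)² = cτ + d`. -/
@[ext]
structure Mp2Z where
  mat : SL(2, ℤ)
  phi : ℍ → ℂ
  holo : MDifferentiable 𝓘(ℂ) 𝓘(ℂ) phi
  sq : ∀ τ : ℍ, phi τ ^ 2 = denom mat τ

namespace Mp2Z

lemma phi_ne_zero (g : Mp2Z) (τ : ℍ) : g.phi τ ≠ 0 := by
  intro h
  have := g.sq τ
  rw [h] at this
  exact denom_ne_zero (g.mat : GL (Fin 2) ℝ) τ (by simpa using this.symm)

lemma mdiff_smul (γ : SL(2, ℤ)) : MDifferentiable 𝓘(ℂ) 𝓘(ℂ) (fun τ : ℍ => γ • τ) :=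
  mdifferentiable_smul (g := (γ : GL (Fin 2) ℝ)) (by simp)

lemma denom_mul' (γ δ : SL(2, ℤ)) (τ : ℍ) :
    denom (γ * δ : SL(2, ℤ)) τ = denom γ (δ • τ : ℍ) * denom δ τ := by
  have := denom_cocycle_σ (γ : GL (Fin 2) ℝ) (δ : GL (Fin 2) ℝ) τ
  simpa [σ, ModularGroup.sl_moeb] using this

/-- `(γ, φ) (δ, ψ) = (γδ, φ(δτ) ψ(τ))`. -/
instance : Mul Mp2Z where
  mul g h :=
    { mat := g.mat * h.mat
      phi := fun τ => g.phi (h.mat • τ) * h.phi τ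
      holo := (g.holo.comp (mdiff_smul h.mat)).mul h.holo
      sq := fun τ => by rw [mul_pow, g.sq, h.sq, denom_mul'] }

instance : One Mp2Z where
  one :=
    { mat := 1
      phi := fun _ => 1
      holo := mdifferentiable_const
      sq := fun τ => by simp }

/-- `(γ, φ)⁻¹ = (γ⁻¹, 1 / φ(γ⁻¹τ))`. -/
instance : Inv Mp2Z where
  inv g :=
    { mat := g.mat⁻¹
      phi := fun τ => (g.phi (g.mat⁻¹ • τ))⁻¹
      holo := by
        have h := g.holo.comp (mdiff_smul g.mat⁻¹)
        rw [UpperHalfPlane.mdifferentiable_iff] at h ⊢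
        exact h.inv fun z _ => g.phi_ne_zero _
      sq := fun τ => by
        rw [inv_pow, g.sq]
        have h := denom_mul' g.mat g.mat⁻¹ τ
        rw [mul_inv_cancel] at h
        simp only [map_one, denom_one] at h
        exact inv_eq_of_mul_eq_one_right h.symm }

@[simp] lemma mul_mat (g h : Mp2Z) : (g * h).mat = g.mat * h.mat := rfl
@[simp] lemma mul_phi (g h : Mp2Z) (τ : ℍ) :
    (g * h).phi τ = g.phi (h.mat • τ) * h.phi τ := rfl
@[simp] lemma one_mat : (1 : Mp2Z).mat = 1 := rfl
@[simp] lemma one_phi (τ : ℍ) : (1 : Mp2Z).phi τ = 1 := rfl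
@[simp] lemma inv_mat (g : Mp2Z) : (g⁻¹).mat = g.mat⁻¹ := rfl
@[simp] lemma inv_phi (g : Mp2Z) (τ : ℍ) : (g⁻¹).phi τ = (g.phi (g.mat⁻¹ • τ))⁻¹ := rfl

instance : Group Mp2Z :=
  Group.ofLeftAxioms
    (fun a b c => by
      refine Mp2Z.ext (mul_assoc _ _ _) (funext fun τ => ?_)
      simp [mul_smul, mul_assoc])
    (fun a => Mp2Z.ext (one_mul _) (funext fun τ => by simp))
    (fun a => Mp2Z.ext (inv_mul_cancel _) (funext fun τ => by
      simp [phi_ne_zero]))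

/-- The projection `Mp₂(ℤ) → SL₂(ℤ)`. -/
def proj : Mp2Z →* SL(2, ℤ) where
  toFun := Mp2Z.mat
  map_one' := rfl
  map_mul' _ _ := rfl

/-- `T = ((1 1; 0 1), 1)`. -/
def T : Mp2Z where
  mat := ModularGroup.T
  phi := fun _ => 1
  holo := mdifferentiable_const
  sq := fun τ => by rw [ModularGroup.denom_apply]; simp [ModularGroup.T]

/-- `S = ((0 -1; 1 0), √τ)`. -/
def S : Mp2Z where
  mat := ModularGroup.S
  phi := fun τ => csqrt τ
  holo := by
    rw [UpperHalfPlane.mdifferentiable_iff]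
    refine DifferentiableOn.congr (f := fun z : ℂ => z ^ (1 / 2 : ℂ)) ?_ ?_
    · intro z hz
      have hz' : 0 < z.im := hz
      exact (differentiableAt_id.cpow_const
        (Complex.mem_slitPlane_iff.mpr (Or.inr hz'.ne'))).differentiableWithinAt
    · intro z hz
      simp [csqrt, ofComplex_apply_of_im_pos hz]
  sq := fun τ => by
    rw [ModularGroup.denom_S, csqrt, ← Complex.cpow_nat_mul]
    simp

end Mp2Z

/-- The preimage `{(γ, φ) ∈ Mp₂(ℤ) | γ ∈ Γ(2)}` of the principal congruence subgroup `Γ(2)`. -/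
def Gamma2Tilde : Subgroup Mp2Z := (CongruenceSubgroup.Gamma 2).comap Mp2Z.proj

/-! ### Harmonic weak Maass forms

Weights are half-integers `k = κ / 2` with `κ : ℤ`, so that `φ(τ)^{2k} = φ(τ)^κ`. -/

/-- `∂f/∂u`, where `τ = u + iv`. -/
def partialU (f : ℍ → ℂ) (τ : ℍ) : ℂ := fderiv ℝ (f ∘ ofComplex) (τ : ℂ) 1

/-- `∂f/∂v`, where `τ = u + iv`. -/
def partialV (f : ℍ → ℂ) (τ : ℍ) : ℂ := fderiv ℝ (f ∘ ofComplex) (τ : ℂ) Complex.I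

/-- The hyperbolic Laplace operator
`Δ_k = -v² (∂²/∂u² + ∂²/∂v²) + ikv (∂/∂u + i ∂/∂v)` of weight `k = κ / 2`. -/
def hypLaplacian (κ : ℤ) (f : ℍ → ℂ) (τ : ℍ) : ℂ :=
  -(τ.im : ℂ) ^ 2 * (partialU (partialU f) τ + partialV (partialV f) τ)
    + Complex.I * ((κ : ℂ) / 2) * τ.im * (partialU f τ + Complex.I * partialV f τ)

/-- `f` is twice continuously differentiable on `ℍ` (in the real sense). -/
def IsC2 (f : ℍ → ℂ) : Prop := ContDiffOn ℝ 2 (f ∘ ofComplex) {z : ℂ | 0 < z.im}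

/-- `f : ℍ → ℂ^ι` is a harmonic weak Maass form of weight `κ / 2` with respect to the unitary
representation `ρ` of `Mp₂(ℤ)` and the subgroup `Γ`. The cusps of `Γ` are the points `δ∞`,
`(δ, φ) ∈ Mp₂(ℤ)`; `O[atImInfty]` is uniform in `u`. -/
structure IsVectorHarmonicWeakMaassForm {ι : Type*} [Fintype ι] [DecidableEq ι] (κ : ℤ)
    (ρ : Mp2Z →* Matrix.unitaryGroup ι ℂ) (Γ : Subgroup Mp2Z) (f : ℍ → ι → ℂ) : Prop where
  finiteIndex : Γ.FiniteIndex
  finite_order_T : ∃ N : ℕ, 0 < N ∧ ρ Mp2Z.T ^ N = 1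
  smooth : ∀ i, IsC2 fun τ => f τ i
  transform : ∀ g ∈ Γ, ∀ τ : ℍ,
    f (g.mat • τ) = g.phi τ ^ κ • ((ρ g : Matrix ι ι ℂ) *ᵥ f τ)
  growth : ∃ C : ℝ, 0 < C ∧ ∀ g : Mp2Z, ∀ i,
    (fun τ : ℍ => g.phi τ ^ (-κ) * (((ρ g)⁻¹ : Matrix.unitaryGroup ι ℂ).1 *ᵥ f (g.mat • τ)) i)
      =O[atImInfty] fun τ : ℍ => Real.exp (C * τ.im)
  harmonic : ∀ i τ, hypLaplacian κ (fun τ' => f τ' i) τ = 0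

/-- `f : ℍ → ℂ` is a scalar valued harmonic weak Maass form of weight `κ / 2` for the subgroup `Γ`
of `Mp₂(ℤ)` with the unitary character (multiplier) `χ` of finite order. As `|χ| = 1`, the
character plays no role in the growth condition. -/
structure IsScalarHarmonicWeakMaassForm (κ : ℤ) (Γ : Subgroup Mp2Z) (χ : Γ →* Circle)
    (f : ℍ → ℂ) : Prop where
  finiteIndex : Γ.FiniteIndex
  finite_order : ∃ N : ℕ, 0 < N ∧ ∀ g : Γ, χ g ^ N = 1
  smooth : IsC2 f
  transform : ∀ g : Γ, ∀ τ : ℍ, f (g.1.mat • τ) = g.1.phi τ ^ κ * χ g * f τ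
  growth : ∃ C : ℝ, 0 < C ∧ ∀ g : Mp2Z,
    (fun τ : ℍ => g.phi τ ^ (-κ) * f (g.mat • τ)) =O[atImInfty] fun τ : ℍ => Real.exp (C * τ.im)
  harmonic : ∀ τ, hypLaplacian κ f τ = 0

/-! ### The third order mock theta functions `φ`, `ψ`, `ν` -/

/-- `(a; x)_n = ∏_{k < n} (1 - a x^k)`. -/
def qPochhammer (a x : ℂ) (n : ℕ) : ℂ := ∏ k ∈ Finset.range n, (1 - a * x ^ k)

def mockPhiTerm (x : ℂ) (n : ℕ) : ℂ := x ^ n ^ 2 / qPochhammer (-x ^ 2) (x ^ 2) n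

/-- The terms of `ψ` are indexed by `n ≥ 1`; `n` is shifted by one here. -/
def mockPsiTerm (x : ℂ) (n : ℕ) : ℂ := x ^ (n + 1) ^ 2 / qPochhammer x (x ^ 2) (n + 1)

def mockNuTerm (x : ℂ) (n : ℕ) : ℂ := x ^ (n * (n + 1)) / qPochhammer (-x) (x ^ 2) (n + 1)

/-- `φ(x) = ∑_{n ≥ 0} x^{n²} / (-x²; x²)_n`. -/
def mockPhi (x : ℂ) : ℂ := ∑' n, mockPhiTerm x n

/-- `ψ(x) = ∑_{n ≥ 1} x^{n²} / (x; x²)_n`. -/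
def mockPsi (x : ℂ) : ℂ := ∑' n, mockPsiTerm x n

/-- `ν(x) = ∑_{n ≥ 0} x^{n(n+1)} / (-x; x²)_{n+1}`. -/
def mockNu (x : ℂ) : ℂ := ∑' n, mockNuTerm x n

/-- The vector `F₍₃₎`; `q^{1/2} = e(τ/2)`. -/
def F3 (τ : ℍ) : Fin 6 → ℂ :=
  ![e (-τ / 48) * mockPhi (e (τ / 2)),
    e (-τ / 48) * mockPhi (-e (τ / 2)),
    2 * e (-τ / 48) * mockPsi (e (τ / 2)),
    2 * e (-τ / 48) * mockPsi (-e (τ / 2)),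
    (√2 : ℝ) * e (τ / 6) * mockNu (e (τ / 2)),
    (√2 : ℝ) * e (τ / 6) * mockNu (-e (τ / 2))]

/-! ### Unary theta functions and the theta integral -/

/-- `n q^{n²/4N}` at `z`. -/
def thetaTerm (N : ℕ) (z : ℂ) (n : ℤ) : ℂ := n * e (z * ((n : ℂ) ^ 2 / (4 * N)))

/-- `θ_{N,a}(z) = ∑_{n ≡ a (2N)} n q^{n²/4N}`. -/
def theta (N : ℕ) (a : ℤ) (z : ℂ) : ℂ :=
  ∑' n : {n : ℤ // n ≡ a [ZMOD (2 * N)]}, thetaTerm N z n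

/-- The vector `g₍₃₎`. -/
def g3 (z : ℂ) : Fin 6 → ℂ :=
  ![-(theta 12 1 z + theta 12 5 z + theta 12 7 z + theta 12 11 z),
    -(theta 12 1 z - theta 12 5 z + theta 12 7 z - theta 12 11 z),
    theta 12 1 z + theta 12 5 z + theta 12 7 z + theta 12 11 z,
    theta 12 1 z - theta 12 5 z + theta 12 7 z - theta 12 11 z,
    -((√2 : ℝ) * (theta 12 4 z + theta 12 8 z)),
    (√2 : ℝ) * (theta 12 4 z + theta 12 8 z)]

/-- The integrand `g₍₃₎(z) / √(-i(z + τ))`. -/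
def G3Integrand (τ : ℍ) (j : Fin 6) (z : ℂ) : ℂ :=
  g3 z j / csqrt (-Complex.I * (z + τ))

/-- The point `-τ̄ + it` of the vertical half-line from `-τ̄` to `i∞`. -/
def ray (τ : ℍ) (t : ℝ) : ℂ := -(starRingEnd ℂ) (τ : ℂ) + Complex.I * t

/-- `G₍₃₎(τ) = (i/√24) ∫_{-τ̄}^{i∞} g₍₃₎(z) / √(-i(z + τ)) dz`, integrated componentwise along
`z = -τ̄ + it`, `t > 0`, so that `dz = i dt`. -/
def G3 (τ : ℍ) (j : Fin 6) : ℂ :=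
  Complex.I / (√24 : ℝ) * ∫ t in Set.Ioi (0 : ℝ), G3Integrand τ j (ray τ t) * Complex.I

/-- `H₍₃₎ = F₍₃₎ - G₍₃₎`. -/
def H3 (τ : ℍ) : Fin 6 → ℂ := F3 τ - G3 τ

/-- The transformation matrix under `τ ↦ τ + 1`. -/
def T3 : Matrix (Fin 6) (Fin 6) ℂ :=
  !![0, e (-1 / 48), 0, 0, 0, 0;
     e (-1 / 48), 0, 0, 0, 0, 0;
     0, 0, 0, e (-1 / 48), 0, 0;
     0, 0, e (-1 / 48), 0, 0, 0;
     0, 0, 0, 0, 0, e (1 / 6);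
     0, 0, 0, 0, e (1 / 6), 0]

/-- The transformation matrix under `τ ↦ -1/τ`. -/
def S3 : Matrix (Fin 6) (Fin 6) ℂ :=
  !![0, 0, 1, 0, 0, 0;
     0, 0, 0, 0, 0, 1;
     1, 0, 0, 0, 0, 0;
     0, 0, 0, 0, 1, 0;
     0, 0, 0, 1, 0, 0;
     0, 1, 0, 0, 0, 0]

end MockThetaThree

end

/-! Zwegers' method. Put `z = e u`, `q = e τ`. Bailey's lemma (`tsum_bailey`), applied to a partial
fraction expansion, shows that `∑ q^{n²} / ((zq;q)_n (q/z;q)_n)` is `(1 - z) / (q;q)_∞` times the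
Appell–Lerch sum `appell τ u` (`tsum_rank`). The choices `z = i`, `z⁴ = q` and `z² = -q` produce
`φ`, `1 + ψ` and `1 + zν`.

Under `u ↦ u + τ` the sum `appell` is quasi-periodic up to elementary terms, and the series
`nonhol`, built from `sgn n - E(·)` and the character `(12/n)`, has matching error terms. Hence
`completion` is exactly quasi-periodic. It is not holomorphic in `u`, but its antiholomorphic
derivative is an explicit multiple of the conjugate of `thetaChi`, whose inversion formula comes
from Jacobi's. So the defect in the expected inversion law of `completion` is holomorphic off the
lattice. The inversion of `η` removes its pole at the origin, and a Liouville argument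
(`eq_zero_of_quasiperiodic`) makes it vanish. This is `completion_S`.

Integrating `G3` termwise turns it into a series of error functions (`G3_eq`). At the special points
above `nonhol` is the same series: only the odd part of the coefficients matters, so the comparison
is a finite check modulo 24. Thus components of `H3` are values of `completion`, and `completion_S`
gives the inversion law for components 0, 2, 3, 4. Components 1 and 5 follow from the translation
law and the relation `TSTST = S` on `ℍ`.

Harmonicity is a computation: `H3` is holomorphic plus an Eichler integral, whose antiholomorphic
derivative is `v^{-1/2}` times an antiholomorphic function. Growth at every cusp reduces to growth
at `i∞`. The representation needs no presentation of `Mp₂(ℤ)`: the components of `H3` are linearly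
independent (`IsRelation.eq_zero`), so the matrix attached to a group element is unique, and its
existence for the generators suffices. Finally `T` and `S` permute the components, up to roots of
unity, like right multiplication on `SL(2, ZMod 2)`, so the preimage of `Γ(2)` acts diagonally. -/

noncomputable section

namespace MockThetaThree

open Filter Topology

/-! ### The exponential `e` -/

lemma e_add (a b : ℂ) : e (a + b) = e a * e b := by
  simp only [e, mul_add, Complex.exp_add]

lemma e_zero : e 0 = 1 := by simp [e]

lemma e_ne_zero (a : ℂ) : e a ≠ 0 := Complex.exp_ne_zero _

lemma e_neg (a : ℂ) : e (-a) = (e a)⁻¹ := by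
  simp only [e, mul_neg, Complex.exp_neg]

lemma e_sub (a b : ℂ) : e (a - b) = e a / e b := by
  simp only [e, mul_sub, Complex.exp_sub]

lemma e_pow (a : ℂ) (n : ℕ) : e a ^ n = e (n * a) := by
  simp only [e, ← Complex.exp_nat_mul]
  ring_nf

lemma e_int (n : ℤ) : e n = 1 := by
  simpa [e, mul_comm] using Complex.exp_int_mul_two_pi_mul_I n

lemma e_half : e (1 / 2) = -1 := by
  rw [e, ← Complex.exp_pi_mul_I]; ring_nf

lemma e_quarter : e (1 / 4) = Complex.I := by
  rw [e, show 2 * (Real.pi : ℂ) * Complex.I * (1 / 4) = Real.pi / 2 * Complex.I by ring,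
    Complex.exp_pi_div_two_mul_I]

lemma e_add_int (a : ℂ) (n : ℤ) : e (a + n) = e a := by rw [e_add, e_int, mul_one]

lemma e_eq_of_sub_int {a b : ℂ} (n : ℤ) (h : a = b + n) : e a = e b := by rw [h, e_add_int]

lemma norm_e (a : ℂ) : ‖e a‖ = Real.exp (-2 * Real.pi * a.im) := by
  rw [e, Complex.norm_exp]; congr 1; simp

lemma norm_e_real (a : ℝ) : ‖e a‖ = 1 := by simp [norm_e]

lemma conj_e (a : ℂ) : (starRingEnd ℂ) (e a) = e (-(starRingEnd ℂ) a) := by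
  simp only [e, ← Complex.exp_conj]
  congr 1
  simp [Complex.conj_ofNat]

lemma e_eq_one_iff {a : ℂ} : e a = 1 ↔ ∃ n : ℤ, a = n := by
  rw [e, Complex.exp_eq_one_iff]
  refine exists_congr fun n => ?_
  have h : (2 * (Real.pi : ℂ) * Complex.I) ≠ 0 := by simp
  constructor
  · intro H; apply mul_left_cancel₀ h; rw [H]; ring
  · rintro rfl; ring

lemma hasDerivAt_e (z : ℂ) : HasDerivAt e (2 * Real.pi * Complex.I * e z) z := by
  have h := ((hasDerivAt_id z).const_mul (2 * Real.pi * Complex.I)).cexp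
  rw [mul_one, mul_comm (Complex.exp _)] at h
  exact h

lemma differentiable_e : Differentiable ℂ e := fun z => (hasDerivAt_e z).differentiableAt

lemma continuous_e : Continuous e := differentiable_e.continuous

lemma norm_e_lt_one {a : ℂ} (h : 0 < a.im) : ‖e a‖ < 1 := by
  rw [norm_e, Real.exp_lt_one_iff]
  have := Real.pi_pos
  nlinarith

/-! ### The `q`-series side: from Bailey's lemma to the mock theta functions as Appell–Lerch sums.
-/

/-! ### Gaussian summability -/

/-- A majorant for theta-like series; the linear term `B|n|` absorbs an elliptic variable of bounded
imaginary part. -/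
lemma summable_pow_mul_gaussian (k : ℕ) {c : ℝ} (hc : 0 < c) (B : ℝ) :
    Summable fun n : ℤ => |(n : ℝ)| ^ k * Real.exp (-c * n ^ 2 + B * |(n : ℝ)|) := by
  have := summable_pow_mul_jacobiTheta₂_term_bound (B / (2 * Real.pi))
    (div_pos hc Real.pi_pos) k
  refine this.congr fun n => ?_
  have := Real.pi_ne_zero
  push_cast
  congr 2
  field_simp
  ring

lemma summable_gaussian {c : ℝ} (hc : 0 < c) (B : ℝ) :
    Summable fun n : ℤ => Real.exp (-c * n ^ 2 + B * |(n : ℝ)|) := by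
  simpa using summable_pow_mul_gaussian 0 hc B

/-! ### The inverse `q`-factorials -/

/-- `1 / (q; q)_m` for `q = e τ`, extended by zero to negative `m`. -/
def invQFac (τ : ℂ) (m : ℤ) : ℂ :=
  if 0 ≤ m then (qPochhammer (e τ) (e τ) m.toNat)⁻¹ else 0

lemma invQFac_natCast (τ : ℂ) (m : ℕ) :
    invQFac τ m = (qPochhammer (e τ) (e τ) m)⁻¹ := by simp [invQFac]

lemma invQFac_of_neg (τ : ℂ) {m : ℤ} (hm : m < 0) : invQFac τ m = 0 := by
  simp [invQFac, hm]

lemma invQFac_zero (τ : ℂ) : invQFac τ 0 = 1 := by simp [invQFac, qPochhammer]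

lemma one_sub_e_ne_zero {a : ℂ} (h : 0 < a.im) : 1 - e a ≠ 0 := by
  intro H
  have := norm_e_lt_one h
  rw [← sub_eq_zero.mp H] at this
  simp at this

/-- Extension by zero is what this recurrence forces, since `1 - q^0 = 0`. Its validity for every
integer lets the sums below run over `ℤ` and be shifted without boundary terms. -/
lemma invQFac_sub_one {τ : ℂ} (hτ : 0 < τ.im) (m : ℤ) :
    invQFac τ (m - 1) = (1 - e (m * τ)) * invQFac τ m := by
  rcases lt_trichotomy m 0 with h | rfl | h
  · rw [invQFac_of_neg τ h, invQFac_of_neg τ (by omega), mul_zero]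
  · rw [invQFac_of_neg τ (by omega)]; simp [e_zero]
  · obtain ⟨k, rfl⟩ : ∃ k : ℕ, m = k + 1 := ⟨(m - 1).toNat, by omega⟩
    rw [add_sub_cancel_right, invQFac_natCast]
    have h2 : ((k : ℤ) + 1) = ((k + 1 : ℕ) : ℤ) := by push_cast; rfl
    rw [h2, invQFac_natCast, qPochhammer, qPochhammer, Finset.prod_range_succ, mul_inv,
      ← pow_succ', e_pow]
    push_cast
    have : 1 - e ((k + 1 : ℂ) * τ) ≠ 0 := by
      apply one_sub_e_ne_zero
      have : ((k + 1 : ℂ) * τ).im = (k + 1) * τ.im := by simp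
      rw [this]; positivity
    field_simp

lemma tendsto_qPochhammer {τ : ℂ} (hτ : 0 < τ.im) :
    Tendsto (fun n => qPochhammer (e τ) (e τ) n) atTop (𝓝 (∏' n : ℕ, (1 - e τ ^ (n + 1)))) := by
  have h : Multipliable fun n : ℕ => 1 - e τ ^ (n + 1) := by
    have : Summable fun n : ℕ => ‖-(e τ) ^ (n + 1)‖ := by
      simp only [norm_neg, norm_pow]
      exact (summable_geometric_of_lt_one (norm_nonneg _) (norm_e_lt_one hτ)).comp_injective
        (add_left_injective 1)
    simpa [sub_eq_add_neg] using multipliable_one_add_of_summable this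
  simpa [qPochhammer, pow_succ'] using h.tendsto_prod_tprod_nat

/-- Euler's product `(q; q)_∞`. -/
def eulerProd (τ : ℂ) : ℂ := ∏' n : ℕ, (1 - e τ ^ (n + 1))

lemma eulerProd_ne_zero {τ : ℂ} (hτ : 0 < τ.im) : eulerProd τ ≠ 0 := by
  have := ModularForm.eta_tprod_ne_zero (z := τ) hτ
  simpa [eulerProd, ModularForm.eta_q_eq_pow, e] using this

lemma tendsto_invQFac {τ : ℂ} (hτ : 0 < τ.im) :
    Tendsto (fun n : ℕ => invQFac τ n) atTop (𝓝 (eulerProd τ)⁻¹) := by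
  simp only [invQFac_natCast]
  exact (tendsto_qPochhammer hτ).inv₀ (eulerProd_ne_zero hτ)

lemma exists_norm_invQFac_le {τ : ℂ} (hτ : 0 < τ.im) :
    ∃ K : ℝ, 0 ≤ K ∧ ∀ m, ‖invQFac τ m‖ ≤ K := by
  obtain ⟨K, hK⟩ := (tendsto_invQFac hτ).norm.bddAbove_range
  refine ⟨max K 0, le_max_right _ _, fun m => ?_⟩
  rcases lt_or_ge m 0 with h | h
  · rw [invQFac_of_neg τ h]; simp
  · obtain ⟨k, rfl⟩ := Int.eq_ofNat_of_zero_le h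
    exact (hK ⟨k, rfl⟩).trans (le_max_left _ _)

/-! ### A limiting case of the `q`-Gauss sum -/

/-- The terms of `∑ q^{m² + jm} / ((q)_m (q)_{m+j})`. -/
def durfeeTerm (τ : ℂ) (j m : ℤ) : ℂ :=
  e (τ * (m ^ 2 + j * m)) * invQFac τ m * invQFac τ (m + j)

def durfeeSum (τ : ℂ) (j : ℤ) : ℂ := ∑' m : ℤ, durfeeTerm τ j m

lemma norm_e_mul_real (τ : ℂ) (x : ℝ) :
    ‖e (τ * x)‖ = Real.exp (-(2 * Real.pi * τ.im) * x) := by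
  rw [norm_e]; congr 1; simp; ring

lemma norm_durfeeTerm_le {τ : ℂ} (hτ : 0 < τ.im) {K : ℝ} (hK0 : 0 ≤ K)
    (hK : ∀ m, ‖invQFac τ m‖ ≤ K) {j : ℤ} (hj : 0 ≤ j) (m : ℤ) :
    ‖durfeeTerm τ j m‖ ≤ K ^ 2 * Real.exp (-(2 * Real.pi * τ.im) * m ^ 2 + 0 * |(m : ℝ)|) := by
  rcases lt_or_ge m 0 with h | h
  · rw [durfeeTerm, invQFac_of_neg τ h]; simp; positivity
  · have h1 : ‖e (τ * (m ^ 2 + j * m))‖ ≤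
        Real.exp (-(2 * Real.pi * τ.im) * m ^ 2 + 0 * |(m : ℝ)|) := by
      have : ((m : ℂ) ^ 2 + j * m) = (((m : ℝ) ^ 2 + j * m : ℝ) : ℂ) := by push_cast; ring
      rw [this, norm_e_mul_real, zero_mul, add_zero]
      apply Real.exp_le_exp.mpr
      have h2 : (0 : ℝ) ≤ (j : ℝ) * m := by
        have : (0 : ℝ) ≤ j := by exact_mod_cast hj
        have : (0 : ℝ) ≤ m := by exact_mod_cast h
        positivity
      have h3 : 0 ≤ 2 * Real.pi * τ.im := by positivity
      nlinarith
    rw [durfeeTerm, norm_mul, norm_mul]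
    calc _ ≤ Real.exp (-(2 * Real.pi * τ.im) * m ^ 2 + 0 * |(m : ℝ)|) * K * K := by
          gcongr
          · exact hK m
          · exact hK _
      _ = _ := by ring

lemma summable_durfeeTerm {τ : ℂ} (hτ : 0 < τ.im) {j : ℤ} (hj : 0 ≤ j) :
    Summable (durfeeTerm τ j) := by
  obtain ⟨K, hK0, hK⟩ := exists_norm_invQFac_le hτ
  exact Summable.of_norm_bounded
    ((summable_gaussian (by positivity : 0 < 2 * Real.pi * τ.im) 0).mul_left (K ^ 2))
    (norm_durfeeTerm_le hτ hK0 hK hj)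

/-- A contiguity relation, proved termwise after shifting `m` to `m + 1`; the `q`-factorial
recurrence is used once for each of the two factors. -/
lemma durfeeSum_sub {τ : ℂ} (hτ : 0 < τ.im) {j : ℤ} (hj : 0 ≤ j) :
    durfeeSum τ j - durfeeSum τ (j + 1) =
      e (τ * (j + 1)) * (durfeeSum τ (j + 2) - durfeeSum τ (j + 1)) := by
  have hs0 := summable_durfeeTerm hτ hj
  have hs1 := summable_durfeeTerm hτ (j := j + 1) (by omega)
  have hs2 := summable_durfeeTerm hτ (j := j + 2) (by omega)
  have key : ∀ m : ℤ, durfeeTerm τ j (m + 1) - durfeeTerm τ (j + 1) (m + 1) =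
      e (τ * (j + 1)) * durfeeTerm τ (j + 2) m
        - e (τ * (j + 1)) * durfeeTerm τ (j + 1) (m + 1) := by
    intro m
    have h1 := invQFac_sub_one hτ (m + 1)
    have h2 := invQFac_sub_one hτ (m + j + 2)
    rw [add_sub_cancel_right] at h1
    rw [show m + j + 2 - 1 = m + 1 + j by ring] at h2
    simp only [durfeeTerm]
    rw [show m + 1 + (j + 1) = m + j + 2 by ring, show m + (j + 2) = m + j + 2 by ring, h1, h2]
    push_cast
    have e1 : e (τ * ((m + 1 : ℂ) ^ 2 + j * (m + 1))) =
      e (τ * (m ^ 2 + (j + 2) * m)) * e (τ * (j + 1)) := by rw [← e_add]; ring_nf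
    have e2 : e (τ * ((m + 1 : ℂ) ^ 2 + (j + 1) * (m + 1))) =
      e (τ * (m ^ 2 + (j + 2) * m)) * e (τ * (j + 1)) * e ((m + 1) * τ) := by
        rw [← e_add, ← e_add]; ring_nf
    have e3 : e ((m + j + 2 : ℂ) * τ) = e ((m + 1) * τ) * e (τ * (j + 1)) := by
      rw [← e_add]; ring_nf
    rw [e1, e2, e3]
    ring
  have shift : ∀ f : ℤ → ℂ, ∑' m, f (m + 1) = ∑' m, f m :=
    fun f => (Equiv.addRight (1 : ℤ)).tsum_eq f
  have sshift : ∀ {f : ℤ → ℂ}, Summable f → Summable fun m => f (m + 1) :=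
    fun {f} hf => (Equiv.addRight (1 : ℤ)).summable_iff.mpr hf
  have := tsum_congr (L := .unconditional ℤ) key
  rw [Summable.tsum_sub (sshift hs0) (sshift hs1),
    Summable.tsum_sub (hs2.mul_left _) ((sshift hs1).mul_left _), tsum_mul_left, tsum_mul_left,
    shift (durfeeTerm τ j), shift (durfeeTerm τ (j + 1))] at this
  rw [durfeeSum, durfeeSum, durfeeSum, this]
  ring

/-- Each use of `durfeeSum_sub` gains a factor of norm at most `‖q‖ < 1`, while all the sums obey
one bound `B`; iterating forces the difference to be zero. -/
lemma durfeeSum_succ {τ : ℂ} (hτ : 0 < τ.im) {j : ℤ} (hj : 0 ≤ j) :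
    durfeeSum τ (j + 1) = durfeeSum τ j := by
  obtain ⟨K, hK0, hK⟩ := exists_norm_invQFac_le hτ
  have hsum := (summable_gaussian (by positivity : 0 < 2 * Real.pi * τ.im) 0).mul_left (K ^ 2)
  set B := ∑' m : ℤ, K ^ 2 * Real.exp (-(2 * Real.pi * τ.im) * m ^ 2 + 0 * |(m : ℝ)|)
  have hB : ∀ i : ℤ, 0 ≤ i → ‖durfeeSum τ i‖ ≤ B := fun i hi =>
    tsum_of_norm_bounded hsum.hasSum (norm_durfeeTerm_le hτ hK0 hK hi)
  have hρ := norm_e_lt_one hτ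
  have step : ∀ i : ℤ, 0 ≤ i → ‖durfeeSum τ i - durfeeSum τ (i + 1)‖ ≤
      ‖e τ‖ * ‖durfeeSum τ (i + 1) - durfeeSum τ (i + 1 + 1)‖ := by
    intro i hi
    rw [durfeeSum_sub hτ hi, norm_mul, norm_sub_rev, show i + 1 + 1 = i + 2 by ring]
    gcongr
    rw [show τ * ((i : ℂ) + 1) = τ * ((i + 1 : ℝ) : ℂ) by push_cast; ring, norm_e_mul_real, norm_e]
    apply Real.exp_le_exp.mpr
    have h0 : (0 : ℝ) ≤ i := by exact_mod_cast hi
    have h3 : 0 ≤ Real.pi * τ.im := by positivity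
    nlinarith
  have iter : ∀ N : ℕ, ‖durfeeSum τ j - durfeeSum τ (j + 1)‖ ≤
      ‖e τ‖ ^ N * ‖durfeeSum τ (j + N) - durfeeSum τ (j + N + 1)‖ := by
    intro N
    induction N with
    | zero => simp
    | succ N ih =>
      refine ih.trans ?_
      rw [pow_succ, mul_assoc]
      gcongr
      have := step (j + N) (by positivity)
      push_cast
      rwa [← add_assoc]
  have hlim : Tendsto (fun N : ℕ => ‖e τ‖ ^ N * (B + B)) atTop (𝓝 (0 * (B + B))) :=
    (tendsto_pow_atTop_nhds_zero_of_lt_one (norm_nonneg _) hρ).mul_const _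
  have h0 : ‖durfeeSum τ j - durfeeSum τ (j + 1)‖ ≤ 0 * (B + B) := by
    refine ge_of_tendsto' hlim fun N => (iter N).trans ?_
    gcongr
    exact (norm_sub_le _ _).trans (add_le_add (hB _ (by positivity)) (hB _ (by positivity)))
  rw [zero_mul, norm_le_zero_iff, sub_eq_zero] at h0
  exact h0.symm

/-- The value is independent of `j`, so it may be computed as `j → ∞`, where only the term `m = 0`
survives. -/
lemma durfeeSum_nat {τ : ℂ} (hτ : 0 < τ.im) (j : ℕ) :
    durfeeSum τ j = (eulerProd τ)⁻¹ := by
  have hconst : ∀ i : ℕ, durfeeSum τ i = durfeeSum τ 0 := by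
    intro i
    induction i with
    | zero => simp
    | succ i ih => push_cast; rw [durfeeSum_succ hτ (by positivity), ih]
  obtain ⟨K, hK0, hK⟩ := exists_norm_invQFac_le hτ
  have hsum := (summable_gaussian (by positivity : 0 < 2 * Real.pi * τ.im) 0).mul_left (K ^ 2)
  have hlim : Tendsto (fun i : ℕ => durfeeSum τ i) atTop
      (𝓝 (∑' m : ℤ, if m = 0 then (eulerProd τ)⁻¹ else 0)) := by
    refine tendsto_tsum_of_dominated_convergence hsum (fun m => ?_)
      (Eventually.of_forall fun i m => norm_durfeeTerm_le hτ hK0 hK (by positivity) m)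
    rcases lt_trichotomy m 0 with h | rfl | h
    · simp [durfeeTerm, invQFac_of_neg τ h, h.ne]
    · simpa [durfeeTerm, e_zero, invQFac_zero] using tendsto_invQFac hτ
    · rw [if_neg h.ne']
      have hρ := norm_e_lt_one hτ
      refine squeeze_zero_norm (a := fun i : ℕ => ‖e τ‖ ^ i * (K * K)) (fun i => ?_) ?_
      · rw [durfeeTerm, norm_mul, norm_mul, mul_assoc]
        gcongr
        · rw [← norm_pow, e_pow, show τ * ((m : ℂ) ^ 2 + (i : ℤ) * m) =
            τ * ((m ^ 2 + i * m : ℝ) : ℂ) by push_cast; ring,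
            show (i : ℂ) * τ = τ * ((i : ℝ) : ℂ) by push_cast; ring, norm_e_mul_real,
            norm_e_mul_real]
          apply Real.exp_le_exp.mpr
          have h1 : (1 : ℝ) ≤ m := by exact_mod_cast h
          have h3 : 0 ≤ 2 * Real.pi * τ.im := by positivity
          have h4 : (0 : ℝ) ≤ i := by positivity
          have h5 : (i : ℝ) ≤ m ^ 2 + i * m := by nlinarith
          nlinarith
        · exact hK _
        · exact hK _
      · simpa using (tendsto_pow_atTop_nhds_zero_of_lt_one (norm_nonneg _) hρ).mul_const (K * K)
  rw [tsum_ite_eq] at hlim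
  rw [hconst]
  simp only [hconst] at hlim
  exact tendsto_nhds_unique tendsto_const_nhds hlim

lemma durfeeSum_neg (τ : ℂ) (j : ℤ) : durfeeSum τ (-j) = durfeeSum τ j := by
  rw [durfeeSum, durfeeSum, ← (Equiv.addRight j).tsum_eq (durfeeTerm τ (-j))]
  refine tsum_congr fun m => ?_
  simp only [durfeeTerm, Equiv.coe_addRight, add_neg_cancel_right]
  push_cast
  rw [show τ * (((m : ℂ) + j) ^ 2 + -j * (m + j)) = τ * (m ^ 2 + j * m) by ring]
  ring

lemma durfeeSum_eq {τ : ℂ} (hτ : 0 < τ.im) (j : ℤ) : durfeeSum τ j = (eulerProd τ)⁻¹ := by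
  obtain ⟨n, rfl | rfl⟩ := j.eq_nat_or_neg
  · exact durfeeSum_nat hτ n
  · rw [durfeeSum_neg, durfeeSum_nat hτ n]

/-! ### A partial fraction expansion -/

lemma summable_mul_invQFac (τ : ℂ) (n : ℤ) (f : ℤ → ℂ) :
    Summable fun r => f r * invQFac τ (n - r) * invQFac τ (n + r) := by
  refine summable_of_hasFiniteSupport ((Set.finite_Icc (-n) n).subset fun r hr => ?_)
  by_contra h
  rw [Set.mem_Icc, not_and_or, not_le, not_le] at h
  apply hr
  rcases h with h | h
  · simp [invQFac_of_neg τ (show n + r < 0 by omega)]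
  · simp [invQFac_of_neg τ (show n - r < 0 by omega)]

/-- The weights `(-1)^r q^{r(r-1)/2}`. -/
def signedQ (τ : ℂ) (r : ℤ) : ℂ := (-1) ^ r * e (τ * (r * (r - 1) / 2))

lemma signedQ_neg (τ : ℂ) (r : ℤ) : signedQ τ (-r) = e (r * τ) * signedQ τ r := by
  simp only [signedQ, zpow_neg, ← inv_zpow]
  norm_num
  rw [mul_left_comm, ← e_add]
  ring_nf

lemma signedQ_add_one (τ : ℂ) (r : ℤ) : signedQ τ (r + 1) = -(e (r * τ) * signedQ τ r) := by
  simp only [signedQ, zpow_add₀ (show (-1 : ℂ) ≠ 0 by norm_num)]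
  rw [mul_left_comm, ← e_add]
  push_cast
  ring_nf

/-- The summands `(-1)^r q^{r(r-1)/2} / ((q)_{n-r} (q)_{n+r})`. -/
def unitTerm (τ : ℂ) (n r : ℤ) : ℂ := signedQ τ r * invQFac τ (n - r) * invQFac τ (n + r)

lemma unitTerm_neg (τ : ℂ) (n r : ℤ) : unitTerm τ n (-r) = e (r * τ) * unitTerm τ n r := by
  rw [unitTerm, unitTerm, signedQ_neg, sub_neg_eq_add, ← sub_eq_add_neg]
  ring

lemma summable_unitTerm (τ : ℂ) (n : ℤ) : Summable (unitTerm τ n) := summable_mul_invQFac τ n _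

lemma summable_unitTerm_neg (τ : ℂ) (n : ℤ) : Summable fun r => unitTerm τ n (-r) :=
  (summable_unitTerm τ n).comp_injective neg_injective

lemma tsum_unitTerm_neg (τ : ℂ) (n : ℤ) : ∑' r, unitTerm τ n (-r) = ∑' r, unitTerm τ n r :=
  (Equiv.neg ℤ).tsum_eq (unitTerm τ n)

/-- A discrete antiderivative of the summand after symmetrisation in `r ↦ -r`. -/
lemma unitTerm_telescope {τ : ℂ} (hτ : 0 < τ.im) (n r : ℤ) :
    (signedQ τ (r + 1) * (1 - e ((n + (r + 1 : ℤ) : ℂ) * τ))) * invQFac τ (n - (r + 1)) *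
      invQFac τ (n + (r + 1)) -
    (signedQ τ r * (1 - e ((n + r : ℂ) * τ))) * invQFac τ (n - r) * invQFac τ (n + r) =
      -(1 - e (n * τ)) * (unitTerm τ n r + unitTerm τ n (-r)) := by
  have h1 := invQFac_sub_one hτ (n - r)
  have h2 := invQFac_sub_one hτ (n + (r + 1))
  rw [show n - r - 1 = n - (r + 1) by ring] at h1
  rw [show n + (r + 1) - 1 = n + r by ring, Int.cast_add n] at h2
  rw [unitTerm_neg, unitTerm, signedQ_add_one, h1]
  have h3 : ∀ a b c : ℂ, -(e (r * τ) * a) * b * c * invQFac τ (n + (r + 1)) =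
      -(e (r * τ) * a) * c * (b * invQFac τ (n + (r + 1))) := fun a b c => by ring
  rw [h3, ← h2, Int.cast_sub, sub_mul (n : ℂ), add_mul (n : ℂ), e_add, e_sub]
  have := e_ne_zero (r * τ)
  generalize e (r * τ) = X at *
  generalize invQFac τ (n - r) = Y at *
  generalize invQFac τ (n + r) = Z at *
  field_simp
  ring

/-- The unit Bailey pair. The telescoping sum is zero, and it is also `-2(1 - q^n)` times the sum in
question, with `q^n ≠ 1`. -/
lemma tsum_unitTerm {τ : ℂ} (hτ : 0 < τ.im) {n : ℤ} (hn : 0 < n) :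
    ∑' r, unitTerm τ n r = 0 := by
  have hts := summable_mul_invQFac τ n fun r => signedQ τ r * (1 - e ((n + r : ℂ) * τ))
  have hsum := tsum_congr (L := .unconditional ℤ) (unitTerm_telescope hτ n)
  have hshift := (Equiv.addRight (1 : ℤ)).summable_iff.mpr hts
  have h1 := (Equiv.addRight (1 : ℤ)).tsum_eq fun r =>
    signedQ τ r * (1 - e ((n + r : ℂ) * τ)) * invQFac τ (n - r) * invQFac τ (n + r)
  have h5 := hshift.tsum_sub hts
  simp only [Function.comp_apply, Equiv.coe_addRight] at h1 h5
  rw [h5, h1, sub_self, tsum_mul_left,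
    (summable_unitTerm τ n).tsum_add (summable_unitTerm_neg τ n), tsum_unitTerm_neg] at hsum
  have h3 : 1 - e (n * τ) ≠ 0 := by
    apply one_sub_e_ne_zero
    have : (0 : ℝ) < n := by exact_mod_cast hn
    have h : ((n : ℂ) * τ).im = n * τ.im := by simp
    rw [h]; positivity
  have h4 := (mul_eq_zero.mp hsum.symm).resolve_left (neg_ne_zero.mpr h3)
  exact add_self_eq_zero.mp h4

/-- The coefficients of the partial fraction expansion. -/
def rankCoeff (τ u : ℂ) (r : ℤ) : ℂ :=
  e (r * τ) * signedQ τ r * ((1 - e u) / (1 - e (u + r * τ)))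

/-- The two new factors of the product at `n` turn the summand into the one at `n - 1`, up to
multiples of `unitTerm`, which cancel in the sum. The partial fraction expansion follows by
induction on `n`. -/
lemma rankCoeff_step {τ u : ℂ} (hτ : 0 < τ.im) (hu : ∀ r : ℤ, 1 - e (u + r * τ) ≠ 0)
    (n r : ℤ) : (1 - e (u + n * τ)) * (1 - e (n * τ - u)) *
      (rankCoeff τ u r * invQFac τ (n - r) * invQFac τ (n + r)) =
      rankCoeff τ u r * invQFac τ (n - 1 - r) * invQFac τ (n - 1 + r) +
      ((1 - e u) * e (n * τ) * unitTerm τ n r - (1 - e u) * e (n * τ - u) * unitTerm τ n (-r)) := by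
  have h1 := invQFac_sub_one hτ (n - r)
  have h2 := invQFac_sub_one hτ (n + r)
  have h0 := hu r
  rw [e_add] at h0
  rw [unitTerm_neg, show n - 1 - r = n - r - 1 by ring, show n - 1 + r = n + r - 1 by ring, h1, h2,
    rankCoeff, unitTerm, Int.cast_sub, Int.cast_add, sub_mul (n : ℂ), add_mul (n : ℂ), e_add, e_add,
    e_add, e_sub, e_sub]
  have h3 := e_ne_zero (r * τ)
  have h4 := e_ne_zero u
  clear h1 h2 hu
  generalize e (r * τ) = X at *
  generalize e u = Z at *
  generalize e (n * τ) = W at *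
  generalize invQFac τ (n - r) = Y1 at *
  generalize invQFac τ (n + r) = Y2 at *
  field_simp
  ring

lemma tsum_rankCoeff_step {τ u : ℂ} (hτ : 0 < τ.im) (hu : ∀ r : ℤ, 1 - e (u + r * τ) ≠ 0)
    {n : ℤ} (hn : 0 < n) :
    (1 - e (u + n * τ)) * (1 - e (n * τ - u)) *
      ∑' r, rankCoeff τ u r * invQFac τ (n - r) * invQFac τ (n + r) =
    ∑' r, rankCoeff τ u r * invQFac τ (n - 1 - r) * invQFac τ (n - 1 + r) := by
  rw [← tsum_mul_left, tsum_congr (rankCoeff_step hτ hu n),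
    Summable.tsum_add (summable_mul_invQFac τ (n - 1) _)
      (((summable_unitTerm τ n).mul_left _).sub ((summable_unitTerm_neg τ n).mul_left _)),
    Summable.tsum_sub ((summable_unitTerm τ n).mul_left _) ((summable_unitTerm_neg τ n).mul_left _),
    tsum_mul_left, tsum_mul_left, tsum_unitTerm_neg, tsum_unitTerm hτ hn]
  ring

lemma inv_qPochhammer_mul_eq_tsum {τ u : ℂ} (hτ : 0 < τ.im)
    (hu : ∀ r : ℤ, 1 - e (u + r * τ) ≠ 0) (n : ℕ) :
    (qPochhammer (e (u + τ)) (e τ) n * qPochhammer (e (τ - u)) (e τ) n)⁻¹ =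
      ∑' r, rankCoeff τ u r * invQFac τ (n - r) * invQFac τ (n + r) := by
  induction n with
  | zero =>
    rw [tsum_eq_single 0]
    · have := hu 0
      simp only [Int.cast_zero, zero_mul, add_zero] at this
      simp [qPochhammer, rankCoeff, signedQ, e_zero, invQFac_zero, this]
    · intro r hr
      rcases lt_or_gt_of_ne hr with h | h
      · simp [invQFac_of_neg τ h]
      · simp [invQFac_of_neg τ (show -r < 0 by omega)]
  | succ n ih =>
    have step := tsum_rankCoeff_step hτ hu (n := (n + 1 : ℤ)) (by positivity)
    rw [add_sub_cancel_right, ← ih] at step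
    have h1 := hu (n + 1)
    have h2 : 1 - e (((n + 1 : ℤ) : ℂ) * τ - u) ≠ 0 := by
      have := hu (-(n + 1))
      push_cast at this ⊢
      rw [show ((n : ℂ) + 1) * τ - u = -(u + -(n + 1) * τ) by ring, e_neg]
      rw [sub_ne_zero] at this ⊢
      exact fun H => this (inv_eq_one.mp H.symm).symm
    push_cast
    push_cast at step h1 h2
    rw [qPochhammer, qPochhammer, Finset.prod_range_succ, Finset.prod_range_succ]
    change (qPochhammer _ _ n * _ * (qPochhammer _ _ n * _))⁻¹ = _
    rw [e_pow, ← e_add, ← e_add, show u + τ + n * τ = u + (n + 1) * τ by ring,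
      show τ - u + n * τ = (n + 1) * τ - u by ring]
    rw [mul_mul_mul_comm, mul_inv, ← step]
    field_simp

/-! ### The Appell–Lerch sum -/

/-- `(-1)^n q^{n(3n+1)/2} / (1 - z q^n)` with `z = e u`. -/
def appellTerm (τ u : ℂ) (n : ℤ) : ℂ :=
  (-1) ^ n * e (τ * (n * (3 * n + 1) / 2)) / (1 - e (u + n * τ))

/-- The Appell–Lerch sum `∑ (-1)^n q^{n(3n+1)/2} / (1 - z q^n)`. -/
def appell (τ u : ℂ) : ℂ := ∑' n : ℤ, appellTerm τ u n

lemma im_add_int_mul (u τ : ℂ) (n : ℤ) : (u + n * τ).im = u.im + n * τ.im := by simp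

/-- For such `n` the imaginary part of `u + nτ` is at least 1 in absolute value, so `|z q^n|` is at
most `1/2` or at least `2`. -/
lemma half_le_norm_one_sub_e {τ : ℂ} (hτ : 0 < τ.im) (B : ℝ) {u : ℂ} (hB : |u.im| ≤ B)
    {n : ℤ} (hn : (B + 1) / τ.im ≤ |(n : ℝ)|) : 1 / 2 ≤ ‖1 - e (u + n * τ)‖ := by
  rw [div_le_iff₀ hτ] at hn
  have hπ := Real.pi_gt_three
  have him := im_add_int_mul u τ n
  have hb := abs_le.mp hB
  rcases le_total 0 (n : ℝ) with h | h
  · rw [abs_of_nonneg h] at hn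
    have h1 : ‖e (u + n * τ)‖ ≤ 1 / 2 := by
      rw [norm_e, him]
      have : Real.exp (-2 * Real.pi * (u.im + n * τ.im)) ≤ Real.exp (-1) := by
        apply Real.exp_le_exp.mpr
        nlinarith
      refine this.trans ?_
      rw [Real.exp_neg, ← one_div]
      apply one_div_le_one_div_of_le (by norm_num)
      have := Real.add_one_le_exp (1 : ℝ)
      linarith
    have := norm_sub_norm_le (1 : ℂ) (e (u + n * τ))
    rw [norm_one] at this
    linarith
  · rw [abs_of_nonpos h] at hn
    have h1 : 2 ≤ ‖e (u + n * τ)‖ := by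
      rw [norm_e, him]
      have : Real.exp 1 ≤ Real.exp (-2 * Real.pi * (u.im + n * τ.im)) := by
        apply Real.exp_le_exp.mpr
        nlinarith
      refine le_trans ?_ this
      have := Real.add_one_le_exp (1 : ℝ)
      linarith
    have := norm_sub_norm_le (e (u + n * τ)) 1
    rw [norm_one, norm_sub_rev] at this
    linarith

lemma finite_abs_lt (C : ℝ) : {n : ℤ | ¬ C ≤ |(n : ℝ)|}.Finite := by
  refine (Set.finite_Icc (-⌈C⌉) ⌈C⌉).subset fun n hn => ?_
  simp only [Set.mem_ofPred_eq, not_le, abs_lt] at hn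
  have := Int.le_ceil C
  constructor
  · have : ((-⌈C⌉ : ℤ) : ℝ) < n := by push_cast; linarith
    exact_mod_cast this.le
  · have : (n : ℝ) < (⌈C⌉ : ℝ) := by linarith
    exact_mod_cast this.le

lemma exists_le_norm_one_sub_e {τ u : ℂ} (hτ : 0 < τ.im)
    (hu : ∀ r : ℤ, 1 - e (u + r * τ) ≠ 0) : ∃ δ : ℝ, 0 < δ ∧ ∀ r : ℤ, δ ≤ ‖1 - e (u + r * τ)‖ := by
  set s := (finite_abs_lt ((|u.im| + 1) / τ.im)).toFinset
  obtain ⟨δ, hδ, h⟩ : ∃ δ : ℝ, 0 < δ ∧ ∀ r ∈ s, δ ≤ ‖1 - e (u + r * τ)‖ := by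
    induction s using Finset.induction_on with
    | empty => exact ⟨1, one_pos, by simp⟩
    | insert a s _ ih =>
      obtain ⟨δ, hδ, h⟩ := ih
      refine ⟨min δ ‖1 - e (u + a * τ)‖, lt_min hδ (norm_pos_iff.mpr (hu a)), fun r hr => ?_⟩
      rcases Finset.mem_insert.mp hr with rfl | hr
      · exact min_le_right _ _
      · exact (min_le_left _ _).trans (h r hr)
  refine ⟨min δ (1 / 2), by positivity, fun r => ?_⟩
  by_cases hr : (|u.im| + 1) / τ.im ≤ |(r : ℝ)|
  · exact (min_le_right _ _).trans (half_le_norm_one_sub_e hτ _ le_rfl hr)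
  · exact (min_le_left _ _).trans (h r (by simpa [s] using hr))

lemma norm_neg_one_zpow (n : ℤ) : ‖(-1 : ℂ) ^ n‖ = 1 := by simp

lemma norm_e_quadratic {τ : ℂ} (hτ : 0 < τ.im) (n a b : ℝ) :
    ‖e (τ * ((a * n ^ 2 + b * n : ℝ) : ℂ))‖ ≤
      Real.exp (-(2 * Real.pi * τ.im * a) * n ^ 2 + (2 * Real.pi * τ.im * |b|) * |n|) := by
  rw [norm_e_mul_real]
  apply Real.exp_le_exp.mpr
  have h1 : -(b * n) ≤ |b| * |n| := by rw [← abs_mul]; exact neg_le_abs _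
  have h2 : 0 ≤ 2 * Real.pi * τ.im := by positivity
  nlinarith

lemma summable_norm_e_quadratic {τ : ℂ} (hτ : 0 < τ.im) {a : ℝ} (ha : 0 < a) (b : ℝ) :
    Summable fun n : ℤ => ‖e (τ * ((a * n ^ 2 + b * n : ℝ) : ℂ))‖ :=
  Summable.of_nonneg_of_le (fun _ => norm_nonneg _)
    (fun n => norm_e_quadratic hτ n a b) (summable_gaussian (by positivity) _)

lemma summable_norm_appell_numerator {τ : ℂ} (hτ : 0 < τ.im) :
    Summable fun n : ℤ => ‖(-1 : ℂ) ^ n * e (τ * (n * (3 * n + 1) / 2))‖ := by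
  refine (summable_norm_e_quadratic hτ (a := 3 / 2) (by norm_num) (1 / 2)).congr fun n => ?_
  rw [norm_mul, norm_neg_one_zpow, one_mul]
  congr 3
  push_cast; ring

lemma summable_rankCoeff {τ u : ℂ} (hτ : 0 < τ.im)
    (hu : ∀ r : ℤ, 1 - e (u + r * τ) ≠ 0) : Summable fun r => ‖rankCoeff τ u r‖ := by
  obtain ⟨δ, hδ, h⟩ := exists_le_norm_one_sub_e hτ hu
  refine Summable.of_nonneg_of_le (fun _ => norm_nonneg _) (fun r => ?_)
    ((summable_norm_e_quadratic hτ (a := 1 / 2) (by norm_num) (1 / 2)).mul_right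
      (‖1 - e u‖ / δ))
  rw [rankCoeff, signedQ, mul_left_comm, ← e_add, norm_mul, norm_mul, norm_neg_one_zpow, one_mul,
    norm_div]
  have : (r : ℂ) * τ + τ * (r * (r - 1) / 2) = τ * ((1 / 2 * r ^ 2 + 1 / 2 * r : ℝ) : ℂ) := by
    push_cast; ring
  rw [this]
  gcongr
  exact h r

lemma summable_appellTerm {τ u : ℂ} (hτ : 0 < τ.im)
    (hu : ∀ r : ℤ, 1 - e (u + r * τ) ≠ 0) : Summable (appellTerm τ u) := by
  obtain ⟨δ, hδ, h⟩ := exists_le_norm_one_sub_e hτ hu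
  refine Summable.of_norm_bounded ((summable_norm_appell_numerator hτ).mul_right δ⁻¹) fun r => ?_
  rw [appellTerm, norm_div, div_eq_mul_inv]
  gcongr
  exact h r

/-- The limiting Bailey lemma (for `a = 1`). -/
theorem tsum_bailey {τ : ℂ} (hτ : 0 < τ.im) {c : ℤ → ℂ} (hc : Summable fun r => ‖c r‖) :
    ∑' n : ℕ, e (τ * n ^ 2) * ∑' r, c r * invQFac τ (n - r) * invQFac τ (n + r) =
      (eulerProd τ)⁻¹ * ∑' r : ℤ, e (τ * r ^ 2) * c r := by
  obtain ⟨K, hK0, hK⟩ := exists_norm_invQFac_le hτ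
  set f : ℤ → ℤ → ℂ := fun n r =>
    e (τ * n ^ 2) * (c r * invQFac τ (n - r) * invQFac τ (n + r)) with hf
  have hfs : Summable (Function.uncurry f) := by
    have h1 : Summable fun n : ℤ => ‖e (τ * ((1 * n ^ 2 + 0 * n : ℝ) : ℂ))‖ :=
      summable_norm_e_quadratic hτ one_pos 0
    refine Summable.of_norm_bounded ((h1.mul_of_nonneg hc
      (fun _ => norm_nonneg _) (fun _ => norm_nonneg _)).mul_right (K * K)) ?_
    rintro ⟨n, r⟩
    simp only [hf, Function.uncurry_apply_pair, norm_mul]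
    rw [show ((1 * (n : ℝ) ^ 2 + 0 * n : ℝ) : ℂ) = (n : ℂ) ^ 2 by push_cast; ring]
    calc _ ≤ ‖e (τ * (n : ℂ) ^ 2)‖ * (‖c r‖ * K * K) := by
          gcongr
          · exact hK _
          · exact hK _
      _ = _ := by ring
  have hzero : ∀ n : ℤ, n < 0 → ∀ r, f n r = 0 := by
    intro n hn r
    rcases le_total 0 r with h | h
    · simp [hf, invQFac_of_neg τ (show n - r < 0 by omega)]
    · simp [hf, invQFac_of_neg τ (show n + r < 0 by omega)]
  have hL : ∑' n : ℕ, e (τ * n ^ 2) * ∑' r, c r * invQFac τ (n - r) * invQFac τ (n + r) =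
      ∑' n : ℤ, ∑' r, f n r := by
    rw [← (Nat.cast_injective (R := ℤ)).tsum_eq]
    · refine tsum_congr fun n => ?_
      rw [← tsum_mul_left]
      simp [hf]
    · intro n hn
      by_contra h
      apply hn
      have : n < 0 := by
        by_contra h'
        exact h ⟨n.toNat, by simp; omega⟩
      simp [hzero n this]
  have hR : ∀ r, ∑' n, f n r = (eulerProd τ)⁻¹ * (e (τ * r ^ 2) * c r) := by
    intro r
    -- With `m = n - r` one has `n² = r² + m² + 2rm`, so the sum over `n` is a Durfee sum with `j =
    -- 2r`.
    have hD := durfeeSum_eq hτ (2 * r)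
    rw [durfeeSum, ← (Equiv.subRight r).tsum_eq] at hD
    have : ∀ n, f n r = e (τ * r ^ 2) * c r * durfeeTerm τ (2 * r) (n - r) := by
      intro n
      simp only [hf, durfeeTerm]
      rw [show e (τ * n ^ 2) = e (τ * r ^ 2) *
        e (τ * (((n - r : ℤ) : ℂ) ^ 2 + (2 * r : ℤ) * (n - r : ℤ))) by
          rw [← e_add]; push_cast; ring_nf, show n - r + 2 * r = n + r by ring]
      ring
    rw [tsum_congr this, tsum_mul_left]
    simp only [Equiv.subRight_apply] at hD
    rw [hD]
    ring
  rw [hL, ← hfs.tsum_comm, tsum_congr hR, tsum_mul_left]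

/-- The rank generating function as an Appell–Lerch sum. -/
theorem tsum_rank {τ u : ℂ} (hτ : 0 < τ.im) (hu : ∀ r : ℤ, 1 - e (u + r * τ) ≠ 0) :
    ∑' n : ℕ, e (τ * n ^ 2) / (qPochhammer (e (u + τ)) (e τ) n * qPochhammer (e (τ - u)) (e τ) n) =
      (1 - e u) / eulerProd τ * appell τ u := by
  simp only [div_eq_mul_inv _ (qPochhammer _ _ _ * _), inv_qPochhammer_mul_eq_tsum hτ hu]
  rw [tsum_bailey hτ (summable_rankCoeff hτ hu), appell, div_eq_inv_mul, mul_assoc,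
    ← tsum_mul_left (a := 1 - e u) (f := appellTerm τ u)]
  congr 1
  refine tsum_congr fun r => ?_
  have : e (τ * (r * (3 * r + 1) / 2)) =
      e (τ * r ^ 2) * (e (r * τ) * e (τ * (r * (r - 1) / 2))) := by
    rw [← e_add, ← e_add]; ring_nf
  rw [rankCoeff, appellTerm, signedQ, this]
  ring

/-- Euler's pentagonal number theorem. -/
theorem tsum_pentagonal {τ : ℂ} (hτ : 0 < τ.im) :
    ∑' n : ℤ, (-1) ^ n * e (τ * (n * (3 * n + 1) / 2)) = eulerProd τ := by
  have hs : Summable fun r => ‖signedQ τ r‖ := by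
    refine (summable_norm_e_quadratic hτ (a := 1 / 2) (by norm_num) (-1 / 2)).congr fun n => ?_
    rw [signedQ, norm_mul, norm_neg_one_zpow, one_mul]
    congr 3
    push_cast; ring
  -- For these coefficients the inner sums are those of the unit Bailey pair: only `n = 0`
  -- contributes, and the left side is 1.
  have h := tsum_bailey hτ hs
  have h0 : ∀ n : ℕ, n ≠ 0 → e (τ * n ^ 2) * ∑' r, unitTerm τ n r = 0 := fun n hn => by
    rw [tsum_unitTerm hτ (by positivity), mul_zero]
  have h1 : ∑' r, unitTerm τ (0 : ℕ) r = 1 := by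
    rw [tsum_eq_single 0]
    · simp [unitTerm, signedQ, e_zero, invQFac_zero]
    · intro r hr
      rcases lt_or_gt_of_ne hr with h | h
      · simp [unitTerm, invQFac_of_neg τ h]
      · simp [unitTerm, invQFac_of_neg τ (show -r < 0 by omega)]
  change ∑' n : ℕ, e (τ * n ^ 2) * ∑' r, unitTerm τ n r = _ at h
  rw [tsum_eq_single 0 h0, h1, eq_inv_mul_iff_mul_eq₀ (eulerProd_ne_zero hτ)] at h
  rw [← (Equiv.neg ℤ).tsum_eq fun n : ℤ => (-1) ^ n * e (τ * (n * (3 * n + 1) / 2))]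
  simp only [Nat.cast_zero] at h
  rw [show e (τ * 0 ^ 2) = 1 by simp [e_zero], one_mul, mul_one] at h
  rw [h]
  refine tsum_congr fun r => ?_
  rw [signedQ, mul_left_comm, ← e_add, Equiv.neg_apply, zpow_neg, ← inv_zpow]
  push_cast
  norm_num
  left
  ring_nf

/-! ### Convergence of the mock theta series -/

lemma norm_inv_qPochhammer_le {a y : ℂ} {r : ℝ} (hr : r < 1) (ha : ‖a‖ ≤ r) (hy : ‖y‖ ≤ 1)
    (n : ℕ) : ‖(qPochhammer a y n)⁻¹‖ ≤ (1 - r)⁻¹ ^ n := by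
  rw [qPochhammer, norm_inv, norm_prod, inv_pow]
  have h1 : 0 < 1 - r := by linarith
  apply inv_anti₀ (by positivity)
  rw [← Finset.card_range n, ← Finset.prod_const, Finset.card_range]
  refine Finset.prod_le_prod (fun _ _ => h1.le) fun k _ => ?_
  have h2 : ‖a * y ^ k‖ ≤ r := by
    rw [norm_mul, norm_pow]
    calc ‖a‖ * ‖y‖ ^ k ≤ r * 1 :=
          mul_le_mul ha (pow_le_one₀ (norm_nonneg _) hy) (by positivity)
            ((norm_nonneg _).trans ha)
      _ = r := mul_one r
  have := norm_sub_norm_le 1 (a * y ^ k)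
  rw [norm_one] at this
  linarith

lemma qPochhammer_ne_zero {a y : ℂ} (ha : ‖a‖ < 1) (hy : ‖y‖ ≤ 1) (n : ℕ) :
    qPochhammer a y n ≠ 0 := by
  refine Finset.prod_ne_zero_iff.mpr fun k _ h => ?_
  have h2 : ‖a * y ^ k‖ < 1 := by
    rw [norm_mul, norm_pow]
    calc ‖a‖ * ‖y‖ ^ k ≤ ‖a‖ * 1 := by gcongr; exact pow_le_one₀ (norm_nonneg _) hy
      _ < 1 := by rwa [mul_one]
  rw [← sub_eq_zero.mp h, norm_one] at h2
  exact lt_irrefl _ h2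

/-- A common majorant for the series of `φ`, `ψ` and `ν`. -/
def mockBound (r : ℝ) (n : ℕ) : ℝ := r ^ n ^ 2 * (1 - r)⁻¹ ^ (n + 1)

lemma summable_mockBound {r : ℝ} (h0 : 0 ≤ r) (h1 : r < 1) : Summable (mockBound r) := by
  have hC : 0 < (1 - r)⁻¹ := inv_pos.mpr (by linarith)
  have hlim : Tendsto (fun n : ℕ => r ^ n * (1 - r)⁻¹) atTop (𝓝 (0 * (1 - r)⁻¹)) :=
    (tendsto_pow_atTop_nhds_zero_of_lt_one h0 h1).mul_const _
  rw [zero_mul] at hlim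
  have hev := hlim.eventually (ge_mem_nhds (show (0 : ℝ) < 1 / 2 by norm_num))
  refine Summable.of_norm_bounded_eventually_nat
    ((summable_geometric_of_lt_one (by norm_num) (show (1 / 2 : ℝ) < 1 by norm_num)).mul_right
      (1 - r)⁻¹) ?_
  filter_upwards [hev] with n hn
  rw [mockBound, Real.norm_of_nonneg (by positivity), pow_succ (1 - r)⁻¹, ← mul_assoc,
    show r ^ n ^ 2 = (r ^ n) ^ n by rw [sq, pow_mul], ← mul_pow]
  gcongr

lemma norm_mockPhiTerm_le {x : ℂ} {r : ℝ} (hr : r < 1) (hx : ‖x‖ ≤ r) (n : ℕ) :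
    ‖mockPhiTerm x n‖ ≤ mockBound r n := by
  have h0 : 0 ≤ r := (norm_nonneg _).trans hx
  have h1 : 0 < 1 - r := by linarith
  have h2 : ‖-x ^ 2‖ ≤ r := by
    rw [norm_neg, norm_pow]; nlinarith [norm_nonneg x]
  have h3 : ‖x ^ 2‖ ≤ 1 := by rw [norm_pow]; nlinarith [norm_nonneg x]
  rw [mockPhiTerm, div_eq_mul_inv, norm_mul, mockBound, norm_pow]
  gcongr
  refine (norm_inv_qPochhammer_le hr h2 h3 n).trans ?_
  exact pow_le_pow_right₀ ((one_le_inv₀ h1).mpr (by linarith)) (by omega)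

lemma norm_mockPsiTerm_le {x : ℂ} {r : ℝ} (hr : r < 1) (hx : ‖x‖ ≤ r) (n : ℕ) :
    ‖mockPsiTerm x n‖ ≤ mockBound r n := by
  have h0 : 0 ≤ r := (norm_nonneg _).trans hx
  have h3 : ‖x ^ 2‖ ≤ 1 := by rw [norm_pow]; nlinarith [norm_nonneg x]
  rw [mockPsiTerm, div_eq_mul_inv, norm_mul, mockBound, norm_pow]
  gcongr
  · calc ‖x‖ ^ (n + 1) ^ 2 ≤ r ^ (n + 1) ^ 2 := by gcongr
      _ ≤ r ^ n ^ 2 := pow_le_pow_of_le_one h0 hr.le (by gcongr; omega)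
  · exact norm_inv_qPochhammer_le hr hx h3 _

lemma norm_mockNuTerm_le {x : ℂ} {r : ℝ} (hr : r < 1) (hx : ‖x‖ ≤ r) (n : ℕ) :
    ‖mockNuTerm x n‖ ≤ mockBound r n := by
  have h0 : 0 ≤ r := (norm_nonneg _).trans hx
  have h3 : ‖x ^ 2‖ ≤ 1 := by rw [norm_pow]; nlinarith [norm_nonneg x]
  rw [mockNuTerm, div_eq_mul_inv, norm_mul, mockBound, norm_pow]
  gcongr
  · calc ‖x‖ ^ (n * (n + 1)) ≤ r ^ (n * (n + 1)) := by gcongr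
      _ ≤ r ^ n ^ 2 := pow_le_pow_of_le_one h0 hr.le (by nlinarith)
  · exact norm_inv_qPochhammer_le hr (by rwa [norm_neg]) h3 _

lemma summable_mockPhiTerm {x : ℂ} (hx : ‖x‖ < 1) : Summable (mockPhiTerm x) :=
  .of_norm_bounded (summable_mockBound (norm_nonneg x) hx) (norm_mockPhiTerm_le hx le_rfl)

lemma summable_mockPsiTerm {x : ℂ} (hx : ‖x‖ < 1) : Summable (mockPsiTerm x) :=
  .of_norm_bounded (summable_mockBound (norm_nonneg x) hx) (norm_mockPsiTerm_le hx le_rfl)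

lemma summable_mockNuTerm {x : ℂ} (hx : ‖x‖ < 1) : Summable (mockNuTerm x) :=
  .of_norm_bounded (summable_mockBound (norm_nonneg x) hx) (norm_mockNuTerm_le hx le_rfl)

lemma differentiableOn_tsum_mock {f : ℂ → ℕ → ℂ}
    (hf : ∀ n, DifferentiableOn ℂ (fun x => f x n) (Metric.ball 0 1))
    (hb : ∀ {x : ℂ} {r : ℝ}, r < 1 → ‖x‖ ≤ r → ∀ n, ‖f x n‖ ≤ mockBound r n) :
    DifferentiableOn ℂ (fun x => ∑' n, f x n) (Metric.ball 0 1) := by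
  intro x hx
  rw [mem_ball_zero_iff] at hx
  obtain ⟨r, hxr, hr⟩ := exists_between hx
  have h0 : 0 ≤ r := (norm_nonneg _).trans hxr.le
  have := Complex.differentiableOn_tsum_of_summable_norm (F := fun n x => f x n) (U := Metric.ball 0 r)
    (summable_mockBound h0 hr)
    (fun n => (hf n).mono (Metric.ball_subset_ball hr.le)) Metric.isOpen_ball
    (fun n w hw => hb hr (mem_ball_zero_iff.mp hw).le n)
  exact (this.differentiableAt (Metric.isOpen_ball.mem_nhds
    (mem_ball_zero_iff.mpr hxr))).differentiableWithinAt

lemma differentiable_qPochhammer_comp {a y : ℂ → ℂ} (ha : Differentiable ℂ a)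
    (hy : Differentiable ℂ y) (n : ℕ) : Differentiable ℂ fun x => qPochhammer (a x) (y x) n := by
  simp only [qPochhammer]
  fun_prop

lemma norm_sq_lt_one {x : ℂ} (hx : ‖x‖ < 1) : ‖x ^ 2‖ < 1 := by
  rw [norm_pow]; nlinarith [norm_nonneg x]

lemma differentiableOn_mockPhi : DifferentiableOn ℂ mockPhi (Metric.ball 0 1) := by
  refine differentiableOn_tsum_mock (fun n => ?_) fun hr hx n => norm_mockPhiTerm_le hr hx n
  refine DifferentiableOn.div (by fun_prop)
    (differentiable_qPochhammer_comp (by fun_prop) (by fun_prop) n).differentiableOn fun x hx => ?_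
  rw [mem_ball_zero_iff] at hx
  exact qPochhammer_ne_zero (by rw [norm_neg]; exact norm_sq_lt_one hx) (norm_sq_lt_one hx).le n

lemma differentiableOn_mockPsi : DifferentiableOn ℂ mockPsi (Metric.ball 0 1) := by
  refine differentiableOn_tsum_mock (fun n => ?_) fun hr hx n => norm_mockPsiTerm_le hr hx n
  refine DifferentiableOn.div (by fun_prop)
    (differentiable_qPochhammer_comp (by fun_prop) (by fun_prop) _).differentiableOn fun x hx => ?_
  rw [mem_ball_zero_iff] at hx
  exact qPochhammer_ne_zero hx (norm_sq_lt_one hx).le _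

lemma differentiableOn_mockNu : DifferentiableOn ℂ mockNu (Metric.ball 0 1) := by
  refine differentiableOn_tsum_mock (fun n => ?_) fun hr hx n => norm_mockNuTerm_le hr hx n
  refine DifferentiableOn.div (by fun_prop)
    (differentiable_qPochhammer_comp (by fun_prop) (by fun_prop) _).differentiableOn fun x hx => ?_
  rw [mem_ball_zero_iff] at hx
  exact qPochhammer_ne_zero (by rwa [norm_neg]) (norm_sq_lt_one hx).le _

/-! ### The mock theta functions as Appell–Lerch sums -/

lemma qPochhammer_succ (a y : ℂ) (n : ℕ) :
    qPochhammer a y (n + 1) = qPochhammer a y n * (1 - a * y ^ n) := Finset.prod_range_succ _ _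

lemma qPochhammer_succ' (a y : ℂ) (n : ℕ) :
    qPochhammer a y (n + 1) = (1 - a) * qPochhammer (a * y) y n := by
  rw [qPochhammer, Finset.prod_range_succ', mul_comm, qPochhammer]
  congr 1
  · simp
  · exact Finset.prod_congr rfl fun k _ => by ring

lemma qPochhammer_mul_neg (a y : ℂ) (n : ℕ) :
    qPochhammer a y n * qPochhammer (-a) y n = qPochhammer (a ^ 2) (y ^ 2) n := by
  rw [qPochhammer, qPochhammer, ← Finset.prod_mul_distrib, qPochhammer]
  exact Finset.prod_congr rfl fun k _ => by ring

lemma e_tau_sq (τ : ℂ) (n : ℕ) : e (τ * n ^ 2) = e τ ^ n ^ 2 := by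
  rw [e_pow]; push_cast; ring_nf

/-- At `z = i` the product `(iq;q)_n (-iq;q)_n` collapses to `(-q²;q²)_n`. -/
theorem mockPhi_eq_appell {τ : ℂ} (hτ : 0 < τ.im)
    (hu : ∀ r : ℤ, 1 - e (1 / 4 + r * τ) ≠ 0) :
    mockPhi (e τ) = (1 - Complex.I) / eulerProd τ * appell τ (1 / 4) := by
  rw [← e_quarter, ← tsum_rank hτ hu, mockPhi]
  refine tsum_congr fun n => ?_
  rw [mockPhiTerm, e_tau_sq, e_add, e_sub, e_quarter, Complex.div_I,
    show -(e τ * Complex.I) = -(Complex.I * e τ) by ring, qPochhammer_mul_neg, mul_pow,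
    Complex.I_sq, neg_one_mul]

lemma qPochhammer_odd (x : ℂ) (m : ℕ) : qPochhammer x (x ^ 2) (2 * m + 1) =
    (1 - x) * (qPochhammer (x ^ 5) (x ^ 4) m * qPochhammer (x ^ 3) (x ^ 4) m) := by
  induction m with
  | zero => simp [qPochhammer]
  | succ m ih =>
    rw [show 2 * (m + 1) + 1 = 2 * m + 1 + 1 + 1 by ring, qPochhammer_succ, qPochhammer_succ, ih,
      qPochhammer_succ, qPochhammer_succ]
    ring

/-- The `1` is the missing term `n = 0` of `∑ x^{n²} / (x;x²)_n`, where `x = e u`. The terms `2m`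
and `2m + 1` add up to `x^{4m²} / (x;x²)_{2m+1}`, which by `qPochhammer_odd` is `1 / (1 - x)` times
the rank summand with base `x⁴` and `z = x`. -/
theorem one_add_mockPsi_eq_appell {τ u : ℂ} (hτ : 0 < τ.im) (h4 : e u ^ 4 = e τ)
    (hu : ∀ r : ℤ, 1 - e (u + r * τ) ≠ 0) :
    1 + mockPsi (e u) = appell τ u / eulerProd τ := by
  have hx : ‖e u‖ < 1 := by
    have h := norm_e_lt_one hτ
    rw [← h4, norm_pow] at h
    by_contra h'
    exact absurd (one_le_pow₀ (not_lt.mp h')) (not_le.mpr h)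
  have h1 : 1 - e u ≠ 0 := by simpa using hu 0
  set x := e u with hxdef
  set b : ℕ → ℂ := fun n => x ^ n ^ 2 / qPochhammer x (x ^ 2) n with hb
  have hbs : Summable b := (summable_nat_add_iff 1).mp (summable_mockPsiTerm hx)
  have hb1 : 1 + mockPsi x = ∑' n, b n := by
    rw [hbs.tsum_eq_zero_add]
    simp [hb, qPochhammer, mockPsi, mockPsiTerm]
  have hev : Summable fun m => b (2 * m) :=
    hbs.comp_injective (mul_right_injective₀ (two_ne_zero))
  have hod : Summable fun m => b (2 * m + 1) :=
    hbs.comp_injective ((add_left_injective 1).comp (mul_right_injective₀ (two_ne_zero)))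
  rw [hb1, ← tsum_even_add_odd hev hod, ← hev.tsum_add hod]
  have hr := tsum_rank hτ hu
  rw [div_mul_eq_mul_div, mul_div_assoc, ← hxdef] at hr
  apply mul_left_cancel₀ h1
  rw [← hr, ← tsum_mul_left]
  refine tsum_congr fun m => ?_
  have hne : ∀ n, qPochhammer x (x ^ 2) n ≠ 0 := qPochhammer_ne_zero hx (norm_sq_lt_one hx).le
  have hm := hne (2 * m + 1)
  have h2m := hne (2 * m)
  have e1 : e (u + τ) = x ^ 5 := by rw [e_add, ← h4]; ring
  have e2 : e (τ - u) = x ^ 3 := by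
    rw [e_sub, ← h4, ← hxdef]; have : x ≠ 0 := e_ne_zero u
    field_simp
  rw [e_tau_sq, e1, e2, ← h4]
  have h3 := qPochhammer_odd x m
  have h5 := qPochhammer_succ x (x ^ 2) (2 * m)
  have h6 : b (2 * m) = x ^ (2 * m) ^ 2 * (1 - x * (x ^ 2) ^ (2 * m)) /
      qPochhammer x (x ^ 2) (2 * m + 1) := by
    rw [h5, hb, mul_div_mul_right]
    intro h; apply hm; rw [h5, h, mul_zero]
  rw [h6, hb]
  simp only
  rw [← add_div, h3]
  rw [h3] at hm
  have h7 := right_ne_zero_of_mul hm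
  rw [show x ^ (2 * m) ^ 2 * (1 - x * (x ^ 2) ^ (2 * m)) + x ^ (2 * m + 1) ^ 2 =
    (x ^ 4) ^ m ^ 2 by
      rw [show x ^ (2 * m + 1) ^ 2 = x ^ (2 * m) ^ 2 * (x * (x ^ 2) ^ (2 * m)) by ring]
      ring]
  field_simp

/-- Here `q / z = -z`, so the rank summand is `(1 - z) q^{n²} (1 + z q^n) / (-q;q²)_{n+1}`. The part
with `z q^n` sums to `zν`; the other part is `b n - b (n + 1)` and telescopes to 1. -/
theorem one_add_mockNu_eq_appell {τ u : ℂ} (hτ : 0 < τ.im) (h2 : e u ^ 2 = -e τ)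
    (hu : ∀ r : ℤ, 1 - e (u + r * τ) ≠ 0) :
    1 + e u * mockNu (e τ) = appell τ u / eulerProd τ := by
  have hx := norm_e_lt_one hτ
  have h1 : 1 - e u ≠ 0 := by simpa using hu 0
  have hr := tsum_rank hτ hu
  rw [div_mul_eq_mul_div, mul_div_assoc] at hr
  apply mul_left_cancel₀ h1
  rw [← hr]
  set x := e τ with hxdef
  set z := e u with hzdef
  have hz0 : z ≠ 0 := e_ne_zero u
  have hne : ∀ n, qPochhammer (-x) (x ^ 2) n ≠ 0 :=
    qPochhammer_ne_zero (by rwa [norm_neg]) (norm_sq_lt_one hx).le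
  set b : ℕ → ℂ := fun n => x ^ n ^ 2 / qPochhammer (-x) (x ^ 2) n with hb
  have hbs : Summable b := by
    refine Summable.of_norm_bounded (summable_mockBound (norm_nonneg x) hx) fun n => ?_
    have h0 : 0 < 1 - ‖x‖ := by linarith
    rw [hb]
    simp only
    rw [div_eq_mul_inv, norm_mul, mockBound, norm_pow]
    gcongr
    refine (norm_inv_qPochhammer_le hx (by rw [norm_neg]) (norm_sq_lt_one hx).le n).trans ?_
    exact pow_le_pow_right₀ ((one_le_inv₀ h0).mpr (by linarith [norm_nonneg x])) (by omega)
  have hb1 : Summable fun n => b (n + 1) := (summable_nat_add_iff 1).mpr hbs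
  have hone : ∑' n, (b n - b (n + 1)) = 1 := by
    rw [hbs.tsum_sub hb1, hbs.tsum_eq_zero_add]
    simp [hb, qPochhammer]
  have hsplit : 1 + z * mockNu x = ∑' n, (b n - b (n + 1) + z * mockNuTerm x n) := by
    rw [(hbs.sub hb1).tsum_add ((summable_mockNuTerm hx).mul_left z), hone, tsum_mul_left, mockNu]
  rw [hsplit, ← tsum_mul_left]
  refine tsum_congr fun n => ?_
  have e1 : e (u + τ) = z * x := e_add _ _
  have e2 : e (τ - u) = -z := by rw [e_sub, ← hzdef, ← hxdef, div_eq_iff hz0]; linear_combination h2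
  rw [e_tau_sq, e1, e2, ← hxdef]
  have h3 := qPochhammer_mul_neg z x (n + 1)
  rw [h2, qPochhammer_succ' z x n, qPochhammer_succ (-z) x n] at h3
  have h4 := hne (n + 1)
  have h5 := qPochhammer_succ (-x) (x ^ 2) n
  have h6 : b n = x ^ n ^ 2 * (1 - -x * (x ^ 2) ^ n) / qPochhammer (-x) (x ^ 2) (n + 1) := by
    rw [h5, hb, mul_div_mul_right]
    intro h; apply h4; rw [h5, h, mul_zero]
  have h8 : b (n + 1) = x ^ n ^ 2 * (x * (x ^ 2) ^ n) / qPochhammer (-x) (x ^ 2) (n + 1) := by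
    rw [hb]; ring_nf
  have h9 : mockNuTerm x n = x ^ n ^ 2 * x ^ n / qPochhammer (-x) (x ^ 2) (n + 1) := by
    rw [mockNuTerm]; ring
  rw [show 1 - -z * x ^ n = 1 + z * x ^ n by ring] at h3
  rw [h6, h8, h9, ← h3]
  rw [← h3] at h4
  have h10 := left_ne_zero_of_mul (right_ne_zero_of_mul h4)
  have h11 := right_ne_zero_of_mul (right_ne_zero_of_mul h4)
  have h12 := right_ne_zero_of_mul (left_ne_zero_of_mul h4)
  field_simp
  ring

/-! ### The modular completion of the Appell–Lerch sum. -/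

/-! ### The principal square root -/

lemma csqrt_sq (z : ℂ) : csqrt z ^ 2 = z := by
  rw [csqrt, ← Complex.cpow_nat_mul]; simp

lemma csqrt_of_sq {w : ℂ} (hw : 0 < w.re) : csqrt (w ^ 2) = w := by
  have := Complex.sq_cpow_two_inv hw
  rw [csqrt, one_div]
  simpa using this

/-- A positive real part singles out the principal root; branch questions below are settled by this
criterion. -/
lemma csqrt_eq {z w : ℂ} (h : w ^ 2 = z) (hw : 0 < w.re) : csqrt z = w := by
  rw [← h, csqrt_of_sq hw]

lemma csqrt_ne_zero {z : ℂ} (hz : z ≠ 0) : csqrt z ≠ 0 := by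
  intro h
  have := csqrt_sq z
  rw [h] at this
  exact hz (by rw [← this]; simp)

lemma re_csqrt_pos {z : ℂ} (hz : z ∈ Complex.slitPlane) : 0 < (csqrt z).re := by
  have hz0 := Complex.slitPlane_ne_zero hz
  rw [csqrt, Complex.cpow_def_of_ne_zero hz0, Complex.exp_re]
  refine mul_pos (Real.exp_pos _) (Real.cos_pos_of_mem_Ioo ?_)
  have h1 := Complex.neg_pi_lt_arg z
  have h2 := lt_of_le_of_ne (Complex.arg_le_pi z) (Complex.slitPlane_arg_ne_pi hz)
  have : (Complex.log z * (1 / 2)).im = Complex.arg z / 2 := by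
    rw [show (1 / 2 : ℂ) = ((1 / 2 : ℝ) : ℂ) by norm_num, Complex.im_mul_ofReal, Complex.log_im]
    ring
  rw [this]
  constructor <;> linarith

lemma csqrt_real_mul {c : ℝ} (hc : 0 < c) {z : ℂ} (hz : z ∈ Complex.slitPlane) :
    csqrt (c * z) = (√c : ℝ) * csqrt z := by
  refine csqrt_eq ?_ ?_
  · rw [mul_pow, csqrt_sq, ← Complex.ofReal_pow, Real.sq_sqrt hc.le]
  · rw [Complex.re_ofReal_mul]
    exact mul_pos (Real.sqrt_pos.mpr hc) (re_csqrt_pos hz)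

lemma neg_I_mul_mem_slitPlane {τ : ℂ} (hτ : 0 < τ.im) : -Complex.I * τ ∈ Complex.slitPlane := by
  left; simpa using hτ

/-! ### The Gaussian error function -/

/-- `2 ∫₀ˣ exp(-πt²) dt`. -/
def gaussErf (x : ℝ) : ℝ := 2 * ∫ t in (0 : ℝ)..x, Real.exp (-Real.pi * t ^ 2)

lemma hasDerivAt_gaussErf (x : ℝ) :
    HasDerivAt gaussErf (2 * Real.exp (-Real.pi * x ^ 2)) x := by
  have hc : Continuous fun t : ℝ => Real.exp (-Real.pi * t ^ 2) := by fun_prop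
  exact (intervalIntegral.integral_hasDerivAt_right (hc.intervalIntegrable _ _)
    (hc.stronglyMeasurableAtFilter _ _) hc.continuousAt).const_mul 2

lemma gaussErf_neg (x : ℝ) : gaussErf (-x) = -gaussErf x := by
  have := intervalIntegral.integral_comp_neg (a := 0) (b := x)
    (fun t : ℝ => Real.exp (-Real.pi * t ^ 2))
  simp only [even_two, Even.neg_pow, neg_zero] at this
  rw [gaussErf, gaussErf, intervalIntegral.integral_symm, ← this]
  ring

lemma integrable_gaussian : MeasureTheory.Integrable fun t : ℝ => Real.exp (-Real.pi * t ^ 2) :=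
  integrable_exp_neg_mul_sq Real.pi_pos

lemma one_sub_gaussErf (x : ℝ) :
    1 - gaussErf x = 2 * ∫ t in Set.Ioi x, Real.exp (-Real.pi * t ^ 2) := by
  have h0 : ∫ t in Set.Ioi (0 : ℝ), Real.exp (-Real.pi * t ^ 2) = 1 / 2 := by
    rw [integral_gaussian_Ioi, div_self Real.pi_ne_zero, Real.sqrt_one]
  have h1 := intervalIntegral.integral_interval_add_Ioi
    (integrable_gaussian.integrableOn (s := Set.Ioi 0))
    (integrable_gaussian.integrableOn (s := Set.Ioi x))
  rw [h0] at h1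
  rw [gaussErf]
  linarith

lemma one_sub_gaussErf_nonneg (x : ℝ) : 0 ≤ 1 - gaussErf x := by
  rw [one_sub_gaussErf]
  exact mul_nonneg zero_le_two (MeasureTheory.integral_nonneg fun t => (Real.exp_pos _).le)

/-- Write `-t² = s² - 2st - (t - s)²` and use `t ≥ x` in the linear term. The free parameter `s` is
later proportional to `n`, so that the bound beats the growing exponentials of the series. -/
lemma one_sub_gaussErf_le (x : ℝ) {s : ℝ} (hs : 0 ≤ s) :
    1 - gaussErf x ≤ 2 * Real.exp (Real.pi * s ^ 2 - 2 * Real.pi * s * x) := by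
  rw [one_sub_gaussErf]
  gcongr
  have hint : MeasureTheory.Integrable fun t : ℝ =>
      Real.exp (Real.pi * s ^ 2 - 2 * Real.pi * s * x) * Real.exp (-Real.pi * (t - s) ^ 2) :=
    (integrable_gaussian.comp_sub_right s).const_mul _
  calc ∫ t in Set.Ioi x, Real.exp (-Real.pi * t ^ 2)
      ≤ ∫ t in Set.Ioi x, Real.exp (Real.pi * s ^ 2 - 2 * Real.pi * s * x) *
          Real.exp (-Real.pi * (t - s) ^ 2) := by
        refine MeasureTheory.setIntegral_mono_on integrable_gaussian.integrableOn
          hint.integrableOn measurableSet_Ioi fun t ht => ?_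
        rw [← Real.exp_add]
        apply Real.exp_le_exp.mpr
        have : 0 ≤ Real.pi * s * (t - x) :=
          mul_nonneg (mul_nonneg Real.pi_pos.le hs) (sub_nonneg.mpr (le_of_lt ht))
        nlinarith
    _ ≤ ∫ t, Real.exp (Real.pi * s ^ 2 - 2 * Real.pi * s * x) *
          Real.exp (-Real.pi * (t - s) ^ 2) :=
        MeasureTheory.setIntegral_le_integral hint
          (Eventually.of_forall fun t => by positivity)
    _ = Real.exp (Real.pi * s ^ 2 - 2 * Real.pi * s * x) := by
        rw [MeasureTheory.integral_const_mul,
          MeasureTheory.integral_sub_right_eq_self (fun t => Real.exp (-Real.pi * t ^ 2)),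
          integral_gaussian, div_self Real.pi_ne_zero, Real.sqrt_one, mul_one]

/-- `sgn n - E x`, the coefficient of the period integral of a unary theta function. -/
def signErf (n : ℤ) (x : ℝ) : ℝ := n.sign - gaussErf x

lemma signErf_neg (n : ℤ) (x : ℝ) : signErf (-n) (-x) = -signErf n x := by
  rw [signErf, signErf, gaussErf_neg, Int.sign_neg]; push_cast; ring

/-- The tail bound with `s = |n| k`, negative `n` being reduced to positive by oddness. The sign of
`x` is irrelevant: when it opposes that of `n` the bound is merely large. -/
lemma abs_signErf_le {n : ℤ} (hn : n ≠ 0) (x : ℝ) {k : ℝ} (hk : 0 ≤ k) :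
    |signErf n x| ≤ 2 * Real.exp (Real.pi * (n * k) ^ 2 - 2 * Real.pi * (n * k) * x) := by
  have pos : ∀ {n : ℤ} {x : ℝ}, 0 < n →
      |signErf n x| ≤ 2 * Real.exp (Real.pi * (n * k) ^ 2 - 2 * Real.pi * (n * k) * x) := by
    intro n x h
    rw [signErf, Int.sign_eq_one_of_pos h, Int.cast_one, abs_of_nonneg (one_sub_gaussErf_nonneg x)]
    exact one_sub_gaussErf_le x (mul_nonneg (by exact_mod_cast h.le) hk)
  rcases lt_or_gt_of_ne hn with h | h
  · have := pos (n := -n) (x := -x) (by omega)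
    rw [signErf_neg, abs_neg] at this
    refine this.trans (le_of_eq ?_)
    push_cast
    ring_nf
  · exact pos h

/-! ### The character `(12/·)` and its theta function -/

/-- The Kronecker symbol `(12/n)`. -/
def chi (n : ℤ) : ℂ :=
  if n % 12 = 1 ∨ n % 12 = 11 then 1 else if n % 12 = 5 ∨ n % 12 = 7 then -1 else 0

lemma norm_chi_le (n : ℤ) : ‖chi n‖ ≤ 1 := by
  rw [chi]; split_ifs <;> simp

lemma chi_neg (n : ℤ) : chi (-n) = chi n := by
  simp only [chi]
  congr 1
  · ext; omega
  · congr 1; ext; omega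

lemma chi_sub_six (n : ℤ) : chi (n - 6) = -chi n := by
  simp only [chi]
  split_ifs <;> first | omega | simp

lemma chi_zero : chi 0 = 0 := by simp [chi]

lemma chi_eq_zero_of_even {n : ℤ} (h : Even n) : chi n = 0 := by
  rw [chi, if_neg, if_neg] <;> grind

lemma e_twelfth_pow_six : e (1 / 12) ^ 6 = -1 := by
  rw [e_pow, ← e_half]; norm_num

lemma e_twelfth_sub : e (1 / 12) - e (1 / 12) ^ 5 = (√3 : ℝ) := by
  have h1 : e (1 / 12) = (√3 / 2 : ℝ) + (1 / 2 : ℝ) * Complex.I := by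
    rw [e, show 2 * (Real.pi : ℂ) * Complex.I * (1 / 12) = ((Real.pi / 6 : ℝ) : ℂ) * Complex.I by
      push_cast; ring, Complex.exp_mul_I, ← Complex.ofReal_cos, ← Complex.ofReal_sin,
      Real.cos_pi_div_six, Real.sin_pi_div_six]
  have h2 : ((√3 : ℝ) : ℂ) ^ 2 = 3 := by
    rw [← Complex.ofReal_pow, Real.sq_sqrt (by norm_num)]; norm_num
  have h3 : e (1 / 12) * ((√3 : ℝ) - e (1 / 12)) = 1 := by
    rw [h1]; push_cast
    linear_combination (1 / 4 : ℂ) * h2 - (1 / 4 : ℂ) * Complex.I_sq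
  have h4 := e_twelfth_pow_six
  have h5 := e_ne_zero (1 / 12)
  apply mul_left_cancel₀ h5
  linear_combination -h3 - h4

/-- The even primitive character modulo 12 is its own finite Fourier transform, with Gauss sum `√12
= 2√3`. -/
lemma chi_gauss (n : ℤ) : chi n * (2 * (√3 : ℝ)) =
    e (n * (1 / 12)) - e (n * (5 / 12)) - e (n * (7 / 12)) + e (n * (11 / 12)) := by
  have h6 := e_twelfth_pow_six
  rw [← e_twelfth_sub]
  obtain ⟨r, hr, hr0, hr12⟩ : ∃ r : ℤ, n % 12 = r ∧ 0 ≤ r ∧ r < 12 := ⟨n % 12, rfl, by omega, by omega⟩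
  obtain ⟨m, rfl⟩ : ∃ m : ℤ, n = 12 * m + r := ⟨n / 12, by omega⟩
  lift r to ℕ using hr0
  have key : ∀ k : ℕ, e (((12 * m + (r : ℤ) : ℤ) : ℂ) * (k / 12)) = (e (1 / 12) ^ r) ^ k := by
    intro k
    rw [← pow_mul, e_pow]
    refine e_eq_of_sub_int (m * k) ?_
    push_cast; ring
  have k1 := key 1
  have k5 := key 5
  have k7 := key 7
  have k11 := key 11
  push_cast at k1 k5 k7 k11
  rw [chi, hr]
  push_cast
  rw [k1, k5, k7, k11]
  generalize e (1 / 12) = ζ at h6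
  have hr' : r < 12 := by exact_mod_cast hr12
  clear key k1 k5 k7 k11 hr hr12
  -- With `w = ζ^r` one has `w⁶ = (-1)^r`, so even residues give 0 and odd ones `2(w - w⁵)`.
  have ev : ∀ w : ℂ, w ^ 6 = 1 → w ^ 1 - w ^ 5 - w ^ 7 + w ^ 11 = 0 := fun w h => by
    linear_combination (w ^ 5 - w) * h
  have od : ∀ w : ℂ, w ^ 6 = -1 → w ^ 1 - w ^ 5 - w ^ 7 + w ^ 11 = 2 * (w - w ^ 5) := fun w h => by
    linear_combination (w ^ 5 - w) * h
  have h12 : ζ ^ 12 = 1 := by linear_combination (ζ ^ 6 - 1) * h6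
  rcases Nat.even_or_odd' r with ⟨s, rfl | rfl⟩
  · rw [ev _ (by rw [← pow_mul, show 2 * s * 6 = 12 * s by ring, pow_mul, h12, one_pow]),
      if_neg (by omega), if_neg (by omega), zero_mul]
  · rw [od _ (by rw [← pow_mul, show (2 * s + 1) * 6 = 12 * s + 6 by ring, pow_add, pow_mul, h12,
      one_pow, one_mul, h6])]
    have hs : s < 6 := by omega
    interval_cases s
    · norm_num
    · norm_num; linear_combination -ζ ^ 3 * h12
    · norm_num; linear_combination 2 * (ζ + ζ ^ 13) * h12
    · norm_num; linear_combination (2 * ζ ^ 11 * (1 + ζ ^ 12)) * h12 + (-2 * ζ + 2 * ζ ^ 5) * h6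
    · norm_num; linear_combination -(ζ ^ 9 * (1 + ζ ^ 12 + ζ ^ 24)) * h12
    · norm_num
      linear_combination (ζ ^ 7 * (1 + ζ ^ 12 + ζ ^ 24 + ζ ^ 36)) * h12 + (ζ - ζ ^ 5) * h6

/-- The theta function `∑ (12/n) q^{n²/24} z^{n/2}`. -/
def thetaChi (τ u : ℂ) : ℂ := ∑' n : ℤ, chi n * e (τ * (n ^ 2 / 24) + n * (u / 2))

lemma jacobiTheta₂_term_eq_e (n : ℤ) (z τ : ℂ) :
    jacobiTheta₂_term n z τ = e (n * z + n ^ 2 * τ / 2) := by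
  rw [jacobiTheta₂_term, e]; congr 1; ring

/-- The classes are written as `-k` because a shift by `k / 12` reappears in this form after Jacobi
inversion. -/
lemma tsum_chi_mul {f : ℤ → ℂ} (hf : Summable f) : ∑' n, chi n * f n =
    ∑' m : ℤ, f (12 * m - 1) - ∑' m : ℤ, f (12 * m - 5) - ∑' m : ℤ, f (12 * m - 7) +
      ∑' m : ℤ, f (12 * m - 11) := by
  set g : ℤ → ℤ → ℂ := fun k n => if (12 : ℤ) ∣ n + k then f n else 0 with hg
  have hgs : ∀ k, Summable (g k) := fun k => by
    refine Summable.of_norm_bounded hf.norm fun n => ?_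
    rw [hg]; simp only; split_ifs <;> simp
  have hgt : ∀ k, ∑' m : ℤ, f (12 * m - k) = ∑' n, g k n := by
    intro k
    have hinj : Function.Injective fun m : ℤ => 12 * m - k := fun a b h => by
      simp only at h; omega
    rw [← hinj.tsum_eq (f := g k)]
    · refine tsum_congr fun m => ?_
      rw [hg]; simp only
      rw [if_pos ⟨m, by ring⟩]
    · intro n hn
      by_contra h
      apply hn
      rw [hg]; simp only
      rw [if_neg]
      rintro ⟨m, hm⟩
      exact h ⟨m, by simp only; omega⟩
  rw [hgt, hgt, hgt, hgt, ← (hgs 1).tsum_sub (hgs 5), ← ((hgs 1).sub (hgs 5)).tsum_sub (hgs 7),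
    ← (((hgs 1).sub (hgs 5)).sub (hgs 7)).tsum_add (hgs 11)]
  refine tsum_congr fun n => ?_
  simp only [hg, chi]
  split_ifs <;> first | omega | simp

lemma summable_e_quadratic {τ : ℂ} (hτ : 0 < τ.im) (z : ℂ) :
    Summable fun n : ℤ => e (n * z + n ^ 2 * τ / 2) := by
  have := (hasSum_jacobiTheta₂_term z hτ).summable
  simpa only [jacobiTheta₂_term_eq_e] using this

lemma thetaChi_eq_jacobi {τ : ℂ} (hτ : 0 < τ.im) (u : ℂ) : thetaChi τ u * (2 * (√3 : ℝ)) =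
    jacobiTheta₂ (u / 2 + 1 / 12) (τ / 12) - jacobiTheta₂ (u / 2 + 5 / 12) (τ / 12) -
    jacobiTheta₂ (u / 2 + 7 / 12) (τ / 12) + jacobiTheta₂ (u / 2 + 11 / 12) (τ / 12) := by
  have hτ' : 0 < (τ / 12).im := by
    rw [show τ / 12 = ((1 / 12 : ℝ) : ℂ) * τ by push_cast; ring, Complex.im_ofReal_mul]; positivity
  have hs := fun z => hasSum_jacobiTheta₂_term z hτ'
  have h := (((hs (u / 2 + 1 / 12)).sub (hs (u / 2 + 5 / 12))).sub (hs (u / 2 + 7 / 12))).add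
    (hs (u / 2 + 11 / 12))
  rw [← h.tsum_eq, thetaChi, ← tsum_mul_right]
  refine tsum_congr fun n => ?_
  simp only [jacobiTheta₂_term_eq_e]
  rw [mul_right_comm, chi_gauss]
  have : ∀ c : ℂ, e (n * (u / 2 + c) + n ^ 2 * (τ / 12) / 2) =
      e (n * c) * e (τ * (n ^ 2 / 24) + n * (u / 2)) := fun c => by rw [← e_add]; ring_nf
  rw [this, this, this, this]
  ring

/-- The Gauss sum writes the series as four Jacobi theta functions at shifts `k / 12`. Inversion
turns each shift into the residue class `-k` modulo 12, and the four classes reassemble into the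
character. -/
theorem thetaChi_S {τ : ℂ} (hτ : 0 < τ.im) (u : ℂ) : thetaChi (-1 / τ) (u / τ) =
    csqrt (-Complex.I * τ) * e (3 * u ^ 2 / (2 * τ)) * thetaChi τ u := by
  have hτ0 : τ ≠ 0 := by rintro rfl; simp at hτ
  have hinv : 0 < (-1 / τ).im := by
    rw [neg_div, Complex.neg_im, one_div, Complex.inv_im, neg_div, neg_neg]
    exact div_pos hτ (Complex.normSq_pos.mpr hτ0)
  have h3 : (√3 : ℝ) ≠ 0 := by positivity
  have hsq : csqrt (-Complex.I * τ) = 2 * (√3 : ℝ) * csqrt (-Complex.I * (τ / 12)) := by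
    have := csqrt_real_mul (c := 1 / 12) (by norm_num) (neg_I_mul_mem_slitPlane hτ)
    rw [show ((1 / 12 : ℝ) : ℂ) * (-Complex.I * τ) = -Complex.I * (τ / 12) by push_cast; ring] at this
    have h12 : √(1 / 12 : ℝ) * (2 * √3) = 1 := by
      rw [show (1 / 12 : ℝ) = 1 / (2 ^ 2 * 3) by norm_num, Real.sqrt_div (by norm_num),
        Real.sqrt_mul (by norm_num), Real.sqrt_sq (by norm_num), Real.sqrt_one]
      field_simp
    rw [this, ← mul_assoc, mul_comm (2 * ((√3 : ℝ) : ℂ))]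
    have h12' : ((√(1 / 12 : ℝ) : ℝ) : ℂ) * (2 * (√3 : ℝ)) = 1 := by exact_mod_cast h12
    rw [h12', one_mul]
  have hs0 : csqrt (-Complex.I * (τ / 12)) ≠ 0 := by
    apply csqrt_ne_zero
    simp [hτ0]
  set f : ℤ → ℂ := fun n => e (-1 / τ * (n ^ 2 / 24) + n * (u / τ / 2)) with hf
  have hfs : Summable f := by
    refine (summable_e_quadratic (τ := -1 / τ / 12) ?_ (u / τ / 2)).congr fun n => ?_
    · rw [show -1 / τ / 12 = ((1 / 12 : ℝ) : ℂ) * (-1 / τ) by push_cast; ring,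
        Complex.im_ofReal_mul]
      positivity
    · rw [hf]; simp only; congr 1; ring
  have key : ∀ k : ℤ, csqrt (-Complex.I * (τ / 12)) * e (3 * u ^ 2 / (2 * τ)) *
      jacobiTheta₂ (u / 2 + k / 12) (τ / 12) = ∑' m : ℤ, f (12 * m - k) := by
    intro k
    rw [jacobiTheta₂_functional_equation]
    change csqrt _ * _ * (1 / csqrt _ * _ * _) = _
    rw [show ∀ a b c d : ℂ, a * b * (1 / a * c * d) = a / a * (b * c) * d from fun a b c d => by ring,
      div_self hs0, one_mul, jacobiTheta₂, ← tsum_mul_left]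
    refine tsum_congr fun m => ?_
    rw [show Complex.exp (-Real.pi * Complex.I * (u / 2 + k / 12) ^ 2 / (τ / 12)) =
      e (-6 * (u / 2 + k / 12) ^ 2 / τ) by rw [e]; congr 1; field_simp; ring,
      jacobiTheta₂_term_eq_e, ← e_add, ← e_add, hf]
    simp only
    congr 1
    push_cast
    field_simp
    ring
  have hmain := tsum_chi_mul hfs
  have k1 := key 1
  have k5 := key 5
  have k7 := key 7
  have k11 := key 11
  rw [← k1, ← k5, ← k7, ← k11] at hmain
  have hjac := thetaChi_eq_jacobi hτ u
  rw [thetaChi, hsq]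
  push_cast at hmain
  rw [hmain]
  linear_combination -csqrt (-Complex.I * (τ / 12)) * e (3 * u ^ 2 / (2 * τ)) * hjac

/-- On its support `n = 6m ± 1` the character is `(-1)^m`, the sign of the pentagonal number series.
-/
lemma tsum_int_six_split {f : ℤ → ℂ} (hf : Summable f) : ∑' n, chi n * f n =
    ∑' m : ℤ, (-1) ^ m * f (6 * m + 1) + ∑' m : ℤ, (-1) ^ m * f (6 * m - 1) := by
  set g : ℤ → ℤ → ℂ := fun k n => if (6 : ℤ) ∣ n - k then chi n * f n else 0 with hg
  have hcf : Summable fun n => chi n * f n :=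
    Summable.of_norm_bounded hf.norm fun n => by
      rw [norm_mul]; exact mul_le_of_le_one_left (norm_nonneg _) (norm_chi_le n)
  have hgs : ∀ k, Summable (g k) := fun k => by
    refine Summable.of_norm_bounded hcf.norm fun n => ?_
    rw [hg]; simp only; split_ifs
    · exact le_rfl
    · rw [norm_zero]; exact norm_nonneg _
  have hgt : ∀ k : ℤ, (∀ m : ℤ, chi (6 * m + k) = (-1) ^ m) →
      ∑' m : ℤ, (-1) ^ m * f (6 * m + k) = ∑' n, g k n := by
    intro k hk
    have hinj : Function.Injective fun m : ℤ => 6 * m + k := fun a b h => by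
      simp only at h; omega
    rw [← hinj.tsum_eq (f := g k)]
    · refine tsum_congr fun m => ?_
      rw [hg]; simp only
      rw [if_pos ⟨m, by ring⟩, hk]
    · intro n hn
      by_contra h
      apply hn
      rw [hg]; simp only
      rw [if_neg]
      rintro ⟨m, hm⟩
      exact h ⟨m, by simp only; omega⟩
  have hpow : ∀ k : ℤ, k = 1 ∨ k = -1 → ∀ m : ℤ, chi (6 * m + k) = (-1) ^ m := by
    intro k hk m
    rw [chi]
    rcases Int.even_or_odd' m with ⟨j, rfl | rfl⟩
    · rw [if_pos (by omega), zpow_mul]; simp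
    · rw [if_neg (by omega), if_pos (by omega), zpow_add₀ (by norm_num), zpow_mul]; simp
  have h1 := hgt 1 (hpow 1 (Or.inl rfl))
  have h2 := hgt (-1) (hpow (-1) (Or.inr rfl))
  simp only [← sub_eq_add_neg] at h2
  rw [h1, h2, ← (hgs 1).tsum_add (hgs (-1))]
  refine tsum_congr fun n => ?_
  simp only [hg]
  by_cases a : (6 : ℤ) ∣ n - 1
  · rw [if_pos a, if_neg (by omega), add_zero]
  · by_cases b : (6 : ℤ) ∣ n - -1
    · rw [if_neg a, if_pos b, zero_add]
    · rw [if_neg a, if_neg b, chi, if_neg (by omega), if_neg (by omega)]; simp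

/-- The Dedekind eta function. -/
def etaFn (τ : ℂ) : ℂ := e (τ / 24) * eulerProd τ

lemma etaFn_ne_zero {τ : ℂ} (hτ : 0 < τ.im) : etaFn τ ≠ 0 :=
  mul_ne_zero (e_ne_zero _) (eulerProd_ne_zero hτ)

/-- Since `(6m ± 1)² / 24 = m(3m ± 1)/2 + 1/24`, each of the two classes modulo 6 gives one
pentagonal series. -/
lemma thetaChi_zero {τ : ℂ} (hτ : 0 < τ.im) : thetaChi τ 0 = 2 * etaFn τ := by
  have hs : Summable fun n : ℤ => e (τ * (n ^ 2 / 24) + n * (0 / 2)) := by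
    refine (summable_e_quadratic (τ := τ / 12) ?_ 0).congr fun n => ?_
    · rw [show τ / 12 = ((1 / 12 : ℝ) : ℂ) * τ by push_cast; ring, Complex.im_ofReal_mul]; positivity
    · congr 1; ring
  have h2 : ∑' m : ℤ, (-1 : ℂ) ^ m * e (τ * (((6 * m - 1 : ℤ) : ℂ) ^ 2 / 24) +
      ((6 * m - 1 : ℤ) : ℂ) * (0 / 2)) = ∑' m : ℤ, (-1 : ℂ) ^ m *
        e (τ * (((6 * m + 1 : ℤ) : ℂ) ^ 2 / 24) + ((6 * m + 1 : ℤ) : ℂ) * (0 / 2)) := by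
    rw [← (Equiv.neg ℤ).tsum_eq fun m : ℤ => (-1 : ℂ) ^ m *
        e (τ * (((6 * m + 1 : ℤ) : ℂ) ^ 2 / 24) + ((6 * m + 1 : ℤ) : ℂ) * (0 / 2))]
    refine tsum_congr fun m => ?_
    rw [Equiv.neg_apply, zpow_neg, ← inv_zpow]
    push_cast
    norm_num
    left
    ring_nf
  rw [thetaChi, tsum_int_six_split hs, h2, ← two_mul, etaFn, ← tsum_pentagonal hτ]
  congr 1
  refine Eq.trans (tsum_congr ?_) tsum_mul_left
  intro m
  rw [mul_left_comm, ← e_add]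
  push_cast
  ring_nf

lemma im_neg_one_div {τ : ℂ} (hτ : 0 < τ.im) : 0 < (-1 / τ).im := by
  have hτ0 : τ ≠ 0 := by rintro rfl; simp at hτ
  rw [neg_div, Complex.neg_im, one_div, Complex.inv_im, neg_div, neg_neg]
  exact div_pos hτ (Complex.normSq_pos.mpr hτ0)

theorem etaFn_S {τ : ℂ} (hτ : 0 < τ.im) :
    etaFn (-1 / τ) = csqrt (-Complex.I * τ) * etaFn τ := by
  have h := thetaChi_S hτ 0
  rw [zero_div, thetaChi_zero (im_neg_one_div hτ), thetaChi_zero hτ] at h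
  simp only [ne_eq, OfNat.ofNat_ne_zero, not_false_eq_true, zero_pow, mul_zero, zero_div, e_zero,
    mul_one] at h
  linear_combination h / 2

/-! ### The non-holomorphic part of the completion -/

/-- The terms of the non-holomorphic completion of the Appell–Lerch sum. -/
def nonholTerm (τ u : ℂ) (n : ℤ) : ℂ :=
  chi n * (signErf n ((n + 6 * (u.im / τ.im)) * √(τ.im / 6)) : ℝ) *
    e (-(τ * (n ^ 2 / 24) + n * (u / 2)))

/-- The non-holomorphic completion of the Appell–Lerch sum. -/
def nonhol (τ u : ℂ) : ℂ := ∑' n : ℤ, nonholTerm τ u n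

lemma norm_e_nonhol (τ u : ℂ) (n : ℤ) : ‖e (-(τ * (n ^ 2 / 24) + n * (u / 2)))‖ =
    Real.exp (Real.pi * τ.im / 12 * n ^ 2 + Real.pi * n * u.im) := by
  rw [norm_e]
  congr 1
  have h1 : (τ * ((n : ℂ) ^ 2 / 24)).im = τ.im * (n ^ 2 / 24) := by
    rw [show ((n : ℂ) ^ 2 / 24) = (((n : ℝ) ^ 2 / 24 : ℝ) : ℂ) by push_cast; rfl,
      Complex.im_mul_ofReal]
  have h2 : ((n : ℂ) * (u / 2)).im = n * (u.im / 2) := by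
    rw [show (n : ℂ) * (u / 2) = ((n / 2 : ℝ) : ℂ) * u by push_cast; ring, Complex.im_ofReal_mul]
    ring
  rw [Complex.neg_im, Complex.add_im, h1, h2]
  ring

/-- The parameter `s = n √(Im τ / 6)` contributes `-π Im τ n² / 6`, which overcomes the growth `π Im
τ n² / 12` of the exponential factor. -/
lemma gaussian_mul_norm_e_le {τ : ℂ} (hτ : 0 < τ.im) (u : ℂ) {B : ℝ} (hB : |u.im| ≤ B) (n : ℤ) :
    Real.exp (Real.pi * (n * √(τ.im / 6)) ^ 2 -
      2 * Real.pi * (n * √(τ.im / 6)) * ((n + 6 * (u.im / τ.im)) * √(τ.im / 6))) *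
      ‖e (-(τ * (n ^ 2 / 24) + n * (u / 2)))‖ ≤
    Real.exp (-(Real.pi * τ.im / 12) * n ^ 2 + Real.pi * B * |(n : ℝ)|) := by
  rw [norm_e_nonhol, ← Real.exp_add]
  apply Real.exp_le_exp.mpr
  have hk : √(τ.im / 6) ^ 2 = τ.im / 6 := Real.sq_sqrt (by positivity)
  have h1 : -(n * u.im) ≤ B * |(n : ℝ)| := by
    calc -((n : ℝ) * u.im) ≤ |(n : ℝ) * u.im| := neg_le_abs _
      _ = |u.im| * |(n : ℝ)| := by rw [abs_mul, mul_comm]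
      _ ≤ _ := by gcongr
  have h2 : Real.pi * (n * √(τ.im / 6)) ^ 2 -
      2 * Real.pi * (n * √(τ.im / 6)) * ((n + 6 * (u.im / τ.im)) * √(τ.im / 6)) =
      -(Real.pi * τ.im / 6) * n ^ 2 - 2 * Real.pi * n * u.im := by
    rw [show Real.pi * (n * √(τ.im / 6)) ^ 2 -
      2 * Real.pi * (n * √(τ.im / 6)) * ((n + 6 * (u.im / τ.im)) * √(τ.im / 6)) =
      √(τ.im / 6) ^ 2 * (Real.pi * n ^ 2 - 2 * Real.pi * n * (n + 6 * (u.im / τ.im))) by ring, hk]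
    field_simp
    ring
  rw [h2]
  have := Real.pi_pos
  nlinarith

lemma norm_nonholTerm_le {τ : ℂ} (hτ : 0 < τ.im) (u : ℂ) {B : ℝ} (hB : |u.im| ≤ B) (n : ℤ) :
    ‖nonholTerm τ u n‖ ≤
      2 * Real.exp (-(Real.pi * τ.im / 12) * n ^ 2 + Real.pi * B * |(n : ℝ)|) := by
  rcases eq_or_ne n 0 with rfl | hn
  · rw [nonholTerm, chi_zero, zero_mul, zero_mul, norm_zero]; positivity
  · rw [nonholTerm, norm_mul, norm_mul, Complex.norm_real, Real.norm_eq_abs]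
    have h1 := abs_signErf_le hn ((n + 6 * (u.im / τ.im)) * √(τ.im / 6))
      (Real.sqrt_nonneg (τ.im / 6))
    calc _ ≤ 1 * (2 * Real.exp (Real.pi * (n * √(τ.im / 6)) ^ 2 -
          2 * Real.pi * (n * √(τ.im / 6)) * ((n + 6 * (u.im / τ.im)) * √(τ.im / 6)))) *
          ‖e (-(τ * (n ^ 2 / 24) + n * (u / 2)))‖ := by
          gcongr
          exact norm_chi_le n
      _ ≤ _ := by
          rw [one_mul, mul_assoc]
          gcongr
          exact gaussian_mul_norm_e_le hτ u hB n

lemma summable_nonholTerm {τ : ℂ} (hτ : 0 < τ.im) (u : ℂ) : Summable (nonholTerm τ u) :=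
  Summable.of_norm_bounded ((summable_gaussian (by positivity) _).mul_left 2)
    (norm_nonholTerm_le hτ u le_rfl)

/-- The imaginary part as a real-linear map to `ℂ`. -/
def imC : ℂ →L[ℝ] ℂ := Complex.ofRealCLM.comp Complex.imCLM

lemma imC_apply (z : ℂ) : imC z = (z.im : ℂ) := rfl

lemma norm_imC_le : ‖imC‖ ≤ 1 :=
  ContinuousLinearMap.opNorm_le_bound _ zero_le_one fun z => by
    rw [imC_apply, Complex.norm_real, one_mul, Real.norm_eq_abs]
    exact Complex.abs_im_le_norm z

/-- The coefficient of `imC` in the real derivative of `nonholTerm`. -/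
def nonholIm (τ u : ℂ) (n : ℤ) : ℂ :=
  chi n * (-(12 * √(τ.im / 6) / τ.im *
    Real.exp (-Real.pi * ((n + 6 * (u.im / τ.im)) * √(τ.im / 6)) ^ 2)) : ℝ) *
    e (-(τ * (n ^ 2 / 24) + n * (u / 2)))

/-- The coefficient of the identity in the real derivative of `nonholTerm`. -/
def nonholHol (τ u : ℂ) (n : ℤ) : ℂ := -(Real.pi * Complex.I * n) * nonholTerm τ u n

/-- The real derivative is split into a complex-linear part and a multiple of `Im`. Only the second
obstructs holomorphy, so only its coefficient has to be evaluated after summation. -/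
lemma hasFDerivAt_nonholTerm (τ u : ℂ) (n : ℤ) :
    HasFDerivAt (fun u => nonholTerm τ u n)
      (nonholIm τ u n • imC + nonholHol τ u n • ContinuousLinearMap.id ℝ ℂ) u := by
  set k := √(τ.im / 6)
  have h1 : HasFDerivAt (fun u : ℂ => ((n : ℝ) + 6 * (u.im / τ.im)) * k)
      ((6 / τ.im * k) • Complex.imCLM) u := by
    have := ((Complex.imCLM.hasFDerivAt (x := u)).const_mul (6 / τ.im * k)).const_add (n * k)
    refine this.congr_of_eventuallyEq (Eventually.of_forall fun w => ?_)
    simp only [Complex.imCLM_apply]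
    ring
  have h2 := ((hasDerivAt_gaussErf (((n : ℝ) + 6 * (u.im / τ.im)) * k)).comp_hasFDerivAt u
    h1).const_sub (n.sign : ℝ)
  have h3 := (Complex.ofRealCLM.hasFDerivAt).comp u h2
  have h4 : HasFDerivAt (fun u : ℂ => e (-(τ * (n ^ 2 / 24) + n * (u / 2))))
      ((-(Real.pi * Complex.I * n) * e (-(τ * (n ^ 2 / 24) + n * (u / 2)))) •
        ContinuousLinearMap.id ℝ ℂ) u := by
    have hl : HasDerivAt (fun u : ℂ => -(τ * ((n : ℂ) ^ 2 / 24) + n * (u / 2))) (-((n : ℂ) * (1 / 2))) u :=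
      ((((hasDerivAt_id u).div_const 2).const_mul (n : ℂ)).const_add _).neg
    have := ((hasDerivAt_e _).comp u hl).complexToReal_fderiv
    refine this.congr_fderiv ?_
    refine ContinuousLinearMap.ext fun z => ?_
    simp only [smul_apply, ContinuousLinearMap.id_apply, one_apply_eq_self, smul_eq_mul]
    ring
  have h5 := (h3.const_mul (chi n)).mul h4
  refine h5.congr_fderiv ?_
  refine ContinuousLinearMap.ext fun z => ?_
  simp only [nonholIm, nonholHol, nonholTerm, signErf, imC_apply, add_apply,
    smul_apply, ContinuousLinearMap.id_apply, Function.comp_apply,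
    ContinuousLinearMap.comp_apply, Complex.ofRealCLM_apply, neg_apply,
    Complex.imCLM_apply, smul_eq_mul]
  push_cast
  ring

lemma norm_nonholIm_le {τ : ℂ} (hτ : 0 < τ.im) (u : ℂ) {B : ℝ} (hB : |u.im| ≤ B) (n : ℤ) :
    ‖nonholIm τ u n‖ ≤ 12 * √(τ.im / 6) / τ.im *
      Real.exp (-(Real.pi * τ.im / 12) * n ^ 2 + Real.pi * B * |(n : ℝ)|) := by
  rw [nonholIm, norm_mul, norm_mul, Complex.norm_real, norm_neg,
    Real.norm_of_nonneg (by positivity)]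
  have h1 : Real.exp (-Real.pi * ((n + 6 * (u.im / τ.im)) * √(τ.im / 6)) ^ 2) ≤
      Real.exp (Real.pi * (n * √(τ.im / 6)) ^ 2 -
      2 * Real.pi * (n * √(τ.im / 6)) * ((n + 6 * (u.im / τ.im)) * √(τ.im / 6))) := by
    apply Real.exp_le_exp.mpr
    have := mul_nonneg Real.pi_pos.le
      (sq_nonneg ((n + 6 * (u.im / τ.im)) * √(τ.im / 6) - n * √(τ.im / 6)))
    nlinarith
  calc _ ≤ 1 * (12 * √(τ.im / 6) / τ.im * Real.exp (Real.pi * (n * √(τ.im / 6)) ^ 2 -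
          2 * Real.pi * (n * √(τ.im / 6)) * ((n + 6 * (u.im / τ.im)) * √(τ.im / 6)))) *
          ‖e (-(τ * (n ^ 2 / 24) + n * (u / 2)))‖ := by
        gcongr
        exact norm_chi_le n
    _ ≤ _ := by
        rw [one_mul, mul_assoc]
        gcongr
        exact gaussian_mul_norm_e_le hτ u hB n

lemma conj_thetaChi (τ u : ℂ) : (starRingEnd ℂ) (thetaChi τ u) = ∑' n : ℤ, chi n *
    e (-((starRingEnd ℂ) τ * (n ^ 2 / 24) + n * ((starRingEnd ℂ) u / 2))) := by
  rw [thetaChi, Complex.conj_tsum]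
  refine tsum_congr fun n => ?_
  have h1 : (starRingEnd ℂ) (chi n) = chi n := by rw [chi]; split_ifs <;> simp
  rw [map_mul, h1, conj_e]
  simp [Complex.conj_ofNat]

/-- Expanding the square in the Gaussian replaces `τ`, `u` by their conjugates in the exponential,
at the cost of a factor independent of `n`. -/
lemma tsum_nonholIm {τ : ℂ} (hτ : 0 < τ.im) (u : ℂ) : ∑' n, nonholIm τ u n =
    (-(12 * √(τ.im / 6) / τ.im * Real.exp (-6 * Real.pi * u.im ^ 2 / τ.im)) : ℝ) *
      (starRingEnd ℂ) (thetaChi τ u) := by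
  rw [conj_thetaChi, ← tsum_mul_left]
  refine tsum_congr fun n => ?_
  rw [nonholIm, Complex.ofReal_neg, Complex.ofReal_mul, Complex.ofReal_neg, Complex.ofReal_mul]
  have hk : √(τ.im / 6) ^ 2 = τ.im / 6 := Real.sq_sqrt (by positivity)
  have key : ((Real.exp (-Real.pi * ((n + 6 * (u.im / τ.im)) * √(τ.im / 6)) ^ 2) : ℝ) : ℂ) *
      e (-(τ * (n ^ 2 / 24) + n * (u / 2))) =
      ((Real.exp (-6 * Real.pi * u.im ^ 2 / τ.im) : ℝ) : ℂ) *
        e (-((starRingEnd ℂ) τ * (n ^ 2 / 24) + n * ((starRingEnd ℂ) u / 2))) := by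
    rw [mul_pow, hk, e, e, Complex.ofReal_exp, Complex.ofReal_exp, ← Complex.exp_add,
      ← Complex.exp_add]
    congr 1
    have h1 : τ = τ.re + τ.im * Complex.I := (Complex.re_add_im τ).symm
    have h2 : u = u.re + u.im * Complex.I := (Complex.re_add_im u).symm
    have h3 : (starRingEnd ℂ) τ = τ.re - τ.im * Complex.I := by
      apply Complex.ext <;> simp
    have h4 : (starRingEnd ℂ) u = u.re - u.im * Complex.I := by
      apply Complex.ext <;> simp
    rw [h3, h4]
    clear h3 h4 hk
    have h5 : (τ.im : ℂ) ≠ 0 := by exact_mod_cast hτ.ne'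
    generalize τ.im = v at *
    generalize τ.re = x at *
    generalize u.im = y at *
    generalize u.re = w at *
    subst h1 h2
    push_cast
    field_simp
    ring_nf
    rw [Complex.I_sq]
    ring
  linear_combination (-chi n * ((12 * √(τ.im / 6) / τ.im : ℝ) : ℂ)) * key

lemma hasFDerivAt_nonhol {τ : ℂ} (hτ : 0 < τ.im) (u : ℂ) : ∃ b : ℂ,
    HasFDerivAt (nonhol τ)
      ((∑' n, nonholIm τ u n) • imC + b • ContinuousLinearMap.id ℝ ℂ) u := by
  set B := |u.im| + 1 with hBdef
  have hB : ∀ w ∈ Metric.ball u 1, |w.im| ≤ B := by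
    intro w hw
    have h1 : |w.im - u.im| ≤ ‖w - u‖ := by
      rw [← Complex.sub_im]; exact Complex.abs_im_le_norm _
    have h2 := abs_sub_abs_le_abs_sub w.im u.im
    rw [Metric.mem_ball, dist_eq_norm] at hw
    linarith
  have hc : 0 < Real.pi * τ.im / 12 := by positivity
  have s0 := summable_gaussian hc (Real.pi * B)
  have s1 := summable_pow_mul_gaussian 1 hc (Real.pi * B)
  simp only [pow_one] at s1
  have hIm := fun w hw n => norm_nonholIm_le hτ w (hB w hw) n
  have hHol : ∀ w ∈ Metric.ball u 1, ∀ n : ℤ, ‖nonholHol τ w n‖ ≤ 2 * Real.pi * (|(n : ℝ)| *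
      Real.exp (-(Real.pi * τ.im / 12) * n ^ 2 + Real.pi * B * |(n : ℝ)|)) := by
    intro w hw n
    have := norm_nonholTerm_le hτ w (hB w hw) n
    rw [nonholHol, norm_mul, norm_neg, norm_mul, norm_mul, Complex.norm_I, mul_one,
      Complex.norm_real, Real.norm_of_nonneg Real.pi_pos.le, Complex.norm_intCast]
    calc _ ≤ Real.pi * |(n : ℝ)| * (2 * Real.exp (-(Real.pi * τ.im / 12) * n ^ 2 +
          Real.pi * B * |(n : ℝ)|)) := by gcongr
      _ = _ := by ring
  have hu : u ∈ Metric.ball u 1 := Metric.mem_ball_self one_pos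
  have hsum := hasFDerivAt_tsum_of_isPreconnected
    (f := fun n w => nonholTerm τ w n)
    (f' := fun n w => nonholIm τ w n • imC + nonholHol τ w n • ContinuousLinearMap.id ℝ ℂ)
    ((s0.mul_left (12 * √(τ.im / 6) / τ.im)).add (s1.mul_left (2 * Real.pi)))
    Metric.isOpen_ball (convex_ball u 1).isPreconnected
    (fun n w _ => hasFDerivAt_nonholTerm τ w n)
    (fun n w hw => by
      refine (norm_add_le _ _).trans (add_le_add ?_ ?_)
      · refine (norm_smul_le _ _).trans ?_
        calc _ ≤ ‖nonholIm τ w n‖ * 1 := by gcongr; exact norm_imC_le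
          _ ≤ _ := by rw [mul_one]; exact hIm w hw n
      · refine (norm_smul_le _ _).trans ?_
        calc _ ≤ ‖nonholHol τ w n‖ * 1 := by
              gcongr; exact ContinuousLinearMap.norm_id_le
          _ ≤ _ := by rw [mul_one]; exact hHol w hw n)
    hu (summable_nonholTerm hτ u) hu
  refine ⟨∑' n, nonholHol τ u n, ?_⟩
  have sI : Summable (nonholIm τ u) := Summable.of_norm_bounded (s0.mul_left _) (hIm u hu)
  have sH : Summable (nonholHol τ u) := Summable.of_norm_bounded (s1.mul_left _) (hHol u hu)
  refine hsum.congr_fderiv ?_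
  rw [Summable.tsum_add (sI.smul_const _) (sH.smul_const _), sI.tsum_smul_const,
    sH.tsum_smul_const]

lemma continuous_nonhol {τ : ℂ} (hτ : 0 < τ.im) : Continuous (nonhol τ) :=
  continuous_iff_continuousAt.mpr fun u => (hasFDerivAt_nonhol hτ u).choose_spec.continuousAt

lemma nonhol_add_one (τ u : ℂ) : nonhol τ (u + 1) = -nonhol τ u := by
  rw [nonhol, nonhol, ← tsum_neg]
  refine tsum_congr fun n => ?_
  rcases Int.even_or_odd n with h | ⟨k, rfl⟩
  · simp [nonholTerm, chi_eq_zero_of_even h]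
  · rw [nonholTerm, nonholTerm, Complex.add_im, Complex.one_im, add_zero]
    have : e (-(τ * (((2 * k + 1 : ℤ) : ℂ) ^ 2 / 24) + ((2 * k + 1 : ℤ) : ℂ) * ((u + 1) / 2))) =
        -e (-(τ * (((2 * k + 1 : ℤ) : ℂ) ^ 2 / 24) + ((2 * k + 1 : ℤ) : ℂ) * (u / 2))) := by
      rw [neg_eq_neg_one_mul (e _), ← e_half, ← e_add]
      refine e_eq_of_sub_int (-k - 1) ?_
      push_cast; ring
    rw [this]; ring

lemma nonhol_neg (τ u : ℂ) : nonhol τ (-u) = -nonhol τ u := by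
  rw [nonhol, nonhol, ← tsum_neg, ← (Equiv.neg ℤ).tsum_eq (nonholTerm τ (-u))]
  refine tsum_congr fun n => ?_
  rw [Equiv.neg_apply, nonholTerm, nonholTerm, chi_neg]
  have : ((((-n : ℤ) : ℝ) + 6 * ((-u).im / τ.im)) * √(τ.im / 6)) =
      -((n + 6 * (u.im / τ.im)) * √(τ.im / 6)) := by push_cast; rw [Complex.neg_im]; ring
  rw [this, signErf_neg]
  push_cast
  ring_nf

/-- The substitution `n = m - 6` reproduces the summand with `sgn (m - 6)` instead of `sgn m`. Where
the character is nonzero these signs differ only at `m = 1` and `m = 5`, whence the two extra terms.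
-/
lemma nonhol_add_tau {τ : ℂ} (hτ : 0 < τ.im) (u : ℂ) : nonhol τ (u + τ) =
    -e (3 * τ / 2 + 3 * u) * (nonhol τ u - 2 * e (-(τ / 24 + u / 2)) +
      2 * e (-(25 * τ / 24 + 5 * u / 2))) := by
  set d : ℤ → ℂ := fun m => chi m * (((m - 6).sign - m.sign : ℤ) : ℂ) *
    e (-(τ * (m ^ 2 / 24) + m * (u / 2))) with hd
  have hd0 : ∀ m ∉ ({1, 5} : Finset ℤ), d m = 0 := by
    intro m hm
    simp only [Finset.mem_insert, Finset.mem_singleton, not_or] at hm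
    rcases lt_or_ge m 0 with h | h
    · simp [hd, Int.sign_eq_neg_one_of_neg h, Int.sign_eq_neg_one_of_neg (show m - 6 < 0 by omega)]
    · rcases lt_or_ge 6 m with h' | h'
      · simp [hd, Int.sign_eq_one_of_pos (show 0 < m by omega),
          Int.sign_eq_one_of_pos (show 0 < m - 6 by omega)]
      · interval_cases m <;> simp_all [chi]
  have hds : Summable d := summable_of_ne_finset_zero hd0
  have hdt : ∑' m, d m = -2 * e (-(τ / 24 + u / 2)) + 2 * e (-(25 * τ / 24 + 5 * u / 2)) := by
    rw [tsum_eq_sum hd0, Finset.sum_pair (by norm_num)]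
    have h1 : d 1 = -2 * e (-(τ / 24 + u / 2)) := by
      have : chi 1 = 1 := by simp [chi]
      have hs : ((1 - 6 : ℤ).sign - (1 : ℤ).sign) = -2 := rfl
      simp only [hd, this, hs]
      norm_num
      ring_nf
    have h5 : d 5 = 2 * e (-(25 * τ / 24 + 5 * u / 2)) := by
      have : chi 5 = -1 := by simp [chi]
      have hs : ((5 - 6 : ℤ).sign - (5 : ℤ).sign) = -2 := rfl
      simp only [hd, this, hs]
      norm_num
      ring_nf
    rw [h1, h5]
  have key : ∀ m : ℤ, nonholTerm τ (u + τ) (m - 6) =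
      -e (3 * τ / 2 + 3 * u) * (nonholTerm τ u m + d m) := by
    intro m
    have he : e (-(τ * (((m - 6 : ℤ) : ℂ) ^ 2 / 24) + ((m - 6 : ℤ) : ℂ) * ((u + τ) / 2))) =
        e (3 * τ / 2 + 3 * u) * e (-(τ * (m ^ 2 / 24) + m * (u / 2))) := by
      rw [← e_add]; congr 1; push_cast; ring
    have hx : ((((m - 6 : ℤ) : ℝ) + 6 * ((u + τ).im / τ.im)) * √(τ.im / 6)) =
        ((m + 6 * (u.im / τ.im)) * √(τ.im / 6)) := by
      rw [Complex.add_im]; push_cast; field_simp; ring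
    rw [nonholTerm, nonholTerm, he, hx, chi_sub_six]
    simp only [hd, signErf]
    push_cast
    ring
  rw [nonhol, ← (Equiv.subRight (6 : ℤ)).tsum_eq (nonholTerm τ (u + τ))]
  simp only [Equiv.subRight_apply, key]
  rw [tsum_mul_left, (summable_nonholTerm hτ u).tsum_add hds, hdt, nonhol]
  ring

/-! ### The Appell–Lerch sum as a function of the elliptic variable -/

/-- `u` is not a point of the lattice `ℤτ + ℤ`. -/
def OffLattice (τ u : ℂ) : Prop := ∀ r : ℤ, 1 - e (u + r * τ) ≠ 0

lemma offLattice_iff {τ u : ℂ} : OffLattice τ u ↔ ∀ r s : ℤ, u + r * τ ≠ s := by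
  refine forall_congr' fun r => ?_
  rw [ne_eq, sub_eq_zero, eq_comm, e_eq_one_iff, not_exists]

lemma OffLattice.add_one {τ u : ℂ} (h : OffLattice τ u) : OffLattice τ (u + 1) := by
  intro r
  have := h r
  rwa [show u + 1 + r * τ = u + r * τ + (1 : ℤ) by push_cast; ring, e_add_int]

lemma OffLattice.add_tau {τ u : ℂ} (h : OffLattice τ u) : OffLattice τ (u + τ) := by
  intro r
  have := h (r + 1)
  rwa [show u + τ + r * τ = u + (r + 1 : ℤ) * τ by push_cast; ring]

lemma OffLattice.neg {τ u : ℂ} (h : OffLattice τ u) : OffLattice τ (-u) := by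
  rw [offLattice_iff] at h ⊢
  intro r s hrs
  refine h (-r) (-s) ?_
  push_cast
  linear_combination -hrs

lemma OffLattice.div_tau {τ u : ℂ} (hτ : τ ≠ 0) (h : OffLattice τ u) :
    OffLattice (-1 / τ) (u / τ) := by
  rw [offLattice_iff] at h ⊢
  intro r s hrs
  refine h (-s) r ?_
  field_simp at hrs
  push_cast
  linear_combination hrs

lemma appell_add_one (τ u : ℂ) : appell τ (u + 1) = appell τ u := by
  refine tsum_congr fun n => ?_
  rw [appellTerm, appellTerm,
    show u + 1 + n * τ = u + n * τ + (1 : ℤ) by push_cast; ring, e_add_int]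

lemma appell_neg (τ u : ℂ) : appell τ (-u) = -e u * appell τ u := by
  rw [appell, appell, ← (Equiv.neg ℤ).tsum_eq (appellTerm τ (-u)), ← tsum_mul_left]
  refine tsum_congr fun n => ?_
  rw [Equiv.neg_apply, appellTerm, appellTerm, zpow_neg, ← inv_zpow,
    show (-1 : ℂ)⁻¹ = -1 by norm_num,
    show -u + ((-n : ℤ) : ℂ) * τ = -(u + n * τ) by push_cast; ring, e_neg,
    show τ * (((-n : ℤ) : ℂ) * (3 * ((-n : ℤ) : ℂ) + 1) / 2) =
      τ * (n * (3 * n + 1) / 2) - n * τ by push_cast; ring, e_sub, e_add]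
  have h1 := e_ne_zero u
  have h2 := e_ne_zero (n * τ)
  have h3 : 1 - (e u * e (n * τ))⁻¹ = -(1 - e u * e (n * τ)) / (e u * e (n * τ)) := by
    field_simp
    ring
  rw [h3, div_div_eq_mul_div, div_neg]
  generalize e (n * τ) = Y at *
  generalize e u = a at *
  generalize e (τ * (n * (3 * n + 1) / 2)) = W
  rw [show (-1 : ℂ) ^ n * (W / Y) * (a * Y) = (-1) ^ n * W * a by field_simp]
  ring

lemma summable_signed_e {τ : ℂ} (hτ : 0 < τ.im) (b : ℝ) :
    Summable fun n : ℤ => (-1 : ℂ) ^ n * e (τ * ((3 / 2 * n ^ 2 + b * n : ℝ) : ℂ)) :=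
  Summable.of_norm_bounded (summable_norm_e_quadratic hτ (a := 3 / 2) (by norm_num) b) fun n => by
    rw [norm_mul, norm_neg_one_zpow, one_mul]

lemma tsum_signed_e_one_half {τ : ℂ} (hτ : 0 < τ.im) :
    ∑' n : ℤ, (-1 : ℂ) ^ n * e (τ * ((3 / 2 * n ^ 2 + (1 / 2) * n : ℝ) : ℂ)) = eulerProd τ := by
  rw [← tsum_pentagonal hτ]
  refine tsum_congr fun n => ?_
  push_cast
  ring_nf

lemma tsum_signed_e_neg (τ : ℂ) (b : ℝ) :
    ∑' n : ℤ, (-1 : ℂ) ^ n * e (τ * ((3 / 2 * n ^ 2 + -b * n : ℝ) : ℂ)) =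
    ∑' n : ℤ, (-1 : ℂ) ^ n * e (τ * ((3 / 2 * n ^ 2 + b * n : ℝ) : ℂ)) := by
  rw [← (Equiv.neg ℤ).tsum_eq fun n : ℤ => (-1 : ℂ) ^ n *
    e (τ * ((3 / 2 * n ^ 2 + b * n : ℝ) : ℂ))]
  refine tsum_congr fun n => ?_
  rw [Equiv.neg_apply, zpow_neg, ← inv_zpow]
  push_cast
  norm_num

lemma tsum_signed_e_shift (τ : ℂ) (b : ℝ) :
    ∑' n : ℤ, (-1 : ℂ) ^ n * e (τ * ((3 / 2 * n ^ 2 + b * n : ℝ) : ℂ)) =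
    -e (τ * (3 / 2 + b)) *
      ∑' n : ℤ, (-1 : ℂ) ^ n * e (τ * ((3 / 2 * n ^ 2 + (b + 3) * n : ℝ) : ℂ)) := by
  rw [← (Equiv.addRight (1 : ℤ)).tsum_eq, ← tsum_mul_left]
  refine tsum_congr fun n => ?_
  rw [Equiv.coe_addRight, zpow_add₀ (by norm_num), zpow_one,
    show e (τ * ((3 / 2 * ((n + 1 : ℤ) : ℝ) ^ 2 + b * ((n + 1 : ℤ) : ℝ) : ℝ) : ℂ)) =
      e (τ * (3 / 2 + b)) * e (τ * ((3 / 2 * n ^ 2 + (b + 3) * n : ℝ) : ℂ)) by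
      rw [← e_add]; congr 1; push_cast; ring]
  ring

/-- The shift `n ↦ n + 1` changes the sign and turns `-3/2` into `3/2`; the reflection `n ↦ -n`
undoes this without a sign. The sum is its own negative. -/
lemma tsum_signed_e_three_halves (τ : ℂ) :
    ∑' n : ℤ, (-1 : ℂ) ^ n * e (τ * ((3 / 2 * n ^ 2 + -(3 / 2) * n : ℝ) : ℂ)) = 0 := by
  have h1 := tsum_signed_e_shift τ (-(3 / 2))
  have h2 := tsum_signed_e_neg τ (3 / 2)
  rw [show (-(3 / 2) + 3 : ℝ) = 3 / 2 by norm_num, ← h2] at h1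
  have h3 : e (τ * (3 / 2 + ((-(3 / 2) : ℝ) : ℂ))) = 1 := by
    rw [← e_zero]; congr 1; push_cast; ring
  rw [h3] at h1
  linear_combination h1 / 2

/-- After `n = m - 1` the new term differs from a multiple of the old one by `1 - (z q^m)³` over `1
- z q^m`, a geometric sum with three terms. Of the resulting theta series the outer two are
pentagonal and the middle one vanishes. -/
lemma appell_add_tau {τ u : ℂ} (hτ : 0 < τ.im) (hu : OffLattice τ u) : appell τ (u + τ) =
    -e (τ + 3 * u) * appell τ u + eulerProd τ * (1 - e (τ + 2 * u)) := by
  set s : ℝ → ℤ → ℂ := fun b n => (-1 : ℂ) ^ n * e (τ * ((3 / 2 * n ^ 2 + b * n : ℝ) : ℂ)) with hs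
  have hss : ∀ b, Summable (s b) := fun b => summable_signed_e hτ b
  have key : ∀ m : ℤ, appellTerm τ (u + τ) (m - 1) = -e (τ + 3 * u) * appellTerm τ u m -
      (e τ * s (-(5 / 2)) m + e (τ + u) * s (-(3 / 2)) m + e (τ + 2 * u) * s (-(1 / 2)) m) := by
    intro m
    have h0 := hu m
    simp only [appellTerm, hs]
    rw [show u + τ + ((m - 1 : ℤ) : ℂ) * τ = u + m * τ by push_cast; ring,
      zpow_sub₀ (by norm_num), zpow_one]
    have e0 : e (τ * (((m - 1 : ℤ) : ℂ) * (3 * ((m - 1 : ℤ) : ℂ) + 1) / 2)) =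
        e τ * e (τ * (m * (3 * m + 1) / 2)) / e (m * τ) ^ 3 := by
      rw [e_pow, ← e_add, ← e_sub]; congr 1; push_cast; ring
    have e5 : e (τ * ((3 / 2 * (m : ℝ) ^ 2 + -(5 / 2) * m : ℝ) : ℂ)) =
        e (τ * (m * (3 * m + 1) / 2)) / e (m * τ) ^ 3 := by
      rw [e_pow, ← e_sub]; congr 1; push_cast; ring
    have e3 : e (τ * ((3 / 2 * (m : ℝ) ^ 2 + -(3 / 2) * m : ℝ) : ℂ)) =
        e (τ * (m * (3 * m + 1) / 2)) / e (m * τ) ^ 2 := by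
      rw [e_pow, ← e_sub]; congr 1; push_cast; ring
    have e1 : e (τ * ((3 / 2 * (m : ℝ) ^ 2 + -(1 / 2) * m : ℝ) : ℂ)) =
        e (τ * (m * (3 * m + 1) / 2)) / e (m * τ) := by
      rw [← e_sub]; congr 1; push_cast; ring
    have e6 : e (τ + 3 * u) = e τ * e u ^ 3 := by rw [e_pow, ← e_add]; norm_num
    have e7 : e (τ + 2 * u) = e τ * e u ^ 2 := by rw [e_pow, ← e_add]; norm_num
    rw [e0, e5, e3, e1, e6, e7, e_add τ u, e_add u]
    rw [e_add] at h0
    have h2 := e_ne_zero (m * τ)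
    generalize e (m * τ) = Y at *
    generalize e u = a at *
    generalize e τ = q
    generalize e (τ * (m * (3 * m + 1) / 2)) = W
    generalize (-1 : ℂ) ^ m = σ
    have h0' : 1 - Y * a ≠ 0 := by rwa [mul_comm]
    field_simp
    ring
  have hsA := summable_appellTerm hτ hu
  rw [appell, ← (Equiv.subRight (1 : ℤ)).tsum_eq (appellTerm τ (u + τ))]
  simp only [Equiv.subRight_apply, key]
  rw [Summable.tsum_sub (hsA.mul_left _) ((((hss _).mul_left _).add ((hss _).mul_left _)).add
    ((hss _).mul_left _)), Summable.tsum_add (((hss _).mul_left _).add ((hss _).mul_left _))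
    ((hss _).mul_left _), Summable.tsum_add ((hss _).mul_left _) ((hss _).mul_left _),
    tsum_mul_left, tsum_mul_left, tsum_mul_left, tsum_mul_left]
  have h3 : ∑' n, s (-(3 / 2)) n = 0 := tsum_signed_e_three_halves τ
  have h1 : ∑' n, s (-(1 / 2)) n = eulerProd τ := by
    simp only [hs]; rw [tsum_signed_e_neg, tsum_signed_e_one_half hτ]
  have h5 : e τ * ∑' n, s (-(5 / 2)) n = -eulerProd τ := by
    simp only [hs]
    rw [tsum_signed_e_shift, show (-(5 / 2) + 3 : ℝ) = 1 / 2 by norm_num, tsum_signed_e_one_half hτ,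
      ← mul_assoc, mul_neg, ← e_add, show τ + τ * (3 / 2 + ((-(5 / 2) : ℝ) : ℂ)) = 0 by
        push_cast; ring, e_zero]
    ring
  rw [h3, h1, h5, appell]
  ring

lemma differentiableAt_appellTerm {τ u : ℂ} {n : ℤ} (h : 1 - e (u + n * τ) ≠ 0) :
    DifferentiableAt ℂ (fun u => appellTerm τ u n) u := by
  refine (differentiableAt_const _).div ?_ h
  exact ((differentiable_e _).comp u (differentiableAt_id.add_const _)).const_sub 1

/-- Only finitely many terms can have poles in a given disc; the others converge uniformly there.
The index 0 is kept in `s` so that the pole at the origin can be read off. -/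
lemma appell_eq_sum_add {τ : ℂ} (hτ : 0 < τ.im) (u₀ : ℂ) : ∃ (s : Finset ℤ) (g : ℂ → ℂ),
    0 ∈ s ∧ DifferentiableOn ℂ g (Metric.ball u₀ 1) ∧
    ∀ u ∈ Metric.ball u₀ 1, appell τ u = ∑ n ∈ s, appellTerm τ u n + g u := by
  set B := |u₀.im| + 1 with hBdef
  have hB : ∀ w ∈ Metric.ball u₀ 1, |w.im| ≤ B := by
    intro w hw
    have h1 : |w.im - u₀.im| ≤ ‖w - u₀‖ := by
      rw [← Complex.sub_im]; exact Complex.abs_im_le_norm _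
    have h2 := abs_sub_abs_le_abs_sub w.im u₀.im
    rw [Metric.mem_ball, dist_eq_norm] at hw
    linarith
  set s := (finite_abs_lt ((B + 1) / τ.im)).toFinset with hs
  have hbound := fun w hw n hn => half_le_norm_one_sub_e hτ B (u := w) (hB w hw) (n := n) hn
  have hmem : ∀ n : ℤ, n ∉ s → (B + 1) / τ.im ≤ |(n : ℝ)| := fun n hn => by
    simpa [hs] using hn
  set g : ℤ → ℂ → ℂ := fun n u => if n ∈ s then 0 else appellTerm τ u n with hg
  have hsum := (summable_norm_appell_numerator hτ).mul_right 2
  have hgb : ∀ (n : ℤ) (w : ℂ), w ∈ Metric.ball u₀ 1 →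
      ‖g n w‖ ≤ ‖(-1 : ℂ) ^ n * e (τ * (n * (3 * n + 1) / 2))‖ * 2 := by
    intro n w hw
    simp only [hg]
    split_ifs with h
    · rw [norm_zero]; positivity
    · rw [appellTerm, norm_div, div_eq_mul_inv]
      gcongr
      have := inv_anti₀ (by norm_num) (hbound w hw n (hmem n h))
      simpa using this
  refine ⟨s, fun u => ∑' n, g n u, ?_, ?_, ?_⟩
  · rw [hs, Set.Finite.mem_toFinset]
    simp only [Set.mem_ofPred_eq, Int.cast_zero, abs_zero, not_le]
    positivity
  · refine Complex.differentiableOn_tsum_of_summable_norm hsum (fun n => ?_) Metric.isOpen_ball hgb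
    simp only [hg]
    split_ifs with h
    · exact differentiableOn_const _
    · intro w hw
      refine (differentiableAt_appellTerm ?_).differentiableWithinAt
      intro H
      have := hbound w hw n (hmem n h)
      rw [H, norm_zero] at this
      norm_num at this
  · intro u hu
    have hgs : Summable fun n => g n u := Summable.of_norm_bounded hsum fun n => hgb n u hu
    have h1 : ∀ n, appellTerm τ u n = (if n ∈ s then appellTerm τ u n else 0) + g n u := by
      intro n; simp only [hg]; split_ifs <;> simp
    have h2 : ∀ n ∉ s, (if n ∈ s then appellTerm τ u n else 0) = 0 := fun n hn => if_neg hn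
    rw [appell, tsum_congr h1, (summable_of_ne_finset_zero h2).tsum_add hgs, tsum_eq_sum h2]
    congr 1
    exact Finset.sum_congr rfl fun n hn => if_pos hn

lemma differentiableAt_appell {τ u : ℂ} (hτ : 0 < τ.im) (hu : OffLattice τ u) :
    DifferentiableAt ℂ (appell τ) u := by
  obtain ⟨s, g, -, hg, h⟩ := appell_eq_sum_add hτ u
  have hball := Metric.ball_mem_nhds u one_pos
  have : DifferentiableAt ℂ (fun u => ∑ n ∈ s, appellTerm τ u n + g u) u :=
    (DifferentiableAt.fun_sum fun n _ => differentiableAt_appellTerm (hu n)).add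
      (hg.differentiableAt hball)
  exact this.congr_of_eventuallyEq (Filter.eventuallyEq_of_mem hball h)

/-- At the origin only the term `1 / (1 - e u)`, of index 0, has a pole. -/
lemma tendsto_mul_appell {τ : ℂ} (hτ : 0 < τ.im) :
    Tendsto (fun u => u * appell τ u) (𝓝[≠] 0) (𝓝 (-(2 * Real.pi * Complex.I)⁻¹)) := by
  obtain ⟨s, g, hs0, hg, h⟩ := appell_eq_sum_add hτ 0
  have hball := Metric.ball_mem_nhds (0 : ℂ) one_pos
  have hid : Tendsto (fun u : ℂ => u) (𝓝[≠] 0) (𝓝 0) := tendsto_id.mono_left nhdsWithin_le_nhds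
  have hterm : ∀ n ∈ s, Tendsto (fun u => u * appellTerm τ u n) (𝓝[≠] 0)
      (𝓝 (if n = 0 then -(2 * Real.pi * Complex.I)⁻¹ else 0)) := by
    intro n _
    split_ifs with hn
    · subst hn
      have hd := (hasDerivAt_iff_tendsto_slope.mp (hasDerivAt_e 0)).inv₀ (by simp [e_zero])
      rw [e_zero, mul_one] at hd
      refine hd.neg.congr fun u => ?_
      simp only [slope_def_field, appellTerm, e_zero]
      simp only [Int.cast_zero, zero_mul, add_zero, zero_div, mul_zero, e_zero, zpow_zero, sub_zero,
        one_mul]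
      rw [inv_div, ← neg_sub (e u) 1, mul_div_assoc', mul_one, div_neg]
    · have : 1 - e (0 + n * τ) ≠ 0 := by
        rw [sub_ne_zero, zero_add, ne_comm, ne_eq, e_eq_one_iff]
        rintro ⟨k, hk⟩
        have := congrArg Complex.im hk
        simp [hn, hτ.ne'] at this
      simpa using hid.mul ((differentiableAt_appellTerm this).continuousAt.tendsto.mono_left
        nhdsWithin_le_nhds)
  have hG : Tendsto (fun u => u * g u) (𝓝[≠] 0) (𝓝 0) := by
    simpa using hid.mul ((hg.differentiableAt hball).continuousAt.tendsto.mono_left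
      nhdsWithin_le_nhds)
  have := (tendsto_finsetSum s hterm).add hG
  rw [Finset.sum_ite_eq' s 0, if_pos hs0, add_zero] at this
  refine this.congr' ?_
  filter_upwards [mem_nhdsWithin_of_mem_nhds hball] with u hu
  rw [h u hu, mul_add, Finset.mul_sum]

/-! ### A Liouville theorem for quasi-periodic functions -/

lemma OffLattice.add_one_iff {τ u : ℂ} : OffLattice τ (u + 1) ↔ OffLattice τ u :=
  ⟨fun h => by simpa using h.neg.add_one.neg, OffLattice.add_one⟩

lemma OffLattice.add_tau_iff {τ u : ℂ} : OffLattice τ (u + τ) ↔ OffLattice τ u :=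
  ⟨fun h => by simpa using h.neg.add_tau.neg, OffLattice.add_tau⟩

lemma not_offLattice_iff {τ u : ℂ} : ¬ OffLattice τ u ↔ ∃ r s : ℤ, u = s + r * τ := by
  rw [offLattice_iff]
  push Not
  constructor
  · rintro ⟨r, s, h⟩
    exact ⟨-r, s, by push_cast; linear_combination h⟩
  · rintro ⟨r, s, h⟩
    exact ⟨-r, s, by push_cast; linear_combination h⟩

lemma eq_of_not_offLattice {τ : ℂ} (hτ : 0 < τ.im) {u w : ℂ} (hu : ¬ OffLattice τ u)
    (hw : ¬ OffLattice τ w) (h : ‖u - w‖ < min τ.im 1) : u = w := by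
  obtain ⟨r, s, rfl⟩ := not_offLattice_iff.mp hu
  obtain ⟨r', s', rfl⟩ := not_offLattice_iff.mp hw
  have h1 : ((s : ℂ) + r * τ) - (s' + r' * τ) = ((s - s' : ℤ) : ℂ) + ((r - r' : ℤ) : ℂ) * τ := by
    push_cast; ring
  rw [h1] at h
  have h2 : r = r' := by
    have := (Complex.abs_im_le_norm _).trans_lt (h.trans_le (min_le_left _ _))
    rw [Complex.add_im, Complex.intCast_im, zero_add, ← Complex.ofReal_intCast,
      Complex.im_ofReal_mul, abs_mul, abs_of_pos hτ] at this
    have h3 : |((r - r' : ℤ) : ℝ)| < 1 := by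
      by_contra! H
      nlinarith
    have : |r - r'| < 1 := by exact_mod_cast h3
    rw [Int.abs_lt_one_iff] at this
    omega
  subst h2
  have h3 := h.trans_le (min_le_right _ _)
  rw [sub_self, Int.cast_zero, zero_mul, add_zero, Complex.norm_intCast] at h3
  have : |s - s'| < 1 := by exact_mod_cast h3
  rw [Int.abs_lt_one_iff] at this
  rw [show s = s' by omega]

lemma eventually_offLattice_punctured {τ : ℂ} (hτ : 0 < τ.im) (u : ℂ) :
    ∀ᶠ w in 𝓝[≠] u, OffLattice τ w := by
  have hδ : 0 < min τ.im 1 := lt_min hτ one_pos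
  by_cases h : ∃ l, ¬ OffLattice τ l ∧ ‖u - l‖ < min τ.im 1 / 2 ∧ l ≠ u
  · obtain ⟨l, hl, hlu, hne⟩ := h
    have hr : 0 < ‖u - l‖ := norm_pos_iff.mpr (sub_ne_zero.mpr hne.symm)
    filter_upwards [mem_nhdsWithin_of_mem_nhds (Metric.ball_mem_nhds u hr)] with w hw
    by_contra hw'
    rw [Metric.mem_ball, dist_eq_norm] at hw
    have := eq_of_not_offLattice hτ hw' hl (by
      calc ‖w - l‖ = ‖(w - u) + (u - l)‖ := by congr 1; ring
        _ ≤ ‖w - u‖ + ‖u - l‖ := norm_add_le _ _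
        _ < _ := by linarith)
    rw [this, norm_sub_rev] at hw
    exact lt_irrefl _ hw
  · push Not at h
    filter_upwards [mem_nhdsWithin_of_mem_nhds (Metric.ball_mem_nhds u (half_pos hδ)),
      self_mem_nhdsWithin] with w hw hne
    by_contra hw'
    rw [Metric.mem_ball, dist_eq_norm, norm_sub_rev] at hw
    exact hne (h w hw' hw)

lemma OffLattice.eventually {τ u : ℂ} (hτ : 0 < τ.im) (hu : OffLattice τ u) :
    ∀ᶠ w in 𝓝 u, OffLattice τ w := by
  rw [← nhdsNE_sup_pure u, eventually_sup, eventually_pure]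
  exact ⟨eventually_offLattice_punctured hτ u, hu⟩

lemma exists_lattice_translate {τ : ℂ} (hτ : 0 < τ.im) (u : ℂ) :
    ∃ a ∈ Set.Icc (0 : ℝ) 1, ∃ b ∈ Set.Icc (0 : ℝ) 1, ∃ r s : ℤ,
      u = ((a : ℂ) + b * τ) + (s * 1 + r * τ) := by
  set b := u.im / τ.im
  set a := u.re - b * τ.re
  refine ⟨Int.fract a, ⟨Int.fract_nonneg _, (Int.fract_lt_one _).le⟩, Int.fract b,
    ⟨Int.fract_nonneg _, (Int.fract_lt_one _).le⟩, ⌊b⌋, ⌊a⌋, ?_⟩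
  have ha : ((Int.fract a : ℝ) : ℂ) = a - ⌊a⌋ := by rw [Int.fract]; push_cast; rfl
  have hb : ((Int.fract b : ℝ) : ℂ) = b - ⌊b⌋ := by rw [Int.fract]; push_cast; rfl
  have hu : u = a + b * τ := by
    apply Complex.ext
    · rw [Complex.add_re, Complex.ofReal_re, Complex.re_ofReal_mul]; ring
    · rw [Complex.add_im, Complex.ofReal_im, Complex.im_ofReal_mul, zero_add,
        div_mul_cancel₀ _ hτ.ne']
  rw [ha, hb]
  linear_combination hu

-- The weight `exp (3π (Im u)² / Im τ)` compensates the multiplier, so the weighted norm is doubly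
-- periodic. Singularities are removable by the condition at 0, hence the weighted norm is bounded
-- on a period parallelogram and thus everywhere. As the weight is at least 1, the function itself
-- is bounded and entire, so constant, and the sign in `f (u + 1) = -f u` makes the constant zero.
open Classical in
lemma eq_zero_of_quasiperiodic {τ : ℂ} (hτ : 0 < τ.im) {f : ℂ → ℂ}
    (hd : ∀ u, OffLattice τ u → DifferentiableAt ℂ f u)
    (h1 : ∀ u, OffLattice τ u → f (u + 1) = -f u)
    (h2 : ∀ u, OffLattice τ u → f (u + τ) = -e (3 * τ / 2 + 3 * u) * f u)
    (h0 : Tendsto (fun u => u * f u) (𝓝[≠] 0) (𝓝 0)) {u : ℂ} (hu : OffLattice τ u) : f u = 0 := by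
  set E : ℂ → ℝ := fun u => Real.exp (3 * Real.pi * u.im ^ 2 / τ.im) with hE
  have hEc : Continuous E := by fun_prop
  -- Nothing is known about `f` at lattice points; the default 0 there keeps `N` periodic.
  set N : ℂ → ℝ := fun u => if OffLattice τ u then ‖f u‖ * E u else 0 with hN
  have p1 : Function.Periodic N 1 := by
    intro w
    simp only [hN, OffLattice.add_one_iff]
    split_ifs with h
    · rw [h1 w h, norm_neg]
      simp [hE]
    · rfl
  have p2 : Function.Periodic N τ := by
    intro w
    simp only [hN, OffLattice.add_tau_iff]
    split_ifs with h
    · rw [h2 w h, norm_mul, norm_neg, norm_e]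
      simp only [hE]
      rw [mul_comm _ ‖f w‖, mul_assoc, ← Real.exp_add]
      congr 2
      have : (3 * τ / 2 + 3 * w).im = 3 / 2 * τ.im + 3 * w.im := by
        rw [show 3 * τ / 2 + 3 * w = ((3 / 2 : ℝ) : ℂ) * τ + ((3 : ℝ) : ℂ) * w by push_cast; ring,
          Complex.add_im, Complex.im_ofReal_mul, Complex.im_ofReal_mul]
      rw [this, Complex.add_im]
      field_simp
      ring
    · rfl
  have pl : ∀ r s : ℤ, Function.Periodic N (s * 1 + r * τ) := fun r s =>
    (p1.int_mul s).add_period (p2.int_mul r)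
  -- Periodicity of `N` transports the condition at 0 to every lattice point.
  have hres : ∀ l, ¬ OffLattice τ l → Tendsto (fun w => (w - l) * f w) (𝓝[≠] l) (𝓝 0) := by
    intro l hl
    obtain ⟨r, s, rfl⟩ := not_offLattice_iff.mp hl
    have hN0 : Tendsto (fun w => ‖w‖ * N w) (𝓝[≠] 0) (𝓝 0) := by
      have := h0.norm.mul ((hEc.tendsto 0).mono_left nhdsWithin_le_nhds)
      rw [norm_zero, zero_mul] at this
      refine this.congr' ?_
      filter_upwards [eventually_offLattice_punctured hτ 0] with w hw
      simp only [hN, if_pos hw, norm_mul, mul_assoc]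
    have ht : Tendsto (fun w : ℂ => w - (s + r * τ)) (𝓝[≠] (s + r * τ)) (𝓝[≠] 0) := by
      refine tendsto_nhdsWithin_iff.mpr ⟨?_, ?_⟩
      · have : Continuous fun w : ℂ => w - (s + r * τ) := by fun_prop
        simpa using (this.tendsto (s + r * τ)).mono_left nhdsWithin_le_nhds
      · filter_upwards [self_mem_nhdsWithin] with w hw
        exact sub_ne_zero.mpr hw
    rw [tendsto_zero_iff_norm_tendsto_zero]
    have hE' : Tendsto (fun w => (E w)⁻¹) (𝓝[≠] (s + r * τ)) (𝓝 (E (s + r * τ))⁻¹) :=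
      ((hEc.inv₀ fun w => (Real.exp_pos _).ne').tendsto _).mono_left nhdsWithin_le_nhds
    have := (hN0.comp ht).mul hE'
    rw [zero_mul] at this
    refine this.congr' ?_
    filter_upwards [eventually_offLattice_punctured hτ (s + r * τ)] with w hw
    have := pl r s (w - (s + r * τ))
    rw [mul_one, sub_add_cancel] at this
    rw [Function.comp_apply, ← this]
    simp only [hN, if_pos hw, norm_mul]
    rw [mul_assoc, mul_assoc, mul_inv_cancel₀ (Real.exp_pos _).ne', mul_one]
  set F : ℂ → ℂ := fun w => if OffLattice τ w then f w else limUnder (𝓝[≠] w) f with hF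
  have hFd : Differentiable ℂ F := by
    intro w
    by_cases hw : OffLattice τ w
    · refine (hd w hw).congr_of_eventuallyEq ?_
      filter_upwards [hw.eventually hτ] with z hz
      simp only [hF, if_pos hz]
    · obtain ⟨s, hs, hso⟩ := eventually_iff_exists_mem.mp (eventually_offLattice_punctured hτ w)
      rw [mem_nhdsWithin_iff_exists_mem_nhds_inter] at hs
      obtain ⟨U, hU, hUs⟩ := hs
      have hupd := Complex.differentiableOn_update_limUnder_of_isLittleO (f := f) hU
        (fun z hz => (hd z (hso z (hUs ⟨hz.1, hz.2⟩))).differentiableWithinAt) (by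
          rw [Asymptotics.isLittleO_iff_tendsto']
          · have h3 := hres w hw
            have h4 : Tendsto (fun z : ℂ => (z - w) * f w) (𝓝[≠] w) (𝓝 0) := by
              have : Continuous fun z : ℂ => (z - w) * f w := by fun_prop
              simpa using (this.tendsto w).mono_left nhdsWithin_le_nhds
            have h5 := h3.sub h4
            rw [sub_zero] at h5
            refine h5.congr fun z => ?_
            rw [div_inv_eq_mul]; ring
          · filter_upwards [self_mem_nhdsWithin] with z hz h
            exact absurd (inv_eq_zero.mp h) (sub_ne_zero.mpr hz))
      refine (hupd.differentiableAt hU).congr_of_eventuallyEq ?_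
      filter_upwards [hU] with z hz
      by_cases hzw : z = w
      · subst hzw
        simp only [hF, if_neg hw, Function.update_self]
      · simp only [hF, if_pos (hso z (hUs ⟨hz, hzw⟩)), Function.update_of_ne hzw]
  have hK : IsCompact ((fun p : ℝ × ℝ => (p.1 : ℂ) + p.2 * τ) ''
      (Set.Icc (0 : ℝ) 1 ×ˢ Set.Icc (0 : ℝ) 1)) :=
    (isCompact_Icc.prod isCompact_Icc).image (by fun_prop)
  obtain ⟨C, hC⟩ := hK.exists_bound_of_continuousOn
    (f := fun w => ‖F w‖ * E w) (hFd.continuous.norm.mul hEc).continuousOn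
  have hbound : ∀ w, OffLattice τ w → ‖F w‖ ≤ C := by
    intro w hw
    obtain ⟨a, ha, b, hb, r, s, hw'⟩ := exists_lattice_translate hτ w
    have h3 := pl r s (a + b * τ)
    rw [← hw'] at h3
    have h4 := hC (a + b * τ) ⟨(a, b), ⟨ha, hb⟩, rfl⟩
    have h5 : N (a + b * τ) ≤ C := by
      refine le_trans ?_ h4
      rw [Real.norm_of_nonneg (by positivity)]
      simp only [hN, hF]
      split_ifs
      · exact le_rfl
      · positivity
    rw [← h3] at h5
    simp only [hN, if_pos hw] at h5
    simp only [hF, if_pos hw]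
    refine le_trans (le_mul_of_one_le_right (norm_nonneg _) ?_) h5
    exact Real.one_le_exp (by positivity)
  have hbound' : ∀ w, ‖F w‖ ≤ C := fun w =>
    le_of_tendsto ((hFd.continuous.norm.tendsto w).mono_left nhdsWithin_le_nhds)
      ((eventually_offLattice_punctured hτ w).mono hbound)
  have hconst := hFd.apply_eq_apply_of_bounded
    (isBounded_iff_forall_norm_le.mpr ⟨C, by rintro _ ⟨w, rfl⟩; exact hbound' w⟩) (u + 1) u
  simp only [hF, if_pos hu, if_pos hu.add_one, h1 u hu] at hconst
  linear_combination (-1 / 2 : ℂ) * hconst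

/-! ### The completed Appell–Lerch sum -/

/-- The completed Appell–Lerch sum. -/
def completion (τ u : ℂ) : ℂ := e (u / 2) * appell τ u / etaFn τ + nonhol τ u / 2

lemma completion_add_one (τ u : ℂ) : completion τ (u + 1) = -completion τ u := by
  rw [completion, completion, appell_add_one, nonhol_add_one,
    show e ((u + 1) / 2) = -e (u / 2) by rw [add_div, e_add, e_half]; ring]
  ring

lemma completion_neg (τ u : ℂ) : completion τ (-u) = -completion τ u := by
  rw [completion, completion, appell_neg, nonhol_neg,
    show e (u / 2) = e (-u / 2) * e u by rw [← e_add]; congr 1; ring]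
  ring

/-- The inhomogeneous terms of `appell_add_tau` and `nonhol_add_tau` cancel; this is what fixes the
coefficient `1/2` of `nonhol`. -/
lemma completion_add_tau {τ u : ℂ} (hτ : 0 < τ.im) (hu : OffLattice τ u) :
    completion τ (u + τ) = -e (3 * τ / 2 + 3 * u) * completion τ u := by
  have hP := eulerProd_ne_zero hτ
  rw [completion, completion, appell_add_tau hτ hu, nonhol_add_tau hτ, etaFn]
  have e1 : e ((u + τ) / 2) = e (τ / 24) * e (u / 2 + 11 * τ / 24) := by
    rw [← e_add]; congr 1; ring
  have e2 : e (u / 2 + 11 * τ / 24) * e (τ + 2 * u) = e (35 * τ / 24 + 5 * u / 2) := by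
    rw [← e_add]; congr 1; ring
  have e3 : e (3 * τ / 2 + 3 * u) * e (-(τ / 24 + u / 2)) = e (35 * τ / 24 + 5 * u / 2) := by
    rw [← e_add]; congr 1; ring
  have e4 : e (3 * τ / 2 + 3 * u) * e (-(25 * τ / 24 + 5 * u / 2)) = e (u / 2 + 11 * τ / 24) := by
    rw [← e_add]; congr 1; ring
  have e5 : e (u / 2 + 11 * τ / 24) * e (τ / 24) * e (τ + 3 * u) =
      e (3 * τ / 2 + 3 * u) * e (u / 2) := by
    rw [← e_add, ← e_add, ← e_add]; congr 1; ring
  have h24 := e_ne_zero (τ / 24)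
  rw [e1]
  have h6 : e (τ / 24) * e (u / 2 + 11 * τ / 24) *
      (-e (τ + 3 * u) * appell τ u + eulerProd τ * (1 - e (τ + 2 * u))) /
      (e (τ / 24) * eulerProd τ) = -(e (3 * τ / 2 + 3 * u) * e (u / 2)) * appell τ u /
      (e (τ / 24) * eulerProd τ) + (e (u / 2 + 11 * τ / 24) - e (35 * τ / 24 + 5 * u / 2)) := by
    rw [← e5, ← e2]
    field_simp
  rw [h6]
  linear_combination e3 - e4

lemma im_div_eq (τ u : ℂ) : (u / τ).im = (u.im * τ.re - u.re * τ.im) / Complex.normSq τ := by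
  rw [Complex.div_im]; ring

/-- For `c² = -iτ` one has `|τ| = c c̄` and `c̄² = i τ̄`. -/
lemma csqrt_conj_identity {τ : ℂ} : (‖τ‖ : ℂ) * (starRingEnd ℂ) (csqrt (-Complex.I * τ)) =
    Complex.I * csqrt (-Complex.I * τ) * (starRingEnd ℂ) τ := by
  set c := csqrt (-Complex.I * τ) with hc
  have h1 : c ^ 2 = -Complex.I * τ := csqrt_sq _
  have h2 : (‖τ‖ : ℂ) = c * (starRingEnd ℂ) c := by
    rw [Complex.mul_conj, Complex.normSq_eq_norm_sq, ← norm_pow, h1]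
    simp
  have h3 := congrArg (starRingEnd ℂ) h1
  rw [map_pow, map_mul, map_neg, Complex.conj_I] at h3
  rw [h2]
  linear_combination c * h3

lemma exponent_S {x v w y : ℝ} (hv : 0 < v) :
    -6 * Real.pi * ((y * x - w * v) / (x * x + v * v)) ^ 2 / (v / (x * x + v * v)) -
      4 * Real.pi * (3 / 2 * ((2 * w * y * x - (w ^ 2 - y ^ 2) * v) / (x * x + v * v))) =
    -6 * Real.pi * y ^ 2 / v := by
  have : 0 < x * x + v * v := by nlinarith
  field_simp
  ring

/-- The conjugate of `thetaChi_S`, with the real exponentials matched by `exponent_S`. The factor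
`τ̄` is what the chain rule divides by when a function of `u / τ` is differentiated with respect to
`ū`. -/
lemma tsum_nonholIm_S {τ : ℂ} (hτ : 0 < τ.im) (u : ℂ) :
    (∑' n, nonholIm (-1 / τ) (u / τ) n) * e (3 * u ^ 2 / (2 * τ)) =
      Complex.I * csqrt (-Complex.I * τ) * (starRingEnd ℂ) τ * ∑' n, nonholIm τ u n := by
  have hτ0 : τ ≠ 0 := by rintro rfl; simp at hτ
  have hN : 0 < ‖τ‖ := norm_pos_iff.mpr hτ0
  have hN2 : Complex.normSq τ = ‖τ‖ ^ 2 := Complex.normSq_eq_norm_sq τ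
  have him : (-1 / τ).im = τ.im / Complex.normSq τ := by
    rw [Complex.div_im]; simp [neg_div]
  have hw : (3 * u ^ 2 / (2 * τ)).im =
      3 / 2 * ((2 * u.re * u.im * τ.re - (u.re ^ 2 - u.im ^ 2) * τ.im) / Complex.normSq τ) := by
    rw [show 3 * u ^ 2 / (2 * τ) = ((3 / 2 : ℝ) : ℂ) * (u ^ 2 / τ) by push_cast; field_simp,
      Complex.im_ofReal_mul, Complex.div_im, sq u, Complex.mul_im, Complex.mul_re]
    ring
  have hee : (starRingEnd ℂ) (e (3 * u ^ 2 / (2 * τ))) * e (3 * u ^ 2 / (2 * τ)) =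
      ((Real.exp (-4 * Real.pi * (3 * u ^ 2 / (2 * τ)).im) : ℝ) : ℂ) := by
    rw [mul_comm, Complex.mul_conj, Complex.normSq_eq_norm_sq, norm_e, ← Real.exp_nat_mul]
    congr 2
    push_cast
    ring
  have hreal : 12 * √((-1 / τ).im / 6) / (-1 / τ).im *
      Real.exp (-6 * Real.pi * (u / τ).im ^ 2 / (-1 / τ).im) *
      Real.exp (-4 * Real.pi * (3 * u ^ 2 / (2 * τ)).im) =
      ‖τ‖ * (12 * √(τ.im / 6) / τ.im * Real.exp (-6 * Real.pi * u.im ^ 2 / τ.im)) := by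
    rw [mul_assoc, ← Real.exp_add, hw, him, im_div_eq, ← exponent_S (x := τ.re) (w := u.re) hτ,
      ← Complex.normSq_apply]
    have h1 : √(τ.im / Complex.normSq τ / 6) = √(τ.im / 6) / ‖τ‖ := by
      rw [hN2, show τ.im / ‖τ‖ ^ 2 / 6 = τ.im / 6 / ‖τ‖ ^ 2 by ring,
        Real.sqrt_div (by positivity), Real.sqrt_sq hN.le]
    have h2 : 12 * √(τ.im / Complex.normSq τ / 6) / (τ.im / Complex.normSq τ) =
        ‖τ‖ * (12 * √(τ.im / 6) / τ.im) := by
      rw [h1, hN2]; field_simp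
    rw [h2, mul_assoc]
    congr 3
    ring
  have hrealC := congrArg (fun r : ℝ => (r : ℂ)) hreal
  rw [tsum_nonholIm (im_neg_one_div hτ), tsum_nonholIm hτ, thetaChi_S hτ, map_mul, map_mul,
    ← csqrt_conj_identity]
  push_cast at hrealC hee ⊢
  linear_combination (-(12 * ((√((-1 / τ).im / 6) : ℝ) : ℂ) / ((-1 / τ).im : ℂ) *
      Complex.exp (-6 * Real.pi * ((u / τ).im : ℂ) ^ 2 / ((-1 / τ).im : ℂ))) *
      (starRingEnd ℂ) (csqrt (-Complex.I * τ)) * (starRingEnd ℂ) (thetaChi τ u)) * hee -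
    (starRingEnd ℂ) (csqrt (-Complex.I * τ)) * (starRingEnd ℂ) (thetaChi τ u) * hrealC

/-- The Cauchy–Riemann equation: the antilinear parts of the two real derivatives cancel by
`tsum_nonholIm_S`. -/
lemma differentiableAt_S_defect {τ u : ℂ} (hτ : 0 < τ.im) (hu : OffLattice τ u) :
    DifferentiableAt ℂ (fun u => completion (-1 / τ) (u / τ) * e (3 * u ^ 2 / (2 * τ)) -
      Complex.I * csqrt (-Complex.I * τ) * completion τ u) u := by
  have hτ0 : τ ≠ 0 := by rintro rfl; simp at hτ
  have hτ' : 0 < (-1 / τ).im := im_neg_one_div hτ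
  obtain ⟨b, hb⟩ := hasFDerivAt_nonhol hτ u
  obtain ⟨b', hb'⟩ := hasFDerivAt_nonhol hτ' (u / τ)
  have hkey := tsum_nonholIm_S hτ u
  set A := ∑' n, nonholIm τ u n
  set A' := ∑' n, nonholIm (-1 / τ) (u / τ) n
  set c := csqrt (-Complex.I * τ)
  have hlin : HasDerivAt (fun u : ℂ => u / τ) (1 / τ) u := (hasDerivAt_id u).div_const τ
  have hE : HasDerivAt (fun u : ℂ => e (3 * u ^ 2 / (2 * τ)))
      (2 * Real.pi * Complex.I * e (3 * u ^ 2 / (2 * τ)) * (3 * (2 * u) / (2 * τ))) u := by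
    have : HasDerivAt (fun u : ℂ => 3 * u ^ 2 / (2 * τ)) (3 * (2 * u) / (2 * τ)) u := by
      simpa using (((hasDerivAt_id u).pow 2).const_mul 3).div_const (2 * τ)
    exact (hasDerivAt_e _).comp u this
  have hnon : DifferentiableAt ℂ (fun u => nonhol (-1 / τ) (u / τ) / 2 * e (3 * u ^ 2 / (2 * τ)) -
      Complex.I * c * (nonhol τ u / 2)) u := by
    have h1 := ((hb'.comp u hlin.complexToReal_fderiv).mul_const (1 / 2 : ℂ)).mul
      hE.complexToReal_fderiv
    have h2 := (hb.mul_const (1 / 2 : ℂ)).const_mul (Complex.I * c)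
    have h3 := h1.sub h2
    set D := 2 * Real.pi * Complex.I * e (3 * u ^ 2 / (2 * τ)) * (3 * (2 * u) / (2 * τ))
    have h4 := hasFDerivAt_of_restrictScalars ℝ h3
      (f' := (nonhol (-1 / τ) (u / τ) * (1 / 2) * D + e (3 * u ^ 2 / (2 * τ)) * (1 / 2) *
        (A' / (2 * Complex.I * τ) + b' / τ) - Complex.I * c * (1 / 2) *
        (A / (2 * Complex.I) + b)) • ContinuousLinearMap.id ℂ ℂ) (by
        refine ContinuousLinearMap.ext fun z => ?_
        -- This separates the complex-linear part of `Im` from the antilinear one.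
        have him : ∀ w : ℂ, (w.im : ℂ) = (w - (starRingEnd ℂ) w) / (2 * Complex.I) := by
          intro w
          rw [Complex.sub_conj]
          field_simp
          push_cast
          ring
        simp only [ContinuousLinearMap.coe_restrictScalars', smul_apply,
          ContinuousLinearMap.id_apply, sub_apply, add_apply, ContinuousLinearMap.comp_apply,
          one_apply_eq_self, smul_eq_mul, imC_apply, him, Function.comp_apply]
        rw [map_mul, map_div₀, map_one]
        have hs : (starRingEnd ℂ) τ ≠ 0 := by simpa using hτ0
        generalize (starRingEnd ℂ) τ = s at *
        generalize (starRingEnd ℂ) z = z'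
        generalize e (3 * u ^ 2 / (2 * τ)) = E at *
        have hI := Complex.I_ne_zero
        have hA : A' * E / s = Complex.I * c * A := by rw [hkey]; field_simp
        linear_combination (z' / (4 * Complex.I)) * hA)
    refine h4.differentiableAt.congr_of_eventuallyEq (Eventually.of_forall fun w => ?_)
    simp only [Pi.sub_apply, Pi.mul_apply, Function.comp_apply]
    ring
  have hτu := hu.div_tau hτ0
  have hA' : DifferentiableAt ℂ (fun u => appell (-1 / τ) (u / τ)) u :=
    (differentiableAt_appell hτ' hτu).comp (f := fun u => u / τ) u hlin.differentiableAt
  have hA := differentiableAt_appell hτ hu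
  have he : Differentiable ℂ (fun w : ℂ => e (w / 2)) :=
    differentiable_e.comp (differentiable_id.div_const 2)
  have he' : DifferentiableAt ℂ (fun u : ℂ => e (u / τ / 2)) u :=
    (he _).comp (f := fun u => u / τ) u hlin.differentiableAt
  have hhol : DifferentiableAt ℂ (fun u => e (u / τ / 2) * appell (-1 / τ) (u / τ) /
      etaFn (-1 / τ) * e (3 * u ^ 2 / (2 * τ)) -
      Complex.I * c * (e (u / 2) * appell τ u / etaFn τ)) u :=
    (((he'.mul hA').div_const _).mul hE.differentiableAt).sub
      ((((he u).mul hA).div_const _).const_mul _)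
  refine (hhol.add hnon).congr_of_eventuallyEq (Eventually.of_forall fun w => ?_)
  simp only [completion, Pi.add_apply]
  ring

lemma tendsto_mul_completion {τ : ℂ} (hτ : 0 < τ.im) :
    Tendsto (fun u => u * completion τ u) (𝓝[≠] 0)
      (𝓝 (-(2 * Real.pi * Complex.I)⁻¹ / etaFn τ)) := by
  have he : Tendsto (fun u : ℂ => e (u / 2)) (𝓝[≠] 0) (𝓝 1) := by
    have : Continuous fun w : ℂ => e (w / 2) := continuous_e.comp (continuous_id.div_const 2)
    simpa [e_zero] using (this.tendsto 0).mono_left nhdsWithin_le_nhds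
  have hn : Tendsto (fun u : ℂ => u * (nonhol τ u / 2)) (𝓝[≠] 0) (𝓝 0) := by
    have : Continuous fun u : ℂ => u * (nonhol τ u / 2) :=
      continuous_id.mul ((continuous_nonhol hτ).div_const 2)
    simpa using (this.tendsto 0).mono_left nhdsWithin_le_nhds
  have := ((he.mul (tendsto_mul_appell hτ)).div_const (etaFn τ)).add hn
  rw [one_mul, add_zero] at this
  refine this.congr fun u => ?_
  rw [completion]; ring

/-- The modular transformation law of the completed Appell–Lerch sum. -/
lemma completion_S {τ u : ℂ} (hτ : 0 < τ.im) (hu : OffLattice τ u) :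
    completion (-1 / τ) (u / τ) * e (3 * u ^ 2 / (2 * τ)) =
      Complex.I * csqrt (-Complex.I * τ) * completion τ u := by
  have hτ0 : τ ≠ 0 := by rintro rfl; simp at hτ
  have hτ' : 0 < (-1 / τ).im := im_neg_one_div hτ
  rw [← sub_eq_zero]
  refine eq_zero_of_quasiperiodic hτ (f := fun u => completion (-1 / τ) (u / τ) *
    e (3 * u ^ 2 / (2 * τ)) - Complex.I * csqrt (-Complex.I * τ) * completion τ u)
    (fun u hu => differentiableAt_S_defect hτ hu) (fun u hu => ?_) (fun u hu => ?_) ?_ hu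
  -- Inversion exchanges the two periods: adding `-1/τ` to `(u + 1)/τ` returns `u/τ`.
  · have h1 := completion_add_tau hτ' (hu.add_one.div_tau hτ0)
    rw [show (u + 1) / τ + -1 / τ = u / τ by ring] at h1
    have h2 : e (3 * (u + 1) ^ 2 / (2 * τ)) =
        e (3 * (-1 / τ) / 2 + 3 * ((u + 1) / τ)) * e (3 * u ^ 2 / (2 * τ)) := by
      rw [← e_add]; congr 1; field_simp; ring
    rw [completion_add_one, h1, h2]
    ring
  · have h2 : e (3 * (u + τ) ^ 2 / (2 * τ)) =
        e (3 * τ / 2 + 3 * u) * e (3 * u ^ 2 / (2 * τ)) := by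
      rw [← e_add]; congr 1; field_simp; ring
    rw [completion_add_tau hτ hu, h2, show (u + τ) / τ = u / τ + 1 by field_simp,
      completion_add_one]
    ring
  · have ht : Tendsto (fun u : ℂ => u / τ) (𝓝[≠] 0) (𝓝[≠] 0) := by
      refine tendsto_nhdsWithin_iff.mpr ⟨?_, ?_⟩
      · have : Continuous fun u : ℂ => u / τ := by fun_prop
        simpa using (this.tendsto 0).mono_left nhdsWithin_le_nhds
      · filter_upwards [self_mem_nhdsWithin] with w hw
        exact div_ne_zero hw hτ0
    have h1 := (tendsto_mul_completion hτ').comp ht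
    have hE : Tendsto (fun u : ℂ => τ * e (3 * u ^ 2 / (2 * τ))) (𝓝[≠] 0) (𝓝 τ) := by
      have : Continuous fun u : ℂ => τ * e (3 * u ^ 2 / (2 * τ)) :=
        continuous_const.mul (continuous_e.comp (by fun_prop))
      simpa [e_zero] using (this.tendsto 0).mono_left nhdsWithin_le_nhds
    have h2 := (h1.mul hE).sub ((tendsto_mul_completion hτ).const_mul
      (Complex.I * csqrt (-Complex.I * τ)))
    -- The residues at the origin cancel, by the inversion of `η` and `τ = i c²` for `c = √(-iτ)`.
    have h3 : -(2 * Real.pi * Complex.I)⁻¹ / etaFn (-1 / τ) * τ -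
        Complex.I * csqrt (-Complex.I * τ) * (-(2 * Real.pi * Complex.I)⁻¹ / etaFn τ) = 0 := by
      rw [etaFn_S hτ]
      have hη := etaFn_ne_zero hτ
      have hc : csqrt (-Complex.I * τ) ≠ 0 := csqrt_ne_zero (by simp [hτ0])
      have hc2 := csqrt_sq (-Complex.I * τ)
      generalize csqrt (-Complex.I * τ) = c at *
      have : τ = Complex.I * c ^ 2 := by rw [hc2, ← mul_assoc]; simp
      generalize (2 * Real.pi * Complex.I)⁻¹ = R
      generalize etaFn τ = η at *
      rw [this]
      field_simp
      ring
    rw [h3] at h2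
    refine h2.congr fun w => ?_
    simp only [Function.comp_apply]
    field_simp

/-! ### The components of `H3` as special values of the completed sum. -/

/-! ### Incomplete Gaussian integrals -/

lemma tendsto_gaussErf_atTop : Tendsto gaussErf atTop (𝓝 1) := by
  have h1 : Tendsto (fun x : ℝ => 2 * Real.exp (Real.pi * 1 ^ 2 - 2 * Real.pi * 1 * x)) atTop
      (𝓝 0) := by
    have : Tendsto (fun x : ℝ => Real.pi * 1 ^ 2 - 2 * Real.pi * 1 * x) atTop atBot := by
      simp only [sub_eq_add_neg]
      refine tendsto_atBot_add_const_left _ _ ?_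
      exact tendsto_neg_atTop_atBot.comp (tendsto_id.const_mul_atTop (by positivity))
    simpa using (Real.tendsto_exp_atBot.comp this).const_mul 2
  have h2 := squeeze_zero one_sub_gaussErf_nonneg
    (fun x => one_sub_gaussErf_le x zero_le_one) h1
  simpa using h2.const_sub 1

lemma integrableOn_gaussErf_deriv {s k : ℝ} (hs : 0 < s) (hk : 0 < k) :
    MeasureTheory.IntegrableOn
      (fun t => k * Real.exp (-Real.pi * k ^ 2 * (s + t)) / √(s + t)) (Set.Ioi 0) := by
  have hc : 0 < Real.pi * k ^ 2 := by positivity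
  refine MeasureTheory.Integrable.mono' (g := fun t => k / √s * Real.exp (-(Real.pi * k ^ 2) * t))
    ((exp_neg_integrableOn_Ioi 0 hc).const_mul _) ?_ ?_
  · refine ContinuousOn.aestronglyMeasurable (fun t ht => ?_) measurableSet_Ioi
    have ht' : 0 < t := ht
    refine ContinuousAt.continuousWithinAt (ContinuousAt.div (by fun_prop) (by fun_prop) ?_)
    positivity
  · filter_upwards [MeasureTheory.ae_restrict_mem measurableSet_Ioi] with t ht
    have ht' : 0 < t := ht
    rw [Real.norm_of_nonneg (by positivity), mul_div_right_comm]
    have h1 : √s ≤ √(s + t) := Real.sqrt_le_sqrt (by linarith)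
    have h2 : 0 < √s := Real.sqrt_pos.mpr hs
    have h3 : Real.exp (-Real.pi * k ^ 2 * (s + t)) ≤ Real.exp (-(Real.pi * k ^ 2) * t) :=
      Real.exp_le_exp.mpr (by nlinarith [mul_pos hc hs])
    gcongr

/-- The integrand is the `t`-derivative of `E (k √(s + t))`. -/
lemma integral_gaussErf_deriv {s k : ℝ} (hs : 0 < s) (hk : 0 < k) :
    ∫ t in Set.Ioi (0 : ℝ), k * Real.exp (-Real.pi * k ^ 2 * (s + t)) / √(s + t) =
      1 - gaussErf (k * √s) := by
  have hd : ∀ t ∈ Set.Ici (0 : ℝ), HasDerivAt (fun t => gaussErf (k * √(s + t)))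
      (k * Real.exp (-Real.pi * k ^ 2 * (s + t)) / √(s + t)) t := by
    intro t ht
    have ht' : 0 < s + t := add_pos_of_pos_of_nonneg hs ht
    have h1 := (((hasDerivAt_id t).const_add s).sqrt ht'.ne').const_mul k
    have h2 := (hasDerivAt_gaussErf _).comp t h1
    refine h2.congr_deriv ?_
    rw [id, mul_pow, Real.sq_sqrt ht'.le]
    field_simp
  have ht : Tendsto (fun t => gaussErf (k * √(s + t))) atTop (𝓝 1) := by
    refine tendsto_gaussErf_atTop.comp (Tendsto.const_mul_atTop hk ?_)
    exact Real.tendsto_sqrt_atTop.comp (tendsto_atTop_add_const_left _ _ tendsto_id)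
  have := MeasureTheory.integral_Ioi_of_hasDerivAt_of_tendsto' hd
    (integrableOn_gaussErf_deriv hs hk) ht
  simpa using this

lemma gaussErf_zero : gaussErf 0 = 0 := by simp [gaussErf]

lemma mul_integral_eq_signErf {s : ℝ} (hs : 0 < s) (n : ℤ) :
    n * ∫ t in Set.Ioi (0 : ℝ), Real.exp (-Real.pi * (n ^ 2 / 24) * (s + t)) / √(s + t) =
      √24 * signErf n (n * √(s / 24)) := by
  have pos : ∀ n : ℤ, 0 < n →
      n * ∫ t in Set.Ioi (0 : ℝ), Real.exp (-Real.pi * (n ^ 2 / 24) * (s + t)) / √(s + t) =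
      √24 * signErf n (n * √(s / 24)) := by
    intro n hn
    have hk : (0 : ℝ) < n / √24 := by positivity
    have h1 := integral_gaussErf_deriv hs hk
    simp only [div_pow, Real.sq_sqrt (show (0 : ℝ) ≤ 24 by norm_num), mul_div_assoc _ (Real.exp _)]
      at h1
    rw [MeasureTheory.integral_const_mul] at h1
    rw [signErf, Int.sign_eq_one_of_pos hn, Int.cast_one, Real.sqrt_div hs.le,
      show (n : ℝ) * (√s / √24) = n / √24 * √s by ring, ← h1]
    field_simp
  rcases lt_trichotomy n 0 with h | rfl | h
  · have := pos (-n) (by omega)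
    push_cast at this
    rw [neg_sq, neg_mul, neg_mul (n : ℝ), signErf_neg] at this
    linarith
  · simp [signErf, gaussErf_zero]
  · exact pos n h

/-! ### Non-holomorphic Eichler integrals as series -/

/-- The terms of the non-holomorphic Eichler integral of `∑ c n * n * e (n² z / 48)`. -/
def eichlerTerm (c : ℤ → ℂ) (τ : ℂ) (n : ℤ) : ℂ :=
  c n * (signErf n (n * √(τ.im / 12)) : ℝ) * e (-(τ * (n ^ 2 / 48)))

/-- The non-holomorphic Eichler integral of `∑ c n * n * e (n² z / 48)`. -/
def eichler (c : ℤ → ℂ) (τ : ℂ) : ℂ := ∑' n, eichlerTerm c τ n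

lemma norm_e_sq (z : ℂ) (n : ℤ) :
    ‖e (z * (n ^ 2 / 48))‖ = Real.exp (-(Real.pi * z.im / 24) * n ^ 2) := by
  rw [norm_e, show z * ((n : ℂ) ^ 2 / 48) = ((n ^ 2 / 48 : ℝ) : ℂ) * z by push_cast; ring,
    Complex.im_ofReal_mul]
  congr 1
  ring

lemma signErf_zero_zero : signErf 0 0 = 0 := by simp [signErf, gaussErf_zero]

lemma abs_signErf_mul_norm_e_le {τ : ℂ} (hτ : 0 < τ.im) (n : ℤ) :
    |signErf n (n * √(τ.im / 12))| * ‖e (-(τ * (n ^ 2 / 48)))‖ ≤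
      2 * Real.exp (-(Real.pi * τ.im / 24) * n ^ 2) := by
  rcases eq_or_ne n 0 with rfl | hn
  · simp [signErf_zero_zero]
  · have h1 := abs_signErf_le hn (n * √(τ.im / 12)) (Real.sqrt_nonneg (τ.im / 12))
    rw [← neg_mul, norm_e_sq]
    calc _ ≤ 2 * Real.exp (Real.pi * (n * √(τ.im / 12)) ^ 2 -
        2 * Real.pi * (n * √(τ.im / 12)) * (n * √(τ.im / 12))) *
        Real.exp (-(Real.pi * (-τ).im / 24) * n ^ 2) := by gcongr
      _ = _ := by
        rw [mul_assoc, ← Real.exp_add]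
        congr 2
        have : √(τ.im / 12) ^ 2 = τ.im / 12 := Real.sq_sqrt (by positivity)
        rw [Complex.neg_im]
        linear_combination (-Real.pi * n ^ 2) * this

lemma norm_eichlerTerm_le {c : ℤ → ℂ} {K : ℝ} (hc : ∀ n, ‖c n‖ ≤ K) {τ : ℂ} (hτ : 0 < τ.im)
    (n : ℤ) : ‖eichlerTerm c τ n‖ ≤ 2 * K * Real.exp (-(Real.pi * τ.im / 24) * n ^ 2) := by
  rw [eichlerTerm, norm_mul, norm_mul, Complex.norm_real, Real.norm_eq_abs, mul_assoc]
  have := abs_signErf_mul_norm_e_le hτ n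
  have hK : 0 ≤ K := (norm_nonneg _).trans (hc 0)
  calc _ ≤ K * (2 * Real.exp (-(Real.pi * τ.im / 24) * n ^ 2)) := by
        gcongr; exact hc n
    _ = _ := by ring

lemma summable_exp_neg_sq {a : ℝ} (ha : 0 < a) :
    Summable fun n : ℤ => Real.exp (-a * n ^ 2) := by
  simpa using summable_gaussian ha 0

lemma summable_eichlerTerm {c : ℤ → ℂ} {K : ℝ} (hc : ∀ n, ‖c n‖ ≤ K) {τ : ℂ} (hτ : 0 < τ.im) :
    Summable (eichlerTerm c τ) :=
  Summable.of_norm_bounded ((summable_exp_neg_sq (by positivity)).mul_left _)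
    (norm_eichlerTerm_le hc hτ)

lemma thetaTerm_twelve (z : ℂ) (n : ℤ) : thetaTerm 12 z n = n * e (z * (n ^ 2 / 48)) := by
  rw [thetaTerm]; norm_num

lemma norm_thetaTerm (z : ℂ) (n : ℤ) :
    ‖thetaTerm 12 z n‖ = |(n : ℝ)| * Real.exp (-(Real.pi * z.im / 24) * n ^ 2) := by
  rw [thetaTerm_twelve, norm_mul, norm_e_sq, Complex.norm_intCast]

lemma summable_abs_mul_exp {a : ℝ} (ha : 0 < a) :
    Summable fun n : ℤ => |(n : ℝ)| * Real.exp (-a * n ^ 2) := by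
  simpa using summable_pow_mul_gaussian 1 ha 0

lemma summable_thetaTerm {z : ℂ} (hz : 0 < z.im) : Summable (thetaTerm 12 z) := by
  refine Summable.of_norm ?_
  simp only [norm_thetaTerm]
  exact summable_abs_mul_exp (by positivity)

lemma im_ray (τ : ℍ) (t : ℝ) : (ray τ t).im = τ.im + t := by
  simp [ray]

lemma csqrt_ray (τ : ℍ) {t : ℝ} (ht : 0 < t) :
    csqrt (-Complex.I * (ray τ t + τ)) = (√(2 * τ.im + t) : ℝ) := by
  have hpos : 0 < 2 * τ.im + t := by have := τ.im_pos; positivity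
  refine csqrt_eq ?_ ?_
  · rw [← Complex.ofReal_pow, Real.sq_sqrt hpos.le, ray]
    apply Complex.ext <;> simp
    ring
  · rw [Complex.ofReal_re]
    exact Real.sqrt_pos.mpr hpos

/-- On the half-line `z = -τ + i(2v + t)`, so each term splits into a factor holomorphic in `τ` and
a real exponential in the same quantity `2v + t` that stands under the square root. -/
lemma thetaTerm_ray (τ : ℍ) (t : ℝ) (n : ℤ) : thetaTerm 12 (ray τ t) n =
    n * e (-((τ : ℂ) * (n ^ 2 / 48))) *
      (Real.exp (-Real.pi * (n ^ 2 / 24) * (2 * τ.im + t)) : ℝ) := by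
  have h1 : ray τ t = -(τ : ℂ) + Complex.I * ((2 * τ.im + t : ℝ) : ℂ) := by
    rw [ray]
    apply Complex.ext <;> simp
    ring
  have h2 : e (Complex.I * ((2 * τ.im + t : ℝ) : ℂ) * (n ^ 2 / 48)) =
      (Real.exp (-Real.pi * (n ^ 2 / 24) * (2 * τ.im + t)) : ℝ) := by
    rw [e, Complex.ofReal_exp]
    congr 1
    push_cast
    linear_combination (2 * Real.pi * (2 * ↑τ.im + t) * (n ^ 2 / 48)) * Complex.I_sq
  rw [thetaTerm_twelve, h1, add_mul, e_add, neg_mul, h2]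
  ring

/-- The terms of the integrand of the Eichler integral on the vertical half-line. -/
def rayTerm (c : ℤ → ℂ) (τ : ℍ) (n : ℤ) (t : ℝ) : ℂ :=
  c n * thetaTerm 12 (ray τ t) n / (√(2 * τ.im + t) : ℝ)

lemma norm_rayTerm_le {c : ℤ → ℂ} {K : ℝ} (hc : ∀ n, ‖c n‖ ≤ K) (τ : ℍ) (n : ℤ) {t : ℝ}
    (ht : 0 < t) : ‖rayTerm c τ n t‖ ≤
      |(n : ℝ)| * Real.exp (-(Real.pi * τ.im / 24) * n ^ 2) *
        (K / √(2 * τ.im) * Real.exp (-(Real.pi / 24) * t)) := by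
  have hv := τ.im_pos
  have hK : 0 ≤ K := (norm_nonneg _).trans (hc 0)
  have hs : 0 < √(2 * τ.im) := Real.sqrt_pos.mpr (by positivity)
  rw [rayTerm, norm_div, norm_mul, Complex.norm_real, Real.norm_of_nonneg (Real.sqrt_nonneg _),
    norm_thetaTerm, im_ray]
  rcases eq_or_ne n 0 with rfl | hn
  · simp
  have h1 : Real.exp (-(Real.pi * (τ.im + t) / 24) * n ^ 2) ≤
      Real.exp (-(Real.pi * τ.im / 24) * n ^ 2) * Real.exp (-(Real.pi / 24) * t) := by
    rw [← Real.exp_add]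
    apply Real.exp_le_exp.mpr
    -- The term `n = 0` is absent because of the factor `n`, and `n² ≥ 1` gives decay in `t`
    -- uniformly in the other `n`.
    have h2 : (1 : ℝ) ≤ n ^ 2 := by
      have := Int.one_le_abs hn
      have : (1 : ℤ) ≤ n ^ 2 := by nlinarith [sq_abs n]
      exact_mod_cast this
    have := mul_le_mul_of_nonneg_left h2 (show 0 ≤ Real.pi / 24 * t by positivity)
    nlinarith
  calc _ ≤ K * (|(n : ℝ)| * (Real.exp (-(Real.pi * τ.im / 24) * n ^ 2) *
        Real.exp (-(Real.pi / 24) * t))) / √(2 * τ.im) := by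
        gcongr
        · exact hc n
        · linarith
    _ = _ := by ring

lemma continuous_ray (τ : ℍ) : Continuous (ray τ) := by
  unfold ray; fun_prop

lemma continuousOn_rayTerm (c : ℤ → ℂ) (τ : ℍ) (n : ℤ) :
    ContinuousOn (rayTerm c τ n) (Set.Ioi 0) := by
  intro t ht
  have ht' : 0 < t := ht
  have hpos : 0 < √(2 * τ.im + t) := Real.sqrt_pos.mpr (by have := τ.im_pos; positivity)
  refine ContinuousAt.continuousWithinAt (ContinuousAt.div ?_ (by fun_prop) ?_)
  · simp only [thetaTerm]
    have := continuous_ray τ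
    exact (continuous_const.mul (continuous_const.mul
      (continuous_e.comp (this.mul continuous_const)))).continuousAt
  · exact_mod_cast hpos.ne'

lemma summable_rayTerm {c : ℤ → ℂ} {K : ℝ} (hc : ∀ n, ‖c n‖ ≤ K) (τ : ℍ) {t : ℝ} (ht : 0 < t) :
    Summable fun n => rayTerm c τ n t :=
  Summable.of_norm_bounded ((summable_abs_mul_exp (by have := τ.im_pos; positivity)).mul_right _)
    fun n => norm_rayTerm_le hc τ n ht

lemma integrableOn_tsum_rayTerm {c : ℤ → ℂ} {K : ℝ} (hc : ∀ n, ‖c n‖ ≤ K) (τ : ℍ) :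
    MeasureTheory.IntegrableOn (fun t => ∑' n, rayTerm c τ n t) (Set.Ioi 0) := by
  have hv := τ.im_pos
  have hs := summable_abs_mul_exp (a := Real.pi * τ.im / 24) (by positivity)
  have hK : 0 ≤ K := (norm_nonneg _).trans (hc 0)
  refine MeasureTheory.Integrable.mono' (g := fun t =>
    (∑' n : ℤ, |(n : ℝ)| * Real.exp (-(Real.pi * τ.im / 24) * n ^ 2)) *
        (K / √(2 * τ.im) * Real.exp (-(Real.pi / 24) * t)))
    (((exp_neg_integrableOn_Ioi 0 (by positivity)).const_mul _).const_mul _) ?_ ?_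
  · refine ContinuousOn.aestronglyMeasurable ?_ measurableSet_Ioi
    refine continuousOn_tsum (fun n => continuousOn_rayTerm c τ n)
      (hs.mul_right (K / √(2 * τ.im))) fun n t ht => (norm_rayTerm_le hc τ n ht).trans ?_
    have ht' : 0 < t := ht
    gcongr
    refine mul_le_of_le_one_right (by positivity) (Real.exp_le_one_iff.mpr ?_)
    have := mul_pos Real.pi_pos ht'
    linarith
  · filter_upwards [MeasureTheory.ae_restrict_mem measurableSet_Ioi] with t ht
    rw [← tsum_mul_right]
    exact tsum_of_norm_bounded (hs.mul_right _).hasSum fun n => norm_rayTerm_le hc τ n ht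

lemma integral_rayTerm (c : ℤ → ℂ) (τ : ℍ) (n : ℤ) :
    ∫ t in Set.Ioi (0 : ℝ), rayTerm c τ n t = (√24 : ℝ) * eichlerTerm c τ n := by
  have h1 : ∀ t : ℝ, rayTerm c τ n t = c n * (n * e (-((τ : ℂ) * (n ^ 2 / 48)))) *
      ((Real.exp (-Real.pi * (n ^ 2 / 24) * (2 * τ.im + t)) / √(2 * τ.im + t) : ℝ) : ℂ) := by
    intro t
    rw [rayTerm, thetaTerm_ray]
    push_cast
    ring
  simp only [h1]
  rw [MeasureTheory.integral_const_mul, integral_complex_ofReal]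
  have h2 := mul_integral_eq_signErf (s := 2 * τ.im) (by have := τ.im_pos; positivity) n
  rw [show 2 * τ.im / 24 = τ.im / 12 by ring] at h2
  have h3 := congrArg (fun r : ℝ => (r : ℂ)) h2
  push_cast at h3
  rw [eichlerTerm, UpperHalfPlane.coe_im]
  linear_combination (c n * e (-((τ : ℂ) * (n ^ 2 / 48)))) * h3

lemma integral_tsum_rayTerm {c : ℤ → ℂ} {K : ℝ} (hc : ∀ n, ‖c n‖ ≤ K) (τ : ℍ) :
    ∫ t in Set.Ioi (0 : ℝ), ∑' n, rayTerm c τ n t = (√24 : ℝ) * eichler c τ := by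
  have hv := τ.im_pos
  have hs := summable_abs_mul_exp (a := Real.pi * τ.im / 24) (by positivity)
  have := MeasureTheory.hasSum_integral_of_dominated_convergence
    (μ := MeasureTheory.volume.restrict (Set.Ioi (0 : ℝ))) (F := fun n t => rayTerm c τ n t)
    (f := fun t => ∑' n, rayTerm c τ n t)
    (fun (n : ℤ) t => |(n : ℝ)| * Real.exp (-(Real.pi * τ.im / 24) * n ^ 2) *
        (K / √(2 * τ.im) * Real.exp (-(Real.pi / 24) * t)))
    (fun n => (continuousOn_rayTerm c τ n).aestronglyMeasurable measurableSet_Ioi)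
    (fun n => by
      filter_upwards [MeasureTheory.ae_restrict_mem measurableSet_Ioi] with t ht
      exact norm_rayTerm_le hc τ n ht)
    (Eventually.of_forall fun t => hs.mul_right _)
    (by
      simp only [tsum_mul_right]
      exact ((exp_neg_integrableOn_Ioi 0 (by positivity)).const_mul _).const_mul _)
    (by
      filter_upwards [MeasureTheory.ae_restrict_mem measurableSet_Ioi] with t ht
      exact (summable_rayTerm hc τ ht).hasSum)
  rw [← this.tsum_eq, eichler, ← tsum_mul_left]
  exact tsum_congr fun n => integral_rayTerm c τ n

/-! ### The coefficients of `g3` -/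

/-- The indicator function of a residue class modulo `24`. -/
def residue (a n : ℤ) : ℂ := if n % 24 = a then 1 else 0

lemma norm_residue_le (a n : ℤ) : ‖residue a n‖ ≤ 1 := by
  rw [residue]; split_ifs <;> simp

/-- The coefficients of the components of `g3`. -/
def shadowCoeff (j : Fin 6) (n : ℤ) : ℂ :=
  (![-(residue 1 n + residue 5 n + residue 7 n + residue 11 n),
    -(residue 1 n - residue 5 n + residue 7 n - residue 11 n),
    residue 1 n + residue 5 n + residue 7 n + residue 11 n,
    residue 1 n - residue 5 n + residue 7 n - residue 11 n,
    -((√2 : ℝ) * (residue 4 n + residue 8 n)),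
    (√2 : ℝ) * (residue 4 n + residue 8 n)] : Fin 6 → ℂ) j

lemma norm_shadowCoeff_le (j : Fin 6) (n : ℤ) : ‖shadowCoeff j n‖ ≤ 4 := by
  have h := fun a => norm_residue_le a n
  have h4 : ∀ a b c d : ℂ, ‖a‖ ≤ 1 → ‖b‖ ≤ 1 → ‖c‖ ≤ 1 → ‖d‖ ≤ 1 → ‖a + b + c + d‖ ≤ 4 := by
    intro a b c d ha hb hc hd
    have h1 := norm_add_le (a + b + c) d
    have h2 := norm_add_le (a + b) c
    have h3 := norm_add_le a b
    linarith
  have h5 : ‖((√2 : ℝ) : ℂ) * (residue 4 n + residue 8 n)‖ ≤ 4 := by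
    rw [norm_mul, Complex.norm_real, Real.norm_of_nonneg (Real.sqrt_nonneg _)]
    have h1 := (norm_add_le (residue 4 n) (residue 8 n)).trans (add_le_add (h 4) (h 8))
    have h2 : √2 ≤ 2 := by rw [Real.sqrt_le_iff]; norm_num
    have h3 := norm_nonneg (residue 4 n + residue 8 n)
    nlinarith [Real.sqrt_nonneg 2]
  have hm : ‖residue 1 n - residue 5 n + residue 7 n - residue 11 n‖ ≤ 4 := by
    rw [sub_eq_add_neg, sub_eq_add_neg]
    exact h4 _ _ _ _ (h 1) (by rw [norm_neg]; exact h 5) (h 7) (by rw [norm_neg]; exact h 11)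
  have hp := h4 _ _ _ _ (h 1) (h 5) (h 7) (h 11)
  fin_cases j <;> simp only [shadowCoeff]
  · change ‖-(residue 1 n + residue 5 n + residue 7 n + residue 11 n)‖ ≤ 4
    rw [norm_neg]; exact hp
  · change ‖-(residue 1 n - residue 5 n + residue 7 n - residue 11 n)‖ ≤ 4
    rw [norm_neg]; exact hm
  · exact hp
  · exact hm
  · change ‖-(((√2 : ℝ) : ℂ) * (residue 4 n + residue 8 n))‖ ≤ 4
    rw [norm_neg]; exact h5
  · exact h5

lemma hasSum_theta {z : ℂ} (hz : 0 < z.im) {a : ℤ} (ha : a % 24 = a) :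
    HasSum (fun n => residue a n * thetaTerm 12 z n) (theta 12 a z) := by
  have h1 := (summable_thetaTerm hz).subtype {n : ℤ | n ≡ a [ZMOD (2 * (12 : ℕ))]}
  have h2 : HasSum (Set.indicator {n : ℤ | n ≡ a [ZMOD (2 * (12 : ℕ))]} (thetaTerm 12 z))
      (theta 12 a z) := hasSum_subtype_iff_indicator.mp h1.hasSum
  refine h2.congr_fun fun n => ?_
  have : n ∈ {n : ℤ | n ≡ a [ZMOD (2 * (12 : ℕ))]} ↔ n % 24 = a := by
    rw [Set.mem_ofPred_eq, Int.ModEq]; norm_num; rw [ha]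
  by_cases h : n % 24 = a
  · rw [Set.indicator_of_mem (this.mpr h), residue, if_pos h, one_mul]
  · rw [Set.indicator_of_notMem (mt this.mp h), residue, if_neg h, zero_mul]

lemma hasSum_g3 {z : ℂ} (hz : 0 < z.im) (j : Fin 6) :
    HasSum (fun n => shadowCoeff j n * thetaTerm 12 z n) (g3 z j) := by
  have h1 := hasSum_theta hz (a := 1) rfl
  have h5 := hasSum_theta hz (a := 5) rfl
  have h7 := hasSum_theta hz (a := 7) rfl
  have h11 := hasSum_theta hz (a := 11) rfl
  have hp := ((h1.add h5).add h7).add h11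
  have hm := ((h1.sub h5).add h7).sub h11
  have hr := ((hasSum_theta hz (a := 4) rfl).add (hasSum_theta hz (a := 8) rfl)).mul_left
    ((√2 : ℝ) : ℂ)
  fin_cases j
  · refine hp.neg.congr_fun fun n => ?_
    simp [shadowCoeff]; ring
  · refine hm.neg.congr_fun fun n => ?_
    simp [shadowCoeff]; ring
  · refine hp.congr_fun fun n => ?_
    simp [shadowCoeff]; ring
  · refine hm.congr_fun fun n => ?_
    simp [shadowCoeff]; ring
  · refine hr.neg.congr_fun fun n => ?_
    simp [shadowCoeff]; ring
  · refine hr.congr_fun fun n => ?_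
    simp [shadowCoeff]; ring

lemma G3Integrand_ray (τ : ℍ) (j : Fin 6) {t : ℝ} (ht : 0 < t) :
    G3Integrand τ j (ray τ t) = ∑' n, rayTerm (shadowCoeff j) τ n t := by
  have hz : 0 < (ray τ t).im := by rw [im_ray]; have := τ.im_pos; positivity
  rw [G3Integrand, csqrt_ray τ ht]
  exact ((hasSum_g3 hz j).div_const _).tsum_eq.symm

lemma integrableOn_G3Integrand (τ : ℍ) (j : Fin 6) : MeasureTheory.IntegrableOn
    (fun t : ℝ => G3Integrand τ j (ray τ t)) (Set.Ioi 0) :=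
  (integrableOn_tsum_rayTerm (norm_shadowCoeff_le j) τ).congr_fun
    (fun _ ht => (G3Integrand_ray τ j ht).symm) measurableSet_Ioi

/-- The sign is `i²`, from the prefactor and from `dz = i dt`; the `√24` cancels the one in
`integral_rayTerm`. -/
lemma G3_eq (τ : ℍ) (j : Fin 6) : G3 τ j = -eichler (shadowCoeff j) τ := by
  rw [G3, MeasureTheory.setIntegral_congr_fun measurableSet_Ioi
    (g := fun t => (∑' n, rayTerm (shadowCoeff j) τ n t) * Complex.I)
    fun t ht => by simp only [G3Integrand_ray τ j ht],
    MeasureTheory.integral_mul_const, integral_tsum_rayTerm (norm_shadowCoeff_le j)]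
  have h : ((√24 : ℝ) : ℂ) ≠ 0 := by exact_mod_cast (Real.sqrt_pos.mpr (by norm_num)).ne'
  field_simp
  rw [Complex.I_sq]
  ring

lemma H3_apply (τ : ℍ) (j : Fin 6) : H3 τ j = F3 τ j + eichler (shadowCoeff j) τ := by
  rw [H3, Pi.sub_apply, G3_eq, sub_neg_eq_add]

/-! ### Comparison of Eichler integrals -/

lemma eichler_mul_left (a : ℂ) (c : ℤ → ℂ) (τ : ℂ) :
    eichler (fun n => a * c n) τ = a * eichler c τ := by
  rw [eichler, eichler, ← tsum_mul_left]
  refine tsum_congr fun n => ?_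
  rw [eichlerTerm, eichlerTerm]
  ring

/-- The error function factor is odd in `n` and the exponential even, so only the odd part of the
coefficients counts. -/
lemma two_mul_eichler {c : ℤ → ℂ} {K : ℝ} (hc : ∀ n, ‖c n‖ ≤ K) {τ : ℂ} (hτ : 0 < τ.im) :
    2 * eichler c τ = eichler (fun n => c n - c (-n)) τ := by
  have hs := summable_eichlerTerm hc hτ
  have hs' : Summable fun n => eichlerTerm c τ (-n) := hs.comp_injective neg_injective
  have h1 : eichler c τ = ∑' n, eichlerTerm c τ (-n) := ((Equiv.neg ℤ).tsum_eq _).symm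
  rw [two_mul]
  nth_rewrite 2 [h1]
  rw [eichler, ← hs.tsum_add hs']
  refine tsum_congr fun n => ?_
  rw [eichlerTerm, eichlerTerm, eichlerTerm,
    show ((-n : ℤ) : ℝ) * √(τ.im / 12) = -(n * √(τ.im / 12)) by push_cast; ring, signErf_neg,
    show ((-n : ℤ) : ℂ) ^ 2 = (n : ℂ) ^ 2 by push_cast; ring]
  push_cast
  ring

/-- This reduces the identification of two Eichler integrals to 24 numerical identities. -/
lemma eichler_congr {c d : ℤ → ℂ} {K L : ℝ} (hc : ∀ n, ‖c n‖ ≤ K) (hd : ∀ n, ‖d n‖ ≤ L)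
    (hcp : Function.Periodic c 24) (hdp : Function.Periodic d 24)
    (h : ∀ r : ℤ, 0 ≤ r → r < 24 → c r - c (-r) = d r - d (-r)) {τ : ℂ} (hτ : 0 < τ.im) :
    eichler c τ = eichler d τ := by
  have key : ∀ n, c n - c (-n) = d n - d (-n) := by
    intro n
    have h1 : ∀ {f : ℤ → ℂ}, Function.Periodic f 24 → f n = f (n % 24) ∧ f (-n) = f (-(n % 24)) := by
      intro f hf
      have hp := hf.int_mul (n / 24) (n % 24)
      have hm := hf.int_mul (-(n / 24)) (-(n % 24))
      rw [← hp, ← hm, Int.cast_id, Int.cast_id]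
      constructor <;> congr 1 <;> omega
    rw [(h1 hcp).1, (h1 hcp).2, (h1 hdp).1, (h1 hdp).2]
    exact h _ (by omega) (by omega)
  have := two_mul_eichler hc hτ
  rw [funext key, ← two_mul_eichler hd hτ] at this
  exact mul_left_cancel₀ two_ne_zero this

/-- The values of `n ↦ e (n / 8)`. -/
def eighthRoot (n : ℤ) : ℂ :=
  if n % 8 = 0 then 1 else if n % 8 = 1 then e (1 / 8) else if n % 8 = 2 then Complex.I else
  if n % 8 = 3 then Complex.I * e (1 / 8) else if n % 8 = 4 then -1 else
  if n % 8 = 5 then -e (1 / 8) else if n % 8 = 6 then -Complex.I else -(Complex.I * e (1 / 8))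

lemma e_int_div_eight (n : ℤ) : e (n / 8) = eighthRoot n := by
  have h0 : e ((n : ℂ) / 8) = e (((n % 8 : ℤ) : ℂ) / 8) := by
    refine e_eq_of_sub_int (n / 8) ?_
    have : (n : ℂ) = ((n % 8 : ℤ) : ℂ) + 8 * ((n / 8 : ℤ) : ℂ) := by
      exact_mod_cast (Int.emod_add_mul_ediv n 8).symm
    rw [this]
    ring
  rw [h0, eighthRoot]
  have h1 : 0 ≤ n % 8 := by omega
  have h2 : n % 8 < 8 := by omega
  generalize n % 8 = r at *
  have hq := e_quarter
  have hh := e_half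
  interval_cases r <;> norm_num
  · exact e_zero
  · rw [← hq]
  · rw [← hq, ← e_add]; norm_num
  · rw [← hh]
  · rw [neg_eq_neg_one_mul, ← hh, ← e_add]; norm_num
  · rw [neg_eq_neg_one_mul, ← hh, ← hq, ← e_add]; norm_num
  · rw [neg_eq_neg_one_mul, ← hh, ← hq, ← e_add, ← e_add]; norm_num

lemma norm_eighthRoot (n : ℤ) : ‖eighthRoot n‖ = 1 := by
  rw [← e_int_div_eight, show (n : ℂ) / 8 = ((n / 8 : ℝ) : ℂ) by push_cast; rfl, norm_e_real]

lemma e_eighth : e (1 / 8) * (√2 : ℝ) = 1 + Complex.I := by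
  have h1 : e (1 / 8) = Complex.exp ((Real.pi / 4 : ℝ) * Complex.I) := by
    rw [e]; congr 1; push_cast; ring
  rw [h1, Complex.exp_mul_I, ← Complex.ofReal_cos, ← Complex.ofReal_sin, Real.cos_pi_div_four,
    Real.sin_pi_div_four]
  have h2 : ((√2 : ℝ) : ℂ) * ((√2 : ℝ) : ℂ) = 2 := by
    rw [← Complex.ofReal_mul, Real.mul_self_sqrt (by norm_num)]; norm_num
  push_cast
  linear_combination ((1 + Complex.I) / 2) * h2

lemma sqrt_two_ne_zero : ((√2 : ℝ) : ℂ) ≠ 0 := by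
  exact_mod_cast (Real.sqrt_pos.mpr (by norm_num)).ne'

lemma sqrt_two_sq : ((√2 : ℝ) : ℂ) ^ 2 = 2 := by
  rw [← Complex.ofReal_pow, Real.sq_sqrt (by norm_num)]; norm_num

lemma chi_add (n k : ℤ) : chi (n + 12 * k) = chi n := by
  simp only [chi, Int.add_mul_emod_self_left]

lemma periodic_shadowCoeff (j : Fin 6) : Function.Periodic (shadowCoeff j) 24 := by
  intro n
  have : ∀ a, residue a (n + 24) = residue a n := fun a => by
    simp only [residue, Int.add_emod_right]
  simp only [shadowCoeff, this]

lemma eighthRoot_add (n k : ℤ) : eighthRoot (n + 8 * k) = eighthRoot n := by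
  simp only [eighthRoot, Int.add_mul_emod_self_left]

lemma offLattice_of_im {τ u : ℂ} (h : ∀ r : ℤ, u.im + r * τ.im ≠ 0) : OffLattice τ u := by
  rw [offLattice_iff]
  intro r s hrs
  apply h r
  have := congrArg Complex.im hrs
  rwa [Complex.add_im, ← Complex.ofReal_intCast, Complex.im_ofReal_mul, Complex.intCast_im] at this

/-! ### Specialisations of the completed Appell–Lerch sum -/

/-- The shadow coefficients at the special point belonging to `φ`. -/
def phiCoeff (n : ℤ) : ℂ := chi n * eighthRoot (-n) / 2

lemma nonhol_quarter (τ : ℂ) : nonhol (τ / 2) (1 / 4) / 2 = eichler phiCoeff τ := by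
  rw [nonhol, eichler, ← tsum_div_const]
  refine tsum_congr fun n => ?_
  have him : (1 / 4 : ℂ).im = 0 := by norm_num
  have him' : (τ / 2).im = τ.im / 2 := by simp
  rw [nonholTerm, eichlerTerm, phiCoeff, ← e_int_div_eight, him, him', zero_div, mul_zero, add_zero,
    show τ.im / 2 / 6 = τ.im / 12 by ring,
    show -(τ / 2 * ((n : ℂ) ^ 2 / 24) + n * (1 / 4 / 2)) =
      ((-n : ℤ) : ℂ) / 8 + -(τ * (n ^ 2 / 48)) by push_cast; ring, e_add]
  ring

lemma eichler_phiCoeff {τ : ℂ} (hτ : 0 < τ.im) : eichler phiCoeff τ =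
    Complex.I / (√2 : ℝ) * eichler (shadowCoeff 0) τ := by
  rw [← eichler_mul_left]
  have h2 := sqrt_two_ne_zero
  refine eichler_congr (K := 1) (L := ‖Complex.I / (√2 : ℝ)‖ * 4) (fun n => ?_) (fun n => ?_)
    (fun n => ?_) (fun n => ?_) (fun r h0 h24 => ?_) hτ
  · rw [phiCoeff, norm_div, norm_mul, norm_eighthRoot, mul_one]
    have := norm_chi_le n
    norm_num
    linarith
  · rw [norm_mul]
    gcongr
    exact norm_shadowCoeff_le 0 n
  · rw [phiCoeff, phiCoeff, show n + 24 = n + 12 * 2 by ring, chi_add,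
      show -(n + 12 * 2) = -n + 8 * (-3) by ring, eighthRoot_add]
  · rw [periodic_shadowCoeff]
  · have he := e_eighth
    have hI := Complex.I_sq
    have key : (1 + Complex.I) * e (1 / 8) * (√2 : ℝ) = 2 * Complex.I := by
      linear_combination (1 + Complex.I) * he + hI
    have key' : (1 + Complex.I) * e (1 / 8) = 2 * (Complex.I / (√2 : ℝ)) := by
      field_simp
      linear_combination key
    rw [one_div] at key'
    generalize Complex.I / ((√2 : ℝ) : ℂ) = w at *
    interval_cases r <;> simp [phiCoeff, shadowCoeff, residue, chi, eighthRoot] <;>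
      first
      | done
      | linear_combination (-1 / 2 : ℂ) * key'
      | linear_combination (1 / 2 : ℂ) * key'

/-- The special point with `z = i` and base `q^{1/2}`. -/
lemma completion_quarter (τ : ℍ) :
    completion (τ / 2) (1 / 4) = Complex.I / (√2 : ℝ) * H3 τ 0 := by
  have hτ : 0 < (τ : ℂ).im := τ.im_pos
  have hτ2 : 0 < ((τ : ℂ) / 2).im := by
    rw [show ((τ : ℂ) / 2).im = (τ : ℂ).im / 2 by simp]; positivity
  have hoff : OffLattice ((τ : ℂ) / 2) (1 / 4) := by
    rw [offLattice_iff]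
    intro r s hrs
    have h1 := congrArg Complex.im hrs
    have hr : r = 0 := by
      simpa [τ.im_pos.ne'] using h1
    subst hr
    have h3 : (1 : ℤ) = 4 * s := by
      have : (1 : ℂ) = 4 * s := by
        rw [← hrs]; push_cast; ring
      exact_mod_cast this
    omega
  rw [completion, nonhol_quarter, eichler_phiCoeff hτ, H3_apply, mul_add]
  congr 1
  have h1 := mockPhi_eq_appell hτ2 hoff
  have hF : F3 τ 0 = e (-τ / 48) * mockPhi (e (τ / 2)) := rfl
  have hP := eulerProd_ne_zero hτ2
  rw [hF, h1, etaFn]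
  have e1 : e (1 / 4 / 2) = e (1 / 8) := by norm_num
  have e2 : e (-τ / 48) = (e ((τ : ℂ) / 2 / 24))⁻¹ := by rw [← e_neg]; congr 1; ring
  have h24 := e_ne_zero ((τ : ℂ) / 2 / 24)
  have h2 := sqrt_two_ne_zero
  rw [e1, e2]
  have h3 : e (1 / 8) = Complex.I / (√2 : ℝ) * (1 - Complex.I) := by
    field_simp
    linear_combination e_eighth + Complex.I_sq
  rw [h3]
  field_simp

/-- The shadow coefficients at the special points belonging to `ψ`. -/
def psiCoeff (s N : ℤ) : ℂ :=
  if N % 2 = 1 then chi ((N - 3) / 2) * eighthRoot (-(2 * s * ((N - 3) / 2))) / 2 else 0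

lemma norm_psiCoeff_le (s N : ℤ) : ‖psiCoeff s N‖ ≤ 1 := by
  rw [psiCoeff]
  split_ifs
  · rw [norm_div, norm_mul, norm_eighthRoot, mul_one]
    have := norm_chi_le ((N - 3) / 2)
    norm_num
    linarith
  · simp

lemma periodic_psiCoeff (s : ℤ) : Function.Periodic (psiCoeff s) 24 := by
  intro n
  have h1 : (n + 24) % 2 = n % 2 := by omega
  have h2 : (n + 24 - 3) / 2 = (n - 3) / 2 + 12 * 1 := by omega
  rw [psiCoeff, psiCoeff, h1, h2, chi_add,
    show -(2 * s * ((n - 3) / 2 + 12 * 1)) = -(2 * s * ((n - 3) / 2)) + 8 * (-3 * s) by ring,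
    eighthRoot_add]

/-- The factor `e (-3τ/16)` completes the square, and the error function acquires the argument
belonging to the index `N = 2n + 3`. Where `chi n ≠ 0` the signs of `n` and `N` differ only at `n =
-1`; that extra term cancels the `1` of `1 + ψ` in `completion_psi`. -/
lemma nonholTerm_psi {τ : ℂ} (hτ : 0 < τ.im) (s n : ℤ) :
    e (-(3 * τ / 16)) * nonholTerm (2 * τ) (s / 2 + τ / 2) n / 2 =
      eichlerTerm (psiCoeff s) τ (2 * n + 3) +
        if n = -1 then -(e (s / 4) * e (-τ / 48)) else 0 := by
  have him : ((s : ℂ) / 2 + τ / 2).im = τ.im / 2 := by simp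
  have him' : (2 * τ).im = 2 * τ.im := by simp
  have hsq : √(2 * τ.im / 6) = 2 * √(τ.im / 12) := by
    rw [show 2 * τ.im / 6 = 2 ^ 2 * (τ.im / 12) by ring, Real.sqrt_mul (by norm_num),
      Real.sqrt_sq (by norm_num)]
  have harg : ((n : ℝ) + 6 * (τ.im / 2 / (2 * τ.im))) * √(2 * τ.im / 6) =
      ((2 * n + 3 : ℤ) : ℝ) * √(τ.im / 12) := by
    rw [hsq]; push_cast; field_simp; ring
  have hN : (2 * n + 3 : ℤ) % 2 = 1 := by omega
  have hN' : (2 * n + 3 - 3 : ℤ) / 2 = n := by omega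
  have hexp : e (-(2 * τ * ((n : ℂ) ^ 2 / 24) + n * (((s : ℂ) / 2 + τ / 2) / 2))) *
      e (-(3 * τ / 16)) =
      e (((-(2 * s * n) : ℤ) : ℂ) / 8) * e (-(τ * (((2 * n + 3 : ℤ) : ℂ) ^ 2 / 48))) := by
    rw [← e_add, ← e_add]; congr 1; push_cast; ring
  rw [nonholTerm, eichlerTerm, psiCoeff, if_pos hN, hN', ← e_int_div_eight, him, him', harg]
  have hsign : signErf n (((2 * n + 3 : ℤ) : ℝ) * √(τ.im / 12)) =
      signErf (2 * n + 3) (((2 * n + 3 : ℤ) : ℝ) * √(τ.im / 12)) +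
        (n.sign - (2 * n + 3).sign : ℤ) := by
    rw [signErf, signErf]; push_cast; ring
  rw [hsign]
  split_ifs with h
  · subst h
    have hc : chi (-1) = 1 := by simp [chi]
    have hs : ((-1 : ℤ).sign - (2 * (-1) + 3 : ℤ).sign : ℤ) = -2 := rfl
    have he : e (((-(2 * s * -1) : ℤ) : ℂ) / 8) * e (-(τ * (((2 * -1 + 3 : ℤ) : ℂ) ^ 2 / 48))) =
        e (s / 4) * e (-τ / 48) := by
      rw [← e_add, ← e_add]; congr 1; push_cast; ring
    rw [hc, hs]
    rw [he] at hexp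
    rw [Complex.ofReal_add, Complex.ofReal_intCast, show ((-2 : ℤ) : ℂ) = -2 by norm_num]
    generalize signErf (2 * -1 + 3) _ = X
    linear_combination (1 / 2 : ℂ) * (X - 2) * hexp - (1 / 2 : ℂ) * X * he
  · have hs : chi n * ((n.sign - (2 * n + 3).sign : ℤ) : ℂ) = 0 := by
      rcases lt_trichotomy n 0 with h' | rfl | h'
      · rw [Int.sign_eq_neg_one_of_neg h', Int.sign_eq_neg_one_of_neg (show 2 * n + 3 < 0 by omega)]
        simp
      · rw [chi_zero, zero_mul]
      · rw [Int.sign_eq_one_of_pos h', Int.sign_eq_one_of_pos (show 0 < 2 * n + 3 by omega)]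
        simp
    rw [Complex.ofReal_add, Complex.ofReal_intCast]
    linear_combination (1 / 2 * chi n * ((signErf (2 * n + 3) (((2 * n + 3 : ℤ) : ℝ) *
      √(τ.im / 12)) : ℝ) : ℂ)) * hexp + (1 / 2 * e (-(2 * τ * ((n : ℂ) ^ 2 / 24) + n *
      (((s : ℂ) / 2 + τ / 2) / 2))) * e (-(3 * τ / 16))) * hs

lemma nonhol_psi {τ : ℂ} (hτ : 0 < τ.im) (s : ℤ) :
    e (-(3 * τ / 16)) * nonhol (2 * τ) (s / 2 + τ / 2) / 2 =
      eichler (psiCoeff s) τ - e (s / 4) * e (-τ / 48) := by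
  have hinj : Function.Injective fun n : ℤ => 2 * n + 3 := fun a b h => by simpa using h
  have hsum : Summable fun n : ℤ => eichlerTerm (psiCoeff s) τ (2 * n + 3) :=
    (summable_eichlerTerm (norm_psiCoeff_le s) hτ).comp_injective hinj
  rw [nonhol, ← tsum_mul_left, ← tsum_div_const, tsum_congr (nonholTerm_psi hτ s),
    hsum.tsum_add (summable_of_ne_finset_zero (s := {-1}) fun n hn =>
      if_neg (by simpa using hn)), tsum_ite_eq, ← sub_eq_add_neg, eichler]
  congr 1
  refine hinj.tsum_eq (f := eichlerTerm (psiCoeff s) τ) fun N hN => ?_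
  by_contra h
  apply hN
  have : ¬ N % 2 = 1 := fun h' => h ⟨(N - 3) / 2, by simp only; omega⟩
  rw [eichlerTerm, psiCoeff, if_neg this, zero_mul, zero_mul]

lemma offLattice_psi {τ : ℂ} (hτ : 0 < τ.im) (s : ℤ) : OffLattice (2 * τ) (s / 2 + τ / 2) := by
  refine offLattice_of_im fun r h => ?_
  have him : ((s : ℂ) / 2 + τ / 2).im = τ.im / 2 := by simp
  have him' : (2 * τ).im = 2 * τ.im := by simp
  rw [him, him'] at h
  have h1 : (1 + 4 * (r : ℝ)) * τ.im = 0 := by linear_combination 2 * h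
  rcases mul_eq_zero.mp h1 with h2 | h2
  · have : (1 + 4 * r : ℤ) = 0 := by exact_mod_cast h2
    omega
  · exact hτ.ne' h2

/-- The shift by `s / 2` does not affect `z⁴ = e (2τ)`: `s = 0` gives `ψ(q^{1/2})` and `s = 1` gives
`ψ(-q^{1/2})`. -/
lemma completion_psi {τ : ℂ} (hτ : 0 < τ.im) (s : ℤ) :
    e (-(3 * τ / 16)) * completion (2 * τ) (s / 2 + τ / 2) =
      e (s / 4) * e (-τ / 48) * mockPsi (e (s / 2 + τ / 2)) + eichler (psiCoeff s) τ := by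
  have hτ2 : 0 < (2 * τ).im := by rw [show (2 * τ).im = 2 * τ.im by simp]; positivity
  have h4 : e ((s : ℂ) / 2 + τ / 2) ^ 4 = e (2 * τ) := by
    rw [e_pow]
    exact e_eq_of_sub_int (2 * s) (by push_cast; ring)
  have h1 := one_add_mockPsi_eq_appell hτ2 h4 (offLattice_psi hτ s)
  have h2 := nonhol_psi hτ s
  have h3 : e (-(3 * τ / 16)) * (e (((s : ℂ) / 2 + τ / 2) / 2) * appell (2 * τ) (s / 2 + τ / 2) /
      etaFn (2 * τ)) = e (s / 4) * e (-τ / 48) *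
      (appell (2 * τ) (s / 2 + τ / 2) / eulerProd (2 * τ)) := by
    have : e (-(3 * τ / 16)) * e (((s : ℂ) / 2 + τ / 2) / 2) =
        e (s / 4) * e (-τ / 48) * e (2 * τ / 24) := by
      rw [← e_add, ← e_add, ← e_add]; congr 1; ring
    have h24 := e_ne_zero (2 * τ / 24)
    have hP := eulerProd_ne_zero hτ2
    rw [etaFn, ← mul_div_assoc, ← mul_assoc, this]
    generalize e (2 * τ / 24) = A at *
    generalize eulerProd (2 * τ) = P at *
    generalize appell (2 * τ) (s / 2 + τ / 2) = B
    field_simp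
  rw [completion, mul_add, h3, ← h1]
  linear_combination h2

lemma eichler_psiCoeff_zero {τ : ℂ} (hτ : 0 < τ.im) : eichler (psiCoeff 0) τ =
    1 / 2 * eichler (shadowCoeff 2) τ := by
  rw [← eichler_mul_left]
  refine eichler_congr (L := ‖(1 / 2 : ℂ)‖ * 4) (norm_psiCoeff_le 0) (fun n => ?_)
    (periodic_psiCoeff 0) (fun n => ?_) (fun r h0 h24 => ?_) hτ
  · rw [norm_mul]
    gcongr
    exact norm_shadowCoeff_le 2 n
  · rw [periodic_shadowCoeff]
  · interval_cases r <;> simp [psiCoeff, shadowCoeff, residue, chi, eighthRoot] <;> norm_num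

lemma eichler_psiCoeff_one {τ : ℂ} (hτ : 0 < τ.im) : eichler (psiCoeff 1) τ =
    Complex.I / 2 * eichler (shadowCoeff 3) τ := by
  rw [← eichler_mul_left]
  refine eichler_congr (L := ‖(Complex.I / 2 : ℂ)‖ * 4) (norm_psiCoeff_le 1) (fun n => ?_)
    (periodic_psiCoeff 1) (fun n => ?_) (fun r h0 h24 => ?_) hτ
  · rw [norm_mul]
    gcongr
    exact norm_shadowCoeff_le 3 n
  · rw [periodic_shadowCoeff]
  · interval_cases r <;> simp [psiCoeff, shadowCoeff, residue, chi, eighthRoot] <;> ring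

lemma completion_psi_zero (τ : ℍ) :
    e (-(3 * τ / 16)) * completion (2 * τ) (τ / 2) = 1 / 2 * H3 τ 2 := by
  have hτ : 0 < (τ : ℂ).im := τ.im_pos
  have h := completion_psi hτ 0
  have hF : F3 τ 2 = 2 * e (-τ / 48) * mockPsi (e (τ / 2)) := rfl
  simp only [Int.cast_zero, zero_div, zero_add, e_zero, one_mul] at h
  rw [h, eichler_psiCoeff_zero hτ, H3_apply, hF]
  ring

lemma completion_psi_one (τ : ℍ) :
    e (-(3 * τ / 16)) * completion (2 * τ) (1 / 2 + τ / 2) = Complex.I / 2 * H3 τ 3 := by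
  have hτ : 0 < (τ : ℂ).im := τ.im_pos
  have h := completion_psi hτ 1
  have hF : F3 τ 3 = 2 * e (-τ / 48) * mockPsi (-e (τ / 2)) := rfl
  rw [Int.cast_one, e_quarter, e_add, e_half, neg_one_mul] at h
  rw [h, eichler_psiCoeff_one hτ, H3_apply, hF]
  ring

/-- The shadow coefficients at the special point belonging to `ν`. -/
def nuCoeff (N : ℤ) : ℂ := chi (N - 3) * eighthRoot (N - 3) / 2

lemma norm_nuCoeff_le (N : ℤ) : ‖nuCoeff N‖ ≤ 1 := by
  rw [nuCoeff, norm_div, norm_mul, norm_eighthRoot, mul_one]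
  have := norm_chi_le (N - 3)
  norm_num
  linarith

lemma periodic_nuCoeff : Function.Periodic nuCoeff 24 := by
  intro n
  rw [nuCoeff, nuCoeff, show n + 24 - 3 = n - 3 + 12 * 2 by ring, chi_add,
    show n - 3 + 12 * 2 = n - 3 + 8 * 3 by ring, eighthRoot_add]

/-- As in `nonholTerm_psi`, now with `N = n + 3`. The signs of `n` and `N` also differ at `-3`, `-2`
and `0`, but the character vanishes there. -/
lemma nonholTerm_nu {τ : ℂ} (hτ : 0 < τ.im) (n : ℤ) :
    e (-(3 * τ / 16)) * nonholTerm (τ / 2) (-1 / 4 + τ / 4) n / 2 =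
      eichlerTerm nuCoeff τ (n + 3) +
        if n = -1 then -(e (-1 / 8) * e (-(τ / 12))) else 0 := by
  have him : (-1 / 4 + τ / 4).im = τ.im / 4 := by
    rw [show (-1 / 4 + τ / 4) = ((-1 / 4 : ℝ) : ℂ) + τ / 4 by push_cast; ring]
    simp
  have him' : (τ / 2).im = τ.im / 2 := by simp
  have harg : ((n : ℝ) + 6 * (τ.im / 4 / (τ.im / 2))) * √(τ.im / 2 / 6) =
      ((n + 3 : ℤ) : ℝ) * √(τ.im / 12) := by
    rw [show τ.im / 2 / 6 = τ.im / 12 by ring]; push_cast; field_simp; ring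
  have hexp : e (-(τ / 2 * ((n : ℂ) ^ 2 / 24) + n * ((-1 / 4 + τ / 4) / 2))) *
      e (-(3 * τ / 16)) =
      e ((n : ℂ) / 8) * e (-(τ * (((n + 3 : ℤ) : ℂ) ^ 2 / 48))) := by
    rw [← e_add, ← e_add]; congr 1; push_cast; ring
  rw [nonholTerm, eichlerTerm, nuCoeff, show n + 3 - 3 = n by ring, ← e_int_div_eight, him, him',
    harg]
  have hsign : signErf n (((n + 3 : ℤ) : ℝ) * √(τ.im / 12)) =
      signErf (n + 3) (((n + 3 : ℤ) : ℝ) * √(τ.im / 12)) + (n.sign - (n + 3).sign : ℤ) := by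
    rw [signErf, signErf]; push_cast; ring
  rw [hsign]
  split_ifs with h
  · subst h
    have hc : chi (-1) = 1 := by simp [chi]
    have hs : ((-1 : ℤ).sign - (-1 + 3 : ℤ).sign : ℤ) = -2 := rfl
    have he : e (((-1 : ℤ) : ℂ) / 8) * e (-(τ * (((-1 + 3 : ℤ) : ℂ) ^ 2 / 48))) =
        e (-1 / 8) * e (-(τ / 12)) := by
      rw [← e_add, ← e_add]; congr 1; push_cast; ring
    rw [hc, hs]
    rw [he] at hexp
    rw [Complex.ofReal_add, Complex.ofReal_intCast, show ((-2 : ℤ) : ℂ) = -2 by norm_num]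
    generalize signErf (-1 + 3) _ = X
    linear_combination (1 / 2 : ℂ) * (X - 2) * hexp - (1 / 2 : ℂ) * X * he
  · have hs : chi n * ((n.sign - (n + 3).sign : ℤ) : ℂ) = 0 := by
      rcases lt_trichotomy n 0 with h' | rfl | h'
      · rcases lt_or_ge (-4) n with h'' | h''
        · have : n = -2 ∨ n = -3 := by omega
          rcases this with rfl | rfl <;> simp [chi]
        · rw [Int.sign_eq_neg_one_of_neg h', Int.sign_eq_neg_one_of_neg (show n + 3 < 0 by omega)]
          simp
      · rw [chi_zero, zero_mul]
      · rw [Int.sign_eq_one_of_pos h', Int.sign_eq_one_of_pos (show 0 < n + 3 by omega)]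
        simp
    rw [Complex.ofReal_add, Complex.ofReal_intCast]
    linear_combination (1 / 2 * chi n * ((signErf (n + 3) (((n + 3 : ℤ) : ℝ) *
      √(τ.im / 12)) : ℝ) : ℂ)) * hexp + (1 / 2 * e (-(τ / 2 * ((n : ℂ) ^ 2 / 24) + n *
      ((-1 / 4 + τ / 4) / 2))) * e (-(3 * τ / 16))) * hs

lemma nonhol_nu {τ : ℂ} (hτ : 0 < τ.im) :
    e (-(3 * τ / 16)) * nonhol (τ / 2) (-1 / 4 + τ / 4) / 2 =
      eichler nuCoeff τ - e (-1 / 8) * e (-(τ / 12)) := by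
  have hsum : Summable fun n : ℤ => eichlerTerm nuCoeff τ (n + 3) :=
    (summable_eichlerTerm norm_nuCoeff_le hτ).comp_injective (add_left_injective 3)
  rw [nonhol, ← tsum_mul_left, ← tsum_div_const, tsum_congr (nonholTerm_nu hτ),
    hsum.tsum_add
      (summable_of_ne_finset_zero (s := {-1}) fun n hn =>
      if_neg (by simpa using hn)), tsum_ite_eq, ← sub_eq_add_neg, eichler]
  congr 1
  exact (Equiv.addRight (3 : ℤ)).tsum_eq (eichlerTerm nuCoeff τ)

lemma offLattice_nu {τ : ℂ} (hτ : 0 < τ.im) : OffLattice (τ / 2) (-1 / 4 + τ / 4) := by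
  refine offLattice_of_im fun r h => ?_
  have him : (-1 / 4 + τ / 4).im = τ.im / 4 := by
    rw [show (-1 / 4 + τ / 4) = ((-1 / 4 : ℝ) : ℂ) + τ / 4 by push_cast; ring]
    simp
  have him' : (τ / 2).im = τ.im / 2 := by simp
  rw [him, him'] at h
  have h1 : (1 + 2 * (r : ℝ)) * τ.im = 0 := by linear_combination 4 * h
  rcases mul_eq_zero.mp h1 with h2 | h2
  · have : (1 + 2 * r : ℤ) = 0 := by exact_mod_cast h2
    omega
  · exact hτ.ne' h2

lemma eichler_nuCoeff {τ : ℂ} (hτ : 0 < τ.im) : eichler nuCoeff τ =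
    e (-3 / 8) / (√2 : ℝ) * eichler (shadowCoeff 4) τ := by
  rw [← eichler_mul_left]
  have h2 := sqrt_two_ne_zero
  refine eichler_congr (L := ‖e (-3 / 8) / (√2 : ℝ)‖ * 4) norm_nuCoeff_le (fun n => ?_)
    periodic_nuCoeff (fun n => ?_) (fun r h0 h24 => ?_) hτ
  · rw [norm_mul]
    gcongr
    exact norm_shadowCoeff_le 4 n
  · rw [periodic_shadowCoeff]
  · have h3 : e (-3 / 8) = eighthRoot (-3) := by rw [← e_int_div_eight]; norm_num
    rw [h3]
    interval_cases r <;> simp [nuCoeff, shadowCoeff, residue, chi, eighthRoot] <;>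
      field_simp <;> ring

lemma completion_nu (τ : ℍ) : e (-(3 * τ / 16)) * completion (τ / 2) (-1 / 4 + τ / 4) =
    e (-3 / 8) / (√2 : ℝ) * H3 τ 4 := by
  have hτ : 0 < (τ : ℂ).im := τ.im_pos
  have hτ2 : 0 < ((τ : ℂ) / 2).im := by
    rw [show ((τ : ℂ) / 2).im = (τ : ℂ).im / 2 by simp]; positivity
  have h2 : e (-1 / 4 + (τ : ℂ) / 4) ^ 2 = -e (τ / 2) := by
    rw [e_pow, show -e ((τ : ℂ) / 2) = e (1 / 2) * e (τ / 2) by rw [e_half]; ring, ← e_add]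
    exact e_eq_of_sub_int (-1) (by push_cast; ring)
  have h1 := one_add_mockNu_eq_appell hτ2 h2 (offLattice_nu hτ)
  have hn := nonhol_nu hτ
  rw [eichler_nuCoeff hτ] at hn
  have h3 : e (-(3 * τ / 16)) * (e ((-1 / 4 + (τ : ℂ) / 4) / 2) *
      appell (τ / 2) (-1 / 4 + τ / 4) / etaFn (τ / 2)) = e (-1 / 8) * e (-(τ / 12)) *
      (appell (τ / 2) (-1 / 4 + τ / 4) / eulerProd (τ / 2)) := by
    have : e (-(3 * τ / 16)) * e ((-1 / 4 + (τ : ℂ) / 4) / 2) =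
        e (-1 / 8) * e (-(τ / 12)) * e ((τ : ℂ) / 2 / 24) := by
      rw [← e_add, ← e_add, ← e_add]; congr 1; ring
    have h24 := e_ne_zero ((τ : ℂ) / 2 / 24)
    have hP := eulerProd_ne_zero hτ2
    rw [etaFn, ← mul_div_assoc, ← mul_assoc, this]
    generalize e ((τ : ℂ) / 2 / 24) = A at *
    generalize eulerProd ((τ : ℂ) / 2) = P at *
    generalize appell ((τ : ℂ) / 2) (-1 / 4 + τ / 4) = B
    field_simp
  have hF : F3 τ 4 = (√2 : ℝ) * e (τ / 6) * mockNu (e (τ / 2)) := rfl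
  have h4 : e (-1 / 8) * e (-((τ : ℂ) / 12)) * e (-1 / 4 + (τ : ℂ) / 4) =
      e (-3 / 8) * e (τ / 6) := by
    rw [← e_add, ← e_add, ← e_add]; congr 1; ring
  have h5 : e (-3 / 8) / (√2 : ℝ) * ((√2 : ℝ) * e (τ / 6) * mockNu (e (τ / 2))) =
      e (-3 / 8) * e (τ / 6) * mockNu (e (τ / 2)) := by
    have := sqrt_two_ne_zero
    field_simp
  rw [completion, mul_add, h3, ← h1, H3_apply, hF, mul_add (e (-3 / 8) / _), h5, ← h4]
  linear_combination hn

/-! ### The transformation laws of `H3` -/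

lemma coe_T_smul (τ : ℍ) : ((ModularGroup.T • τ : ℍ) : ℂ) = τ + 1 := by
  rw [UpperHalfPlane.modular_T_smul, UpperHalfPlane.coe_vadd]
  push_cast
  ring

lemma coe_S_smul (τ : ℍ) : ((ModularGroup.S • τ : ℍ) : ℂ) = -1 / τ := by
  rw [UpperHalfPlane.modular_S_smul, UpperHalfPlane.coe_mk, inv_neg, neg_div, one_div]

/-- The class of `n²` modulo 48 depends only on `n` modulo 24. -/
lemma residue_mul_e (a n : ℤ) :
    residue a n * e (-((n : ℂ) ^ 2 / 48)) = e (-((a : ℂ) ^ 2 / 48)) * residue a n := by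
  rw [residue]
  split_ifs with h
  · rw [one_mul, mul_one]
    obtain ⟨k, rfl⟩ : ∃ k, n = 24 * k + a := ⟨n / 24, by omega⟩
    refine e_eq_of_sub_int (-(12 * k ^ 2 + k * a)) ?_
    push_cast
    ring
  · simp

lemma eichler_add_one {c d : ℤ → ℂ} {a : ℂ}
    (h : ∀ n : ℤ, c n * e (-((n : ℂ) ^ 2 / 48)) = a * d n) (τ : ℂ) :
    eichler c (τ + 1) = a * eichler d τ := by
  rw [eichler, eichler, ← tsum_mul_left]
  refine tsum_congr fun n => ?_
  have him : (τ + 1).im = τ.im := by simp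
  rw [eichlerTerm, eichlerTerm, him, show -((τ + 1) * ((n : ℂ) ^ 2 / 48)) =
    -((n : ℂ) ^ 2 / 48) + -(τ * (n ^ 2 / 48)) by ring, e_add]
  linear_combination (((signErf n (n * √(τ.im / 12)) : ℝ) : ℂ) * e (-(τ * (n ^ 2 / 48)))) * h n

/-- The nonzero entries of `T3`. -/
def tMult (j : Fin 6) : ℂ := if j.val < 4 then e (-1 / 48) else e (1 / 6)

/-- The permutation underlying `T3`. -/
def tPerm : Fin 6 → Fin 6 := ![1, 0, 3, 2, 5, 4]

/-- The permutation underlying `S3`. -/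
def sPerm : Fin 6 → Fin 6 := ![2, 5, 0, 4, 3, 1]

lemma T3_mulVec (x : Fin 6 → ℂ) : T3 *ᵥ x = fun j => tMult j * x (tPerm j) := by
  funext j
  fin_cases j <;> simp [T3, Matrix.mulVec, dotProduct, Fin.sum_univ_six, tMult, tPerm]

lemma S3_mulVec (x : Fin 6 → ℂ) : S3 *ᵥ x = fun j => x (sPerm j) := by
  funext j
  fin_cases j <;> simp [S3, Matrix.mulVec, dotProduct, Fin.sum_univ_six, sPerm]

/-- Modulo 48 the squares of 1, 7 are 1, those of 5, 11 are 25, and those of 4, 8 are 16. The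
difference of 24 between the first two is a sign, which exchanges `s₊` and `s₋`. -/
lemma shadowCoeff_mul_e (j : Fin 6) (n : ℤ) :
    shadowCoeff j n * e (-((n : ℂ) ^ 2 / 48)) = tMult j * shadowCoeff (tPerm j) n := by
  have h1 := residue_mul_e 1 n
  have h5 := residue_mul_e 5 n
  have h7 := residue_mul_e 7 n
  have h11 := residue_mul_e 11 n
  have h4 := residue_mul_e 4 n
  have h8 := residue_mul_e 8 n
  have e1 : e (-(((1 : ℤ) : ℂ) ^ 2 / 48)) = e (-1 / 48) := by congr 1; push_cast; ring
  have e5 : e (-(((5 : ℤ) : ℂ) ^ 2 / 48)) = -e (-1 / 48) := by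
    rw [show -e (-1 / 48) = e (1 / 2) * e (-1 / 48) by rw [e_half]; ring, ← e_add]
    exact e_eq_of_sub_int (-1) (by push_cast; ring)
  have e7 : e (-(((7 : ℤ) : ℂ) ^ 2 / 48)) = e (-1 / 48) :=
    e_eq_of_sub_int (-1) (by push_cast; ring)
  have e11 : e (-(((11 : ℤ) : ℂ) ^ 2 / 48)) = -e (-1 / 48) := by
    rw [show -e (-1 / 48) = e (1 / 2) * e (-1 / 48) by rw [e_half]; ring, ← e_add]
    exact e_eq_of_sub_int (-3) (by push_cast; ring)
  have e4 : e (-(((4 : ℤ) : ℂ) ^ 2 / 48)) = -e (1 / 6) := by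
    rw [← neg_one_mul (e _), ← e_half, ← e_add]
    exact e_eq_of_sub_int (-1) (by push_cast; ring)
  have e8 : e (-(((8 : ℤ) : ℂ) ^ 2 / 48)) = -e (1 / 6) := by
    rw [← neg_one_mul (e _), ← e_half, ← e_add]
    exact e_eq_of_sub_int (-2) (by push_cast; ring)
  rw [e1] at h1
  rw [e5] at h5
  rw [e7] at h7
  rw [e11] at h11
  rw [e4] at h4
  rw [e8] at h8
  fin_cases j
  · change -(residue 1 n + residue 5 n + residue 7 n + residue 11 n) * _ =
      e (-1 / 48) * -(residue 1 n - residue 5 n + residue 7 n - residue 11 n)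
    linear_combination -h1 - h5 - h7 - h11
  · change -(residue 1 n - residue 5 n + residue 7 n - residue 11 n) * _ =
      e (-1 / 48) * -(residue 1 n + residue 5 n + residue 7 n + residue 11 n)
    linear_combination -h1 + h5 - h7 + h11
  · change (residue 1 n + residue 5 n + residue 7 n + residue 11 n) * _ =
      e (-1 / 48) * (residue 1 n - residue 5 n + residue 7 n - residue 11 n)
    linear_combination h1 + h5 + h7 + h11
  · change (residue 1 n - residue 5 n + residue 7 n - residue 11 n) * _ =
      e (-1 / 48) * (residue 1 n + residue 5 n + residue 7 n + residue 11 n)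
    linear_combination h1 - h5 + h7 - h11
  · change -((√2 : ℝ) * (residue 4 n + residue 8 n)) * _ =
      e (1 / 6) * ((√2 : ℝ) * (residue 4 n + residue 8 n))
    linear_combination (-(√2 : ℝ) : ℂ) * (h4 + h8)
  · change (√2 : ℝ) * (residue 4 n + residue 8 n) * _ =
      e (1 / 6) * -((√2 : ℝ) * (residue 4 n + residue 8 n))
    linear_combination ((√2 : ℝ) : ℂ) * (h4 + h8)

lemma F3_T (τ : ℍ) (j : Fin 6) : F3 (ModularGroup.T • τ) j = tMult j * F3 τ (tPerm j) := by
  have hq : e ((((ModularGroup.T • τ : ℍ) : ℂ)) / 2) = -e (τ / 2) := by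
    rw [coe_T_smul, add_div, e_add, e_half]; ring
  have h48 : e (-((ModularGroup.T • τ : ℍ) : ℂ) / 48) = e (-1 / 48) * e (-τ / 48) := by
    rw [coe_T_smul, ← e_add]; congr 1; ring
  have h6 : e (((ModularGroup.T • τ : ℍ) : ℂ) / 6) = e (1 / 6) * e (τ / 6) := by
    rw [coe_T_smul, ← e_add]; congr 1; ring
  rw [F3, hq, h48, h6, neg_neg]
  fin_cases j
  · change e (-1 / 48) * e (-τ / 48) * mockPhi (-e (τ / 2)) =
      e (-1 / 48) * (e (-τ / 48) * mockPhi (-e (τ / 2)))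
    ring
  · change e (-1 / 48) * e (-τ / 48) * mockPhi (e (τ / 2)) =
      e (-1 / 48) * (e (-τ / 48) * mockPhi (e (τ / 2)))
    ring
  · change 2 * (e (-1 / 48) * e (-τ / 48)) * mockPsi (-e (τ / 2)) =
      e (-1 / 48) * (2 * e (-τ / 48) * mockPsi (-e (τ / 2)))
    ring
  · change 2 * (e (-1 / 48) * e (-τ / 48)) * mockPsi (e (τ / 2)) =
      e (-1 / 48) * (2 * e (-τ / 48) * mockPsi (e (τ / 2)))
    ring
  · change (√2 : ℝ) * (e (1 / 6) * e (τ / 6)) * mockNu (-e (τ / 2)) =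
      e (1 / 6) * ((√2 : ℝ) * e (τ / 6) * mockNu (-e (τ / 2)))
    ring
  · change (√2 : ℝ) * (e (1 / 6) * e (τ / 6)) * mockNu (e (τ / 2)) =
      e (1 / 6) * ((√2 : ℝ) * e (τ / 6) * mockNu (e (τ / 2)))
    ring

lemma H3_T_apply (τ : ℍ) (j : Fin 6) : H3 (ModularGroup.T • τ) j = tMult j * H3 τ (tPerm j) := by
  rw [H3_apply, H3_apply, F3_T, coe_T_smul, eichler_add_one (shadowCoeff_mul_e j), mul_add]

lemma H3_T (τ : ℍ) : H3 (ModularGroup.T • τ) = T3 *ᵥ H3 τ := by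
  rw [T3_mulVec]
  exact funext (H3_T_apply τ)

lemma csqrt_two_mul (τ : ℍ) :
    csqrt (-Complex.I * (2 * τ)) = (√2 : ℝ) * csqrt (-Complex.I * τ) := by
  rw [← csqrt_real_mul two_pos (neg_I_mul_mem_slitPlane τ.im_pos)]
  congr 1
  push_cast
  ring

/-- Inversion sends the point `(2τ, τ/2)` of `ψ` to `(-1/(2τ), 1/4)`, the point of `φ` at `-1/τ`. -/
lemma H3_S_zero (τ : ℍ) :
    H3 (ModularGroup.S • τ) 0 = csqrt (-Complex.I * τ) * H3 τ 2 := by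
  have hτ : 0 < (τ : ℂ).im := τ.im_pos
  have hτ0 : (τ : ℂ) ≠ 0 := τ.ne_zero
  have hτ2 : 0 < (2 * (τ : ℂ)).im := by
    rw [show (2 * (τ : ℂ)).im = 2 * (τ : ℂ).im by simp]; positivity
  have hoff := offLattice_psi hτ 0
  simp only [Int.cast_zero, zero_div, zero_add] at hoff
  have h1 := completion_S hτ2 hoff
  have h2 := completion_quarter (ModularGroup.S • τ)
  have h3 := completion_psi_zero τ
  rw [coe_S_smul] at h2
  rw [show -1 / (2 * (τ : ℂ)) = -1 / τ / 2 by field_simp,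
    show (τ : ℂ) / 2 / (2 * τ) = 1 / 4 by field_simp; norm_num,
    show 3 * ((τ : ℂ) / 2) ^ 2 / (2 * (2 * τ)) = 3 * τ / 16 by field_simp; norm_num,
    h2, csqrt_two_mul] at h1
  rw [e_neg] at h3
  have he := e_ne_zero (3 * (τ : ℂ) / 16)
  have hs := sqrt_two_ne_zero
  have hs2 := sqrt_two_sq
  have hI := Complex.I_ne_zero
  generalize e (3 * (τ : ℂ) / 16) = E at *
  generalize completion (2 * (τ : ℂ)) (τ / 2) = X at *
  generalize H3 (ModularGroup.S • τ) 0 = A at *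
  generalize H3 τ 2 = B at *
  generalize csqrt (-Complex.I * τ) = c at *
  generalize ((√2 : ℝ) : ℂ) = s at *
  have hX : X = E * (1 / 2 * B) := by rw [← h3]; field_simp
  rw [hX] at h1
  have h4 : (Complex.I * E / s) * A = (Complex.I * E / s) * (s ^ 2 / 2 * (c * B)) := by
    field_simp at h1 ⊢
    linear_combination h1
  rw [hs2, div_self two_ne_zero, one_mul] at h4
  exact mul_left_cancel₀ (by positivity) h4

/-- Inversion sends the point `(2τ, 1/2 + τ/2)` to the negative of the point of `ν` at `-1/τ`; hence
the use of oddness. -/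
lemma H3_S_four (τ : ℍ) :
    H3 (ModularGroup.S • τ) 4 = csqrt (-Complex.I * τ) * H3 τ 3 := by
  have hτ : 0 < (τ : ℂ).im := τ.im_pos
  have hτ0 : (τ : ℂ) ≠ 0 := τ.ne_zero
  have hτ2 : 0 < (2 * (τ : ℂ)).im := by
    rw [show (2 * (τ : ℂ)).im = 2 * (τ : ℂ).im by simp]; positivity
  have hoff := offLattice_psi hτ 1
  rw [Int.cast_one] at hoff
  have h1 := completion_S hτ2 hoff
  have h2 := completion_nu (ModularGroup.S • τ)
  have h3 := completion_psi_one τ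
  rw [coe_S_smul] at h2
  rw [show -1 / (2 * (τ : ℂ)) = -1 / τ / 2 by field_simp,
    show (1 / 2 + (τ : ℂ) / 2) / (2 * τ) = -(-1 / 4 + -1 / τ / 4) by field_simp; ring,
    completion_neg, csqrt_two_mul] at h1
  have he1 : e (3 * (1 / 2 + (τ : ℂ) / 2) ^ 2 / (2 * (2 * τ))) =
      e (3 * τ / 16) * (e (-(3 * (-1 / τ) / 16)) / e (-3 / 8)) := by
    rw [← e_sub, ← e_add]; congr 1; field_simp; ring
  rw [he1] at h1
  rw [e_neg (3 * (τ : ℂ) / 16)] at h3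
  have he := e_ne_zero (3 * (τ : ℂ) / 16)
  have hs := sqrt_two_ne_zero
  have hs2 := sqrt_two_sq
  have hI := Complex.I_ne_zero
  have hI2 := Complex.I_sq
  have he3 := e_ne_zero (-3 / 8)
  generalize e (3 * (τ : ℂ) / 16) = E at *
  generalize completion (2 * (τ : ℂ)) (1 / 2 + τ / 2) = X at *
  generalize completion (-1 / (τ : ℂ) / 2) (-1 / 4 + -1 / τ / 4) = Y at *
  generalize e (-(3 * (-1 / (τ : ℂ)) / 16)) = E' at *
  generalize H3 (ModularGroup.S • τ) 4 = A at *
  generalize H3 τ 3 = B at *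
  generalize csqrt (-Complex.I * τ) = c at *
  generalize ((√2 : ℝ) : ℂ) = s at *
  generalize e (-3 / 8) = W at *
  have hX : X = E * (Complex.I / 2 * B) := by rw [← h3]; field_simp
  have h5 : -(E / W) * (E' * Y) = -(E / s) * A := by rw [h2]; field_simp
  have h6 : -(E / s) * A = -(E / s) * (c * B) := by
    rw [← h5]
    have : -(E / W) * (E' * Y) = Complex.I * (s * c) * X := by rw [← h1]; ring
    rw [this, hX]
    field_simp
    linear_combination (s ^ 2 * c * B) * hI2 - (c * B) * hs2
  exact mul_left_cancel₀ (neg_ne_zero.mpr (div_ne_zero he hs)) h6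

lemma S_smul_S_smul (τ : ℍ) : ModularGroup.S • ModularGroup.S • τ = τ := by
  apply UpperHalfPlane.ext
  rw [coe_S_smul, coe_S_smul]
  have := τ.ne_zero
  field_simp

lemma csqrt_mul_csqrt_S (τ : ℍ) :
    csqrt (-Complex.I * τ) * csqrt (-Complex.I * (ModularGroup.S • τ : ℍ)) = 1 := by
  have h0 := csqrt_ne_zero (z := -Complex.I * τ) (by simp [τ.ne_zero])
  have hp := re_csqrt_pos (neg_I_mul_mem_slitPlane τ.im_pos)
  have : csqrt (-Complex.I * (ModularGroup.S • τ : ℍ)) = (csqrt (-Complex.I * τ))⁻¹ := by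
    refine csqrt_eq ?_ ?_
    · rw [inv_pow, csqrt_sq, coe_S_smul]
      have := τ.ne_zero
      have hI := Complex.I_ne_zero
      field_simp
      rw [Complex.I_sq]
    · rw [Complex.inv_re]
      exact div_pos hp (Complex.normSq_pos.mpr h0)
  rw [this, mul_inv_cancel₀ h0]

/-- `S` is an involution of `ℍ`, and the two factors `√(-iτ)` at `τ` and `-1/τ` multiply to 1. -/
lemma H3_S_symm {i j : Fin 6}
    (h : ∀ τ : ℍ, H3 (ModularGroup.S • τ) i = csqrt (-Complex.I * τ) * H3 τ j) (τ : ℍ) :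
    H3 (ModularGroup.S • τ) j = csqrt (-Complex.I * τ) * H3 τ i := by
  have h1 := h (ModularGroup.S • τ)
  rw [S_smul_S_smul] at h1
  rw [h1, ← mul_assoc, csqrt_mul_csqrt_S, one_mul]

lemma csqrt_sector {z : ℂ} (hz : 0 < z.re) :
    |(csqrt z).im| < (csqrt z).re := by
  have h1 := re_csqrt_pos (Complex.mem_slitPlane_iff.mpr (Or.inl hz))
  have h2 := congrArg Complex.re (csqrt_sq z)
  rw [sq, Complex.mul_re] at h2
  refine abs_lt_of_sq_lt_sq ?_ h1.le
  nlinarith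

/-- Both sides have the same square. The three roots lie in the sector `|arg| < π/4`, so the left
side and `e (1/8) * csqrt x` both have positive real part, which excludes the other sign. -/
lemma csqrt_mul_csqrt_of_sector {z w x : ℂ} (hz : 0 < z.re) (hw : 0 < w.re) (hx : 0 < x.re)
    (h : z * w = Complex.I * x) : csqrt z * csqrt w = e (1 / 8) * csqrt x := by
  have h1 := abs_lt.mp (csqrt_sector hz)
  have h2 := abs_lt.mp (csqrt_sector hw)
  have h3 := abs_lt.mp (csqrt_sector hx)
  have hsq : (csqrt z * csqrt w) ^ 2 = (e (1 / 8) * csqrt x) ^ 2 := by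
    rw [mul_pow, mul_pow, csqrt_sq, csqrt_sq, csqrt_sq, h, e_pow, ← e_quarter]
    norm_num
  rcases sq_eq_sq_iff_eq_or_eq_neg.mp hsq with h4 | h4
  · exact h4
  · exfalso
    have h5 : csqrt z * csqrt w * (√2 : ℝ) = -((1 + Complex.I) * csqrt x) := by
      rw [h4, ← e_eighth]; ring
    have h6 := congrArg Complex.re h5
    rw [Complex.re_mul_ofReal, Complex.mul_re, Complex.neg_re, Complex.mul_re] at h6
    simp only [Complex.add_re, Complex.one_re, Complex.I_re, Complex.add_im, Complex.one_im,
      Complex.I_im] at h6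
    have h7 : 0 < (csqrt z).re * (csqrt w).re - (csqrt z).im * (csqrt w).im := by nlinarith
    have h8 := mul_pos h7 (Real.sqrt_pos.mpr (zero_lt_two' ℝ))
    linarith

lemma re_neg_I_mul (z : ℂ) : (-Complex.I * z).re = z.im := by simp

/-- No further special value is needed: with `τ = Tx` and `w = STSTx`, the relation `Tw = Sx`
expresses this law through those already known. The square roots combine with the constant `e (1/8)
= e (-1/48)² e (1/6)`, which the translation multipliers absorb. -/
lemma H3_S_one (τ : ℍ) :
    H3 (ModularGroup.S • τ) 1 = csqrt (-Complex.I * τ) * H3 τ 5 := by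
  obtain ⟨x, rfl⟩ : ∃ x : ℍ, ModularGroup.T • x = τ := ⟨ModularGroup.T⁻¹ • τ, by simp⟩
  obtain ⟨w, hw⟩ : ∃ w : ℍ,
      w = ModularGroup.S • ModularGroup.T • ModularGroup.S • ModularGroup.T • x := ⟨_, rfl⟩
  have hx0 := x.ne_zero
  have hx1 := (ModularGroup.T • x).ne_zero
  rw [coe_T_smul] at hx1
  have hwc : (w : ℂ) = -(x + 1) / x := by
    rw [hw, coe_S_smul, coe_T_smul, coe_S_smul, coe_T_smul,
      show -1 / ((x : ℂ) + 1) + 1 = x / (x + 1) by field_simp; ring]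
    field_simp
  have hTw : ModularGroup.T • w = ModularGroup.S • x := by
    apply UpperHalfPlane.ext
    rw [coe_T_smul, coe_S_smul, hwc]
    field_simp
    ring
  have h1 := H3_T_apply (ModularGroup.S • ModularGroup.T • x) 0
  have h2 := H3_S_zero w
  rw [hw, S_smul_S_smul, ← hw] at h2
  have h3 := H3_T_apply w 3
  rw [hTw, H3_S_symm H3_S_four x] at h3
  have h4 := H3_T_apply x 5
  have ht0 : tMult 0 = e (-1 / 48) := rfl
  have ht3 : tMult 3 = e (-1 / 48) := rfl
  have ht5 : tMult 5 = e (1 / 6) := rfl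
  have hp0 : tPerm 0 = 1 := rfl
  have hp3 : tPerm 3 = 2 := rfl
  have hp5 : tPerm 5 = 4 := rfl
  rw [ht0, hp0, h2] at h1
  rw [ht3, hp3] at h3
  rw [ht5, hp5] at h4
  have hc : csqrt (-Complex.I * w) * csqrt (-Complex.I * x) =
      e (1 / 8) * csqrt (-Complex.I * (ModularGroup.T • x : ℍ)) := by
    refine csqrt_mul_csqrt_of_sector ?_ ?_ ?_ ?_
    · rw [re_neg_I_mul]; exact w.im_pos
    · rw [re_neg_I_mul]; exact x.im_pos
    · rw [re_neg_I_mul]; exact (ModularGroup.T • x).im_pos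
    · rw [hwc, coe_T_smul]
      field_simp
  have h48 := e_ne_zero (-1 / 48)
  have he : e (1 / 8) = e (-1 / 48) * e (-1 / 48) * e (1 / 6) := by
    rw [← e_add, ← e_add]; congr 1; norm_num
  rw [h4]
  rw [he] at hc
  generalize e (-1 / 48) = z at *
  refine mul_left_cancel₀ (mul_ne_zero h48 h48) ?_
  linear_combination (-z) * h1 - csqrt (-Complex.I * w) * h3 + H3 x 4 * hc

lemma H3_S_apply (τ : ℍ) (j : Fin 6) :
    H3 (ModularGroup.S • τ) j = csqrt (-Complex.I * τ) * H3 τ (sPerm j) := by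
  fin_cases j
  · exact H3_S_zero τ
  · exact H3_S_one τ
  · exact H3_S_symm H3_S_zero τ
  · exact H3_S_symm H3_S_four τ
  · exact H3_S_four τ
  · exact H3_S_symm H3_S_one τ

lemma H3_S (τ : ℍ) : H3 (ModularGroup.S • τ) = csqrt (-Complex.I * τ) • (S3 *ᵥ H3 τ) := by
  rw [S3_mulVec]
  exact funext (H3_S_apply τ)

/-! ### Smoothness, harmonicity and growth. -/

/-! ### Real derivatives of Eichler integrals -/

/-- Polynomial growth of a sequence of coefficients. -/
def PolyBounded (c : ℤ → ℂ) : Prop := ∃ (K : ℝ) (m : ℕ), 0 ≤ K ∧ ∀ n, ‖c n‖ ≤ K * |(n : ℝ)| ^ m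

/-- The coefficients of the holomorphic derivative of an Eichler integral. -/
def derivCoeff (c : ℤ → ℂ) (n : ℤ) : ℂ := -(Real.pi * Complex.I * n ^ 2 / 24) * c n

lemma PolyBounded.derivCoeff {c : ℤ → ℂ} (h : PolyBounded c) : PolyBounded (derivCoeff c) := by
  obtain ⟨K, m, hK, h⟩ := h
  refine ⟨Real.pi / 24 * K, m + 2, by positivity, fun n => ?_⟩
  have h1 : ‖-((Real.pi : ℂ) * Complex.I * (n : ℂ) ^ 2 / 24)‖ = Real.pi / 24 * |(n : ℝ)| ^ 2 := by
    rw [norm_neg, norm_div, norm_mul, norm_mul, norm_pow, Complex.norm_I, Complex.norm_real,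
      Real.norm_of_nonneg Real.pi_pos.le, Complex.norm_intCast]
    norm_num
    ring
  rw [MockThetaThree.derivCoeff, norm_mul, h1]
  calc _ ≤ Real.pi / 24 * |(n : ℝ)| ^ 2 * (K * |(n : ℝ)| ^ m) := by gcongr; exact h n
    _ = _ := by ring

lemma polyBounded_shadowCoeff (j : Fin 6) : PolyBounded (shadowCoeff j) :=
  ⟨4, 0, by norm_num, fun n => by simpa using norm_shadowCoeff_le j n⟩

/-- The terms of the antiholomorphic derivative of an Eichler integral, as functions of `-τ̄`. -/
def shadowTerm (c : ℤ → ℂ) (w : ℂ) (n : ℤ) : ℂ := c n * n * e (-(w * (n ^ 2 / 48)))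

/-- The antiholomorphic derivative of an Eichler integral, as a function of `τ̄`. -/
def shadow (c : ℤ → ℂ) (w : ℂ) : ℂ := ∑' n, shadowTerm c w n

lemma summable_pow_mul_exp (m : ℕ) {a : ℝ} (ha : 0 < a) :
    Summable fun n : ℤ => |(n : ℝ)| ^ m * Real.exp (-a * n ^ 2) := by
  simpa using summable_pow_mul_gaussian m ha 0

lemma norm_shadowTerm_le {c : ℤ → ℂ} {K : ℝ} {m : ℕ} (hc : ∀ n, ‖c n‖ ≤ K * |(n : ℝ)| ^ m)
    (hK : 0 ≤ K) {ε : ℝ} {w : ℂ} (hw : w.im < -ε) (n : ℤ) :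
    ‖shadowTerm c w n‖ ≤ K * (|(n : ℝ)| ^ (m + 1) * Real.exp (-(Real.pi * ε / 24) * n ^ 2)) := by
  rw [shadowTerm, norm_mul, norm_mul, ← neg_mul, norm_e_sq, Complex.norm_intCast]
  have h1 : Real.exp (-(Real.pi * (-w).im / 24) * n ^ 2) ≤
      Real.exp (-(Real.pi * ε / 24) * n ^ 2) := by
    apply Real.exp_le_exp.mpr
    rw [Complex.neg_im]
    have := Real.pi_pos
    have h2 : Real.pi * ε ≤ Real.pi * -w.im := by
      apply mul_le_mul_of_nonneg_left _ this.le; linarith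
    nlinarith [sq_nonneg (n : ℝ)]
  calc _ ≤ K * |(n : ℝ)| ^ m * |(n : ℝ)| * Real.exp (-(Real.pi * ε / 24) * n ^ 2) := by
        gcongr; exact hc n
    _ = _ := by ring

lemma hasDerivAt_shadow {c : ℤ → ℂ} (hc : PolyBounded c) {w : ℂ} (hw : w.im < 0) :
    HasDerivAt (shadow c) (shadow (derivCoeff c) w) w := by
  obtain ⟨K, m, hK, hb⟩ := hc
  obtain ⟨K', m', hK', hb'⟩ := PolyBounded.derivCoeff ⟨K, m, hK, hb⟩
  have hε : 0 < -w.im / 2 := by linarith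
  have hmem : w ∈ {z : ℂ | z.im < -(-w.im / 2)} := by simp; linarith
  have hopen : IsOpen {z : ℂ | z.im < -(-w.im / 2)} :=
    isOpen_lt Complex.continuous_im continuous_const
  refine hasDerivAt_tsum_of_isPreconnected (t := {z : ℂ | z.im < -(-w.im / 2)})
    (g := fun n w => shadowTerm c w n) (g' := fun n w => shadowTerm (derivCoeff c) w n)
    ((summable_pow_mul_exp (m' + 1) (a := Real.pi * (-w.im / 2) / 24) (by positivity)).mul_left K')
    hopen (convex_halfSpace_im_lt _).isPreconnected (fun n z _ => ?_)
    (fun n z hz => norm_shadowTerm_le hb' hK' hz n) hmem ?_ hmem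
  · have h1 : HasDerivAt (fun z : ℂ => -(z * ((n : ℂ) ^ 2 / 48))) (-(1 * ((n : ℂ) ^ 2 / 48))) z :=
      ((hasDerivAt_id z).mul_const _).neg
    have h2 := ((hasDerivAt_e _).comp z h1).const_mul (c n * n)
    refine h2.congr_deriv ?_
    rw [shadowTerm, derivCoeff]
    ring
  · exact Summable.of_norm_bounded ((summable_pow_mul_exp (m + 1)
      (a := Real.pi * (-w.im / 2) / 24) (by positivity)).mul_left K)
      (norm_shadowTerm_le hb hK hmem)

/-- The factor `-1 / √(12 v)` in the antiholomorphic derivative of an Eichler integral. -/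
def shadowFactor (v : ℝ) : ℝ := -(1 / (12 * √(v / 12)))

/-- The Gaussian produced by differentiating the error function turns `e (-τ n²/48)` into `e (-τ̄
n²/48)`, so the coefficient of `Im` is antiholomorphic up to a power of `v`. -/
lemma hasFDerivAt_eichlerTerm (c : ℤ → ℂ) {τ : ℂ} (hτ : 0 < τ.im) (n : ℤ) :
    HasFDerivAt (fun τ => eichlerTerm c τ n)
      (eichlerTerm (derivCoeff c) τ n • ContinuousLinearMap.id ℝ ℂ +
        ((shadowFactor τ.im : ℂ) * shadowTerm c ((starRingEnd ℂ) τ) n) • imC) τ := by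
  have hs : 0 < √(τ.im / 12) := Real.sqrt_pos.mpr (by positivity)
  have h0 : HasDerivAt (fun v : ℝ => (n : ℝ) * √(v / 12))
      (n * (1 / 12 / (2 * √(τ.im / 12)))) τ.im :=
    (((hasDerivAt_id τ.im).div_const 12).sqrt (by positivity)).const_mul _
  have h1 := ((hasDerivAt_gaussErf _).comp τ.im h0).comp_hasFDerivAt τ
    (Complex.imCLM.hasFDerivAt (x := τ))
  have h3 := (Complex.ofRealCLM.hasFDerivAt).comp τ (h1.const_sub (n.sign : ℝ))
  have h4 : HasFDerivAt (fun τ : ℂ => e (-(τ * ((n : ℂ) ^ 2 / 48))))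
      ((-(Real.pi * Complex.I * n ^ 2 / 24) * e (-(τ * (n ^ 2 / 48)))) •
        ContinuousLinearMap.id ℝ ℂ) τ := by
    have hl : HasDerivAt (fun z : ℂ => -(z * ((n : ℂ) ^ 2 / 48))) (-(1 * ((n : ℂ) ^ 2 / 48))) τ :=
      ((hasDerivAt_id τ).mul_const _).neg
    refine (((hasDerivAt_e _).comp τ hl).complexToReal_fderiv).congr_fderiv ?_
    refine ContinuousLinearMap.ext fun z => ?_
    simp only [smul_apply, ContinuousLinearMap.id_apply, one_apply_eq_self, smul_eq_mul]
    ring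
  have h5 := (h3.const_mul (c n)).mul h4
  have key : ((Real.exp (-Real.pi * (n * √(τ.im / 12)) ^ 2) : ℝ) : ℂ) *
      e (-(τ * (n ^ 2 / 48))) = e (-((starRingEnd ℂ) τ * (n ^ 2 / 48))) := by
    rw [mul_pow, Real.sq_sqrt (by positivity), e, e, Complex.ofReal_exp, ← Complex.exp_add]
    congr 1
    have h6 : (starRingEnd ℂ) τ = τ - 2 * Complex.I * τ.im := by
      apply Complex.ext
      · simp
      · simp; ring
    rw [h6]
    push_cast
    linear_combination (-(Real.pi * (n ^ 2 / 12) * τ.im) : ℂ) * Complex.I_sq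
  refine h5.congr_fderiv ?_
  refine ContinuousLinearMap.ext fun z => ?_
  rw [← sub_eq_zero]
  simp only [eichlerTerm, derivCoeff, shadowTerm, shadowFactor, signErf, imC_apply, add_apply,
    smul_apply, ContinuousLinearMap.id_apply, Function.comp_apply, Complex.imCLM_apply,
    ContinuousLinearMap.comp_apply, Complex.ofRealCLM_apply, neg_apply,
    smul_eq_mul, ← key]
  have hs' : ((√(τ.im / 12) : ℝ) : ℂ) ≠ 0 := by exact_mod_cast hs.ne'
  push_cast
  field_simp
  ring

lemma norm_eichlerTerm_le_of_poly {c : ℤ → ℂ} {K : ℝ} {m : ℕ}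
    (hc : ∀ n, ‖c n‖ ≤ K * |(n : ℝ)| ^ m) (hK : 0 ≤ K) {ε : ℝ} (hε : 0 < ε) {τ : ℂ}
    (hτ : ε < τ.im) (n : ℤ) : ‖eichlerTerm c τ n‖ ≤
      2 * K * (|(n : ℝ)| ^ m * Real.exp (-(Real.pi * ε / 24) * n ^ 2)) := by
  rw [eichlerTerm, norm_mul, norm_mul, Complex.norm_real, Real.norm_eq_abs, mul_assoc]
  have h1 := abs_signErf_mul_norm_e_le (hε.trans hτ) n
  have h2 : Real.exp (-(Real.pi * τ.im / 24) * n ^ 2) ≤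
      Real.exp (-(Real.pi * ε / 24) * n ^ 2) := by
    apply Real.exp_le_exp.mpr
    have h3 : Real.pi * ε ≤ Real.pi * τ.im := mul_le_mul_of_nonneg_left hτ.le Real.pi_pos.le
    nlinarith [sq_nonneg (n : ℝ)]
  calc _ ≤ K * |(n : ℝ)| ^ m * (2 * Real.exp (-(Real.pi * ε / 24) * n ^ 2)) :=
        mul_le_mul (hc n) (h1.trans (by gcongr)) (by positivity) (by positivity)
    _ = _ := by ring

lemma hasFDerivAt_eichler {c : ℤ → ℂ} (hc : PolyBounded c) {τ : ℂ} (hτ : 0 < τ.im) :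
    HasFDerivAt (eichler c)
      (eichler (derivCoeff c) τ • ContinuousLinearMap.id ℝ ℂ +
        ((shadowFactor τ.im : ℂ) * shadow c ((starRingEnd ℂ) τ)) • imC) τ := by
  obtain ⟨K, m, hK, hb⟩ := hc
  obtain ⟨K', m', hK', hb'⟩ := PolyBounded.derivCoeff ⟨K, m, hK, hb⟩
  set ε := τ.im / 2 with hε'
  have hε : 0 < ε := by positivity
  set U : Set ℂ := {z : ℂ | ε < z.im}
  have hmem : τ ∈ U := by change ε < τ.im; linarith
  have hopen : IsOpen U := isOpen_lt continuous_const Complex.continuous_im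
  have ha : 0 < Real.pi * ε / 24 := by positivity
  have s1 := (summable_pow_mul_exp m' ha).mul_left (2 * K')
  have s2 := ((summable_pow_mul_exp (m + 1) ha).mul_left K).mul_left |shadowFactor ε|
  have hconj : ∀ z ∈ U, ((starRingEnd ℂ) z).im < -ε := fun z hz => by
    rw [Complex.conj_im]; exact neg_lt_neg hz
  have hfac : ∀ z ∈ U, |shadowFactor z.im| ≤ |shadowFactor ε| := by
    intro z hz
    have hz' : ε < z.im := hz
    rw [shadowFactor, shadowFactor, abs_neg, abs_neg, abs_of_nonneg (by positivity),
      abs_of_nonneg (by positivity)]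
    have : 0 < √(ε / 12) := Real.sqrt_pos.mpr (by positivity)
    gcongr
  have hb1 : ∀ n, ∀ z ∈ U, ‖eichlerTerm (derivCoeff c) z n‖ ≤
      2 * K' * (|(n : ℝ)| ^ m' * Real.exp (-(Real.pi * ε / 24) * n ^ 2)) :=
    fun n z hz => norm_eichlerTerm_le_of_poly hb' hK' hε hz n
  have hb2 : ∀ (n : ℤ), ∀ z ∈ U,
      ‖(shadowFactor z.im : ℂ) * shadowTerm c ((starRingEnd ℂ) z) n‖ ≤ |shadowFactor ε| *
        (K * (|(n : ℝ)| ^ (m + 1) * Real.exp (-(Real.pi * ε / 24) * n ^ 2))) := by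
    intro n z hz
    rw [norm_mul, Complex.norm_real, Real.norm_eq_abs]
    exact mul_le_mul (hfac z hz) (norm_shadowTerm_le hb hK (hconj z hz) n) (norm_nonneg _)
      (abs_nonneg _)
  have hsum := hasFDerivAt_tsum_of_isPreconnected (f := fun n z => eichlerTerm c z n)
    (f' := fun n z => eichlerTerm (derivCoeff c) z n • ContinuousLinearMap.id ℝ ℂ +
        ((shadowFactor z.im : ℂ) * shadowTerm c ((starRingEnd ℂ) z) n) • imC)
    (s1.add s2) hopen (convex_halfSpace_im_gt _).isPreconnected
    (fun n z hz => hasFDerivAt_eichlerTerm c (hε.trans hz) n)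
    (fun n z hz => by
      refine (norm_add_le _ _).trans (add_le_add ?_ ?_)
      · refine (norm_smul_le _ _).trans ?_
        calc _ ≤ ‖eichlerTerm (derivCoeff c) z n‖ * 1 := by
              gcongr; exact ContinuousLinearMap.norm_id_le
          _ ≤ _ := by rw [mul_one]; exact hb1 n z hz
      · refine (norm_smul_le _ _).trans ?_
        calc _ ≤ ‖(shadowFactor z.im : ℂ) * shadowTerm c ((starRingEnd ℂ) z) n‖ * 1 := by
              gcongr; exact norm_imC_le
          _ ≤ _ := by rw [mul_one]; exact hb2 n z hz)
    hmem (Summable.of_norm_bounded ((summable_pow_mul_exp m ha).mul_left (2 * K))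
      fun n => norm_eichlerTerm_le_of_poly hb hK hε hmem n) hmem
  refine hsum.congr_fderiv ?_
  have sI : Summable fun n => eichlerTerm (derivCoeff c) τ n :=
    Summable.of_norm_bounded s1 fun n => hb1 n τ hmem
  have sH : Summable fun n => (shadowFactor τ.im : ℂ) * shadowTerm c ((starRingEnd ℂ) τ) n :=
    Summable.of_norm_bounded s2 fun n => hb2 n τ hmem
  rw [Summable.tsum_add (sI.smul_const _) (sH.smul_const _), sI.tsum_smul_const,
    sH.tsum_smul_const, tsum_mul_left, eichler, shadow]

lemma isOpen_im_pos : IsOpen {z : ℂ | 0 < z.im} := isOpen_lt continuous_const Complex.continuous_im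

lemma differentiableOn_shadow {c : ℤ → ℂ} (hc : PolyBounded c) :
    DifferentiableOn ℂ (shadow c) {w : ℂ | w.im < 0} := fun _ hw =>
  (hasDerivAt_shadow hc hw).differentiableAt.differentiableWithinAt

lemma contDiffOn_shadow_conj {c : ℤ → ℂ} (hc : PolyBounded c) (m : ℕ) :
    ContDiffOn ℝ m (fun τ => shadow c ((starRingEnd ℂ) τ)) {z : ℂ | 0 < z.im} := by
  have h1 : ContDiffOn ℝ m (shadow c) {w : ℂ | w.im < 0} :=
    ((differentiableOn_shadow hc).contDiffOn
      (isOpen_lt Complex.continuous_im continuous_const)).restrict_scalars ℝ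
  refine h1.comp Complex.conjCLE.contDiff.contDiffOn fun z hz => ?_
  have hz' : 0 < z.im := hz
  change ((starRingEnd ℂ) z).im < 0
  rw [Complex.conj_im]
  linarith

lemma contDiffOn_shadowFactor (m : ℕ) :
    ContDiffOn ℝ m (fun τ : ℂ => (shadowFactor τ.im : ℂ)) {z : ℂ | 0 < z.im} := by
  refine Complex.ofRealCLM.contDiff.comp_contDiffOn ?_
  have h1 : ContDiffOn ℝ m (fun τ : ℂ => √(τ.im / 12)) {z : ℂ | 0 < z.im} := by
    refine ContDiffOn.sqrt ?_ fun z hz => ?_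
    · exact (Complex.imCLM.contDiff.div_const 12).contDiffOn
    · have hz' : 0 < z.im := hz
      positivity
  refine (ContDiffOn.div contDiffOn_const (contDiffOn_const.mul h1) fun z hz => ?_).neg
  have hz' : 0 < z.im := hz
  have : 0 < √(z.im / 12) := Real.sqrt_pos.mpr (by positivity)
  positivity

/-- The derivative contains another Eichler integral, with coefficients multiplied by `n²`;
induction therefore needs all polynomially bounded coefficients at once. -/
lemma contDiffOn_eichler (m : ℕ) : ∀ {c : ℤ → ℂ}, PolyBounded c →
    ContDiffOn ℝ m (eichler c) {z : ℂ | 0 < z.im} := by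
  induction m with
  | zero =>
    intro c hc
    rw [Nat.cast_zero, contDiffOn_zero]
    exact fun z hz => (hasFDerivAt_eichler hc hz).continuousAt.continuousWithinAt
  | succ m ih =>
    intro c hc
    rw [Nat.cast_add, Nat.cast_one,
      contDiffOn_succ_iff_hasFDerivWithinAt_of_uniqueDiffOn isOpen_im_pos.uniqueDiffOn]
    refine ⟨fun h => absurd h (by simp), _, ?_,
      fun z hz => (hasFDerivAt_eichler hc hz).hasFDerivWithinAt⟩
    exact ((ih hc.derivCoeff).smul contDiffOn_const).add
      (((contDiffOn_shadowFactor m).mul (contDiffOn_shadow_conj hc m)).smul contDiffOn_const)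

/-! ### Harmonicity -/

/-- A holomorphic function plus an Eichler integral. -/
lemma isC2_add_eichler {F : ℂ → ℂ} (hF : DifferentiableOn ℂ F {z : ℂ | 0 < z.im}) {c : ℤ → ℂ}
    (hc : PolyBounded c) : IsC2 fun τ : ℍ => F τ + eichler c τ := by
  have h1 : ContDiffOn ℝ 2 (fun z => F z + eichler c z) {z : ℂ | 0 < z.im} :=
    ((hF.contDiffOn isOpen_im_pos).restrict_scalars ℝ).add (contDiffOn_eichler 2 hc)
  refine h1.congr fun z hz => ?_
  rw [Function.comp_apply, ofComplex_apply_of_im_pos hz]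

lemma fderiv_comp_ofComplex {h : ℂ → ℂ} {L : ℂ →L[ℝ] ℂ} {τ : ℍ} (hL : HasFDerivAt h L (τ : ℂ)) :
    fderiv ℝ ((fun τ : ℍ => h τ) ∘ ofComplex) (τ : ℂ) = L := by
  refine (hL.congr_of_eventuallyEq ?_).fderiv
  filter_upwards [isOpen_im_pos.mem_nhds τ.im_pos] with z hz
  rw [Function.comp_apply, ofComplex_apply_of_im_pos hz]

lemma hasDerivAt_shadowFactor {v : ℝ} (hv : 0 < v) :
    HasDerivAt shadowFactor (-(shadowFactor v / (2 * v))) v := by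
  have hs : 0 < √(v / 12) := Real.sqrt_pos.mpr (by positivity)
  have h1 : HasDerivAt (fun v : ℝ => 12 * √(v / 12)) (12 * (1 / 12 / (2 * √(v / 12)))) v :=
    (((hasDerivAt_id v).div_const 12).sqrt (by positivity)).const_mul _
  have h2 := ((hasDerivAt_const v (1 : ℝ)).div h1 (by positivity)).neg
  refine h2.congr_deriv ?_
  have h3 : √(v / 12) ^ 2 = v / 12 := Real.sq_sqrt (by positivity)
  rw [shadowFactor]
  generalize √(v / 12) = s at *
  have : v = 12 * s ^ 2 := by rw [h3]; ring
  subst this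
  field_simp
  ring

/-- One has `∂f/∂u = A` and `∂f/∂v = iA + B`, so the first order part of the operator sees only
`iB`. As `B` is `v^{-1/2}` times an antiholomorphic function, the Euclidean Laplacian of `f` is `-B
/ (2v)`, and the two parts cancel exactly in weight `1/2`. -/
lemma hypLaplacian_add_eichler {F : ℂ → ℂ} (hF : DifferentiableOn ℂ F {z : ℂ | 0 < z.im})
    {c : ℤ → ℂ} (hc : PolyBounded c) (τ : ℍ) :
    hypLaplacian 1 (fun τ : ℍ => F τ + eichler c τ) τ = 0 := by
  set A : ℂ → ℂ := fun z => deriv F z + eichler (derivCoeff c) z with hA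
  set B : ℂ → ℂ := fun z => (shadowFactor z.im : ℂ) * shadow c ((starRingEnd ℂ) z) with hB
  have hF' : DifferentiableOn ℂ (deriv F) {z : ℂ | 0 < z.im} := hF.deriv isOpen_im_pos
  have hder : ∀ {G : ℂ → ℂ}, DifferentiableOn ℂ G {z : ℂ | 0 < z.im} → ∀ {z : ℂ}, 0 < z.im →
      HasFDerivAt G (deriv G z • (1 : ℂ →L[ℝ] ℂ)) z := fun hG z hz =>
    (hG.differentiableAt (isOpen_im_pos.mem_nhds hz)).hasDerivAt.complexToReal_fderiv
  have hH : ∀ {z : ℂ}, 0 < z.im → HasFDerivAt (fun z => F z + eichler c z)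
      (deriv F z • (1 : ℂ →L[ℝ] ℂ) + (eichler (derivCoeff c) z • ContinuousLinearMap.id ℝ ℂ +
        B z • imC)) z := fun hz => (hder hF hz).add (hasFDerivAt_eichler hc hz)
  have hU : partialU (fun τ : ℍ => F τ + eichler c τ) = fun τ : ℍ => A τ := by
    funext σ
    rw [partialU, fderiv_comp_ofComplex (h := fun z => F z + eichler c z) (hH σ.im_pos)]
    simp [hA, imC_apply]
  have hV : partialV (fun τ : ℍ => F τ + eichler c τ) =
      fun τ : ℍ => Complex.I * A τ + B τ := by
    funext σ
    rw [partialV, fderiv_comp_ofComplex (h := fun z => F z + eichler c z) (hH σ.im_pos)]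
    simp [hA, imC_apply]
    ring
  have hτ : 0 < (τ : ℂ).im := τ.im_pos
  have hA' : HasFDerivAt A (deriv (deriv F) τ • (1 : ℂ →L[ℝ] ℂ) +
      (eichler (derivCoeff (derivCoeff c)) τ • ContinuousLinearMap.id ℝ ℂ +
        ((shadowFactor (τ : ℂ).im : ℂ) * shadow (derivCoeff c) ((starRingEnd ℂ) (τ : ℂ))) • imC)) τ :=
    (hder hF' hτ).add (hasFDerivAt_eichler hc.derivCoeff hτ)
  have hfac : HasFDerivAt (fun z : ℂ => (shadowFactor z.im : ℂ))
      (Complex.ofRealCLM.comp ((-(shadowFactor (τ : ℂ).im / (2 * (τ : ℂ).im))) •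
        Complex.imCLM)) (τ : ℂ) :=
    (Complex.ofRealCLM.hasFDerivAt).comp (τ : ℂ)
      ((hasDerivAt_shadowFactor hτ).comp_hasFDerivAt (τ : ℂ) Complex.imCLM.hasFDerivAt)
  have hsh : HasFDerivAt (fun z : ℂ => shadow c ((starRingEnd ℂ) z))
      ((shadow (derivCoeff c) ((starRingEnd ℂ) (τ : ℂ)) • (1 : ℂ →L[ℝ] ℂ)).comp
        (Complex.conjCLE : ℂ →L[ℝ] ℂ)) (τ : ℂ) := by
    refine HasFDerivAt.comp (g := shadow c) (τ : ℂ)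
      (HasDerivAt.complexToReal_fderiv (hasDerivAt_shadow hc ?_))
      Complex.conjCLE.hasFDerivAt
    rw [Complex.conj_im]
    linarith
  have hB' := hfac.mul hsh
  have hUU : partialU (fun τ : ℍ => A τ) τ =
      deriv (deriv F) τ + eichler (derivCoeff (derivCoeff c)) τ := by
    rw [partialU, fderiv_comp_ofComplex hA']
    simp [imC_apply]
  -- The differentiated shadow occurs in `i ∂A/∂v` and, since `∂τ̄/∂v = -i`, with opposite sign in
  -- `∂B/∂v`. Only the derivative of `v^{-1/2}` remains of `B`.
  have hVV : partialV (fun τ : ℍ => Complex.I * A τ + B τ) τ =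
      -(deriv (deriv F) τ + eichler (derivCoeff (derivCoeff c)) τ) -
        B τ / (2 * τ.im) := by
    rw [partialV, fderiv_comp_ofComplex (h := fun z => Complex.I * A z + B z)
      ((hA'.const_mul Complex.I).add hB')]
    have hI := Complex.I_sq
    simp only [add_apply, smul_apply, ContinuousLinearMap.comp_apply, one_apply_eq_self,
      ContinuousLinearMap.id_apply, imC_apply, Complex.ofRealCLM_apply, Complex.imCLM_apply,
      smul_eq_mul, Complex.I_im, ContinuousLinearEquiv.coe_coe, Complex.conjCLE_apply,
      Complex.conj_I, hB, UpperHalfPlane.coe_im]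
    push_cast
    linear_combination (deriv (deriv F) τ + eichler (derivCoeff (derivCoeff c)) τ) * hI
  have hτ0 : (τ.im : ℂ) ≠ 0 := by exact_mod_cast hτ.ne'
  rw [hypLaplacian, hU, hV, hUU, hVV]
  have hI := Complex.I_sq
  field_simp
  push_cast
  linear_combination (τ.im * Complex.I * A τ + τ.im * B τ) * hI

/-! ### The holomorphic part -/

/-- The components of `F3` as functions of a complex variable. -/
def F3Fun (j : Fin 6) (z : ℂ) : ℂ :=
  (![e (-z / 48) * mockPhi (e (z / 2)),
    e (-z / 48) * mockPhi (-e (z / 2)),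
    2 * e (-z / 48) * mockPsi (e (z / 2)),
    2 * e (-z / 48) * mockPsi (-e (z / 2)),
    (√2 : ℝ) * e (z / 6) * mockNu (e (z / 2)),
    (√2 : ℝ) * e (z / 6) * mockNu (-e (z / 2))] : Fin 6 → ℂ) j

lemma F3_apply (τ : ℍ) (j : Fin 6) : F3 τ j = F3Fun j τ := rfl

lemma norm_e_half_lt_one {z : ℂ} (hz : 0 < z.im) : ‖e (z / 2)‖ < 1 :=
  norm_e_lt_one (by rw [show (z / 2).im = z.im / 2 by simp]; positivity)

lemma differentiableOn_F3Fun (j : Fin 6) : DifferentiableOn ℂ (F3Fun j) {z : ℂ | 0 < z.im} := by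
  have hd : ∀ {f : ℂ → ℂ}, Differentiable ℂ f → Differentiable ℂ fun z => e (f z) :=
    fun hf => differentiable_e.comp hf
  have h48 : Differentiable ℂ fun z : ℂ => e (-z / 48) := hd (by fun_prop)
  have h6 : Differentiable ℂ fun z : ℂ => e (z / 6) := hd (by fun_prop)
  have h2 : Differentiable ℂ fun z : ℂ => e (z / 2) := hd (by fun_prop)
  have hp : ∀ {f : ℂ → ℂ}, DifferentiableOn ℂ f (Metric.ball 0 1) →
      DifferentiableOn ℂ (fun z => f (e (z / 2))) {z : ℂ | 0 < z.im} := fun hf =>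
    hf.comp h2.differentiableOn fun z hz => by
      rw [mem_ball_zero_iff]; exact norm_e_half_lt_one hz
  have hm : ∀ {f : ℂ → ℂ}, DifferentiableOn ℂ f (Metric.ball 0 1) →
      DifferentiableOn ℂ (fun z => f (-e (z / 2))) {z : ℂ | 0 < z.im} := fun hf =>
    hf.comp h2.neg.differentiableOn fun z hz => by
      rw [mem_ball_zero_iff, norm_neg]; exact norm_e_half_lt_one hz
  fin_cases j
  · exact h48.differentiableOn.mul (hp differentiableOn_mockPhi)
  · exact h48.differentiableOn.mul (hm differentiableOn_mockPhi)
  · exact (h48.const_mul 2).differentiableOn.mul (hp differentiableOn_mockPsi)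
  · exact (h48.const_mul 2).differentiableOn.mul (hm differentiableOn_mockPsi)
  · exact (h6.const_mul _).differentiableOn.mul (hp differentiableOn_mockNu)
  · exact (h6.const_mul _).differentiableOn.mul (hm differentiableOn_mockNu)

lemma H3_eq (j : Fin 6) :
    (fun τ => H3 τ j) = fun τ : ℍ => F3Fun j τ + eichler (shadowCoeff j) τ :=
  funext fun τ => by rw [H3_apply, F3_apply]

lemma isC2_H3 (j : Fin 6) : IsC2 fun τ => H3 τ j := by
  rw [H3_eq]
  exact isC2_add_eichler (differentiableOn_F3Fun j) (polyBounded_shadowCoeff j)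

lemma hypLaplacian_H3 (j : Fin 6) (τ : ℍ) : hypLaplacian 1 (fun τ => H3 τ j) τ = 0 := by
  rw [H3_eq]
  exact hypLaplacian_add_eichler (differentiableOn_F3Fun j) (polyBounded_shadowCoeff j) τ

/-! ### Behaviour at the cusp -/

lemma tendsto_im_atImInfty : Tendsto (fun τ : ℍ => τ.im) atImInfty atTop := tendsto_comap

lemma tendsto_e_mul_atImInfty {a : ℝ} (ha : 0 < a) :
    Tendsto (fun τ : ℍ => e (a * τ)) atImInfty (𝓝 0) := by
  rw [tendsto_zero_iff_norm_tendsto_zero]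
  have h1 : ∀ τ : ℍ, ‖e (a * τ)‖ = Real.exp (-(2 * Real.pi * a * τ.im)) := fun τ => by
    rw [norm_e, Complex.im_ofReal_mul, UpperHalfPlane.coe_im]; ring_nf
  simp only [h1]
  exact Real.tendsto_exp_neg_atTop_nhds_zero.comp
    (tendsto_im_atImInfty.const_mul_atTop (by have := Real.pi_pos; positivity))

lemma mockPhi_zero : mockPhi 0 = 1 := by
  rw [mockPhi, tsum_eq_single 0]
  · simp [mockPhiTerm, qPochhammer]
  · intro n hn
    simp [mockPhiTerm, hn]

lemma mockPsi_zero : mockPsi 0 = 0 := by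
  rw [mockPsi, ← tsum_zero (α := ℂ) (β := ℕ)]
  refine tsum_congr fun n => ?_
  simp [mockPsiTerm]

/-- The limits of `e (τ / 48) * H3 τ j` at the cusp. -/
def cuspValue (j : Fin 6) : ℂ := if j = 0 ∨ j = 1 then 1 else 0

lemma tendsto_mul_F3 (j : Fin 6) :
    Tendsto (fun τ : ℍ => e (τ / 48) * F3 τ j) atImInfty (𝓝 (cuspValue j)) := by
  have hq : Tendsto (fun τ : ℍ => e (τ / 2)) atImInfty (𝓝 0) := by
    refine (tendsto_e_mul_atImInfty (a := 1 / 2) (by norm_num)).congr fun τ => ?_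
    congr 1; push_cast; ring
  have hq' : Tendsto (fun τ : ℍ => -e (τ / 2)) atImInfty (𝓝 0) := by simpa using hq.neg
  have h6 : Tendsto (fun τ : ℍ => e (τ / 48) * e (τ / 6)) atImInfty (𝓝 0) := by
    refine (tendsto_e_mul_atImInfty (a := 9 / 48) (by norm_num)).congr fun τ => ?_
    rw [← e_add]; congr 1; push_cast; ring
  have h48 : ∀ τ : ℍ, e (τ / 48) * e (-τ / 48) = 1 := fun τ => by
    rw [← e_add, ← e_zero]; congr 1; ring
  have hc : ∀ {f : ℂ → ℂ}, DifferentiableOn ℂ f (Metric.ball 0 1) → Tendsto f (𝓝 0) (𝓝 (f 0)) :=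
    fun hf => (hf.differentiableAt (Metric.ball_mem_nhds 0 one_pos)).continuousAt.tendsto
  have hPhi := hc differentiableOn_mockPhi
  have hPsi := hc differentiableOn_mockPsi
  have hNu := hc differentiableOn_mockNu
  rw [mockPhi_zero] at hPhi
  rw [mockPsi_zero] at hPsi
  have phi : ∀ {g : ℍ → ℂ}, Tendsto g atImInfty (𝓝 0) →
      Tendsto (fun τ : ℍ => e (τ / 48) * (e (-τ / 48) * mockPhi (g τ))) atImInfty (𝓝 1) :=
    fun hg => (hPhi.comp hg).congr fun τ => by
      rw [Function.comp_apply, ← mul_assoc, h48, one_mul]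
  have psi : ∀ {g : ℍ → ℂ}, Tendsto g atImInfty (𝓝 0) →
      Tendsto (fun τ : ℍ => e (τ / 48) * (2 * e (-τ / 48) * mockPsi (g τ))) atImInfty (𝓝 0) :=
    fun hg => by
      have := (hPsi.comp hg).const_mul 2
      rw [mul_zero] at this
      refine this.congr fun τ => ?_
      rw [Function.comp_apply]
      linear_combination (-2 * mockPsi _) * h48 τ
  have nu : ∀ {g : ℍ → ℂ}, Tendsto g atImInfty (𝓝 0) →
      Tendsto (fun τ : ℍ => e (τ / 48) * ((√2 : ℝ) * e (τ / 6) * mockNu (g τ))) atImInfty (𝓝 0) :=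
    fun hg => by
      have := (h6.const_mul ((√2 : ℝ) : ℂ)).mul (hNu.comp hg)
      rw [mul_zero, zero_mul] at this
      refine this.congr fun τ => ?_
      rw [Function.comp_apply]
      ring
  fin_cases j
  · rw [show cuspValue _ = 1 by simp [cuspValue]]; exact phi hq
  · rw [show cuspValue _ = 1 by simp [cuspValue]]; exact phi hq'
  · rw [show cuspValue _ = 0 by simp [cuspValue]]; exact psi hq
  · rw [show cuspValue _ = 0 by simp [cuspValue]]; exact psi hq'
  · rw [show cuspValue _ = 0 by simp [cuspValue]]; exact nu hq
  · rw [show cuspValue _ = 0 by simp [cuspValue]]; exact nu hq'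

lemma norm_eichler_le {c : ℤ → ℂ} {K : ℝ} (hc : ∀ n, ‖c n‖ ≤ K) {τ : ℂ} (hτ : 1 ≤ τ.im) :
    ‖eichler c τ‖ ≤ ∑' n : ℤ, 2 * K * Real.exp (-(Real.pi / 24) * n ^ 2) := by
  have hK : 0 ≤ K := (norm_nonneg _).trans (hc 0)
  refine tsum_of_norm_bounded
    ((summable_exp_neg_sq (by positivity)).mul_left (2 * K)).hasSum fun n => ?_
  refine (norm_eichlerTerm_le hc (by linarith) n).trans ?_
  have h3 : Real.pi ≤ Real.pi * τ.im := le_mul_of_one_le_right Real.pi_pos.le hτ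
  have : -(Real.pi * τ.im / 24) * (n : ℝ) ^ 2 ≤ -(Real.pi / 24) * n ^ 2 := by
    nlinarith [sq_nonneg (n : ℝ)]
  gcongr

/-- Serves both the growth condition and the linear independence of the components. -/
lemma tendsto_mul_H3 (j : Fin 6) :
    Tendsto (fun τ : ℍ => e (τ / 48) * H3 τ j) atImInfty (𝓝 (cuspValue j)) := by
  have h0 : Tendsto (fun τ : ℍ => e (τ / 48)) atImInfty (𝓝 0) := by
    refine (tendsto_e_mul_atImInfty (a := 1 / 48) (by norm_num)).congr fun τ => ?_
    congr 1; push_cast; ring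
  have h1 : Tendsto (fun τ : ℍ => e (τ / 48) * eichler (shadowCoeff j) τ) atImInfty (𝓝 0) := by
    refine h0.zero_mul_isBoundedUnder_le ⟨∑' n : ℤ, 2 * 4 * Real.exp (-(Real.pi / 24) * n ^ 2), ?_⟩
    rw [eventually_map]
    filter_upwards [tendsto_im_atImInfty.eventually_ge_atTop 1] with τ hτ
    exact norm_eichler_le (norm_shadowCoeff_le j) hτ
  have := (tendsto_mul_F3 j).add h1
  rw [add_zero] at this
  refine this.congr fun τ => ?_
  rw [H3_apply, mul_add]

lemma isBigO_H3 (j : Fin 6) :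
    (fun τ => H3 τ j) =O[atImInfty] fun τ : ℍ => Real.exp (1 * τ.im) := by
  have h1 := (tendsto_mul_H3 j).isBigO_one ℝ
  have h2 : (fun τ : ℍ => e (-τ / 48)) =O[atImInfty] fun τ : ℍ => Real.exp (1 * τ.im) := by
    refine Asymptotics.IsBigO.of_bound 1 (Eventually.of_forall fun τ => ?_)
    rw [norm_e, Real.norm_of_nonneg (Real.exp_pos _).le, one_mul]
    apply Real.exp_le_exp.mpr
    have h3 : (-(τ : ℂ) / 48).im = -τ.im / 48 := by simp
    rw [h3]
    -- The norm of `q^{-1/48}` is `exp (πv/24)`, well below `exp v`.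
    have := Real.pi_le_four
    nlinarith [τ.im_pos]
  refine ((h2.mul h1).congr_left fun τ => ?_).congr_right fun τ => mul_one _
  rw [← mul_assoc, ← e_add, show -(τ : ℂ) / 48 + τ / 48 = 0 by ring, e_zero, one_mul]

/-! ### The metaplectic representation and its restriction to `Γ(2)`. -/

/-! ### Linear independence of the components -/

/-- The linear relations between the components of `H3`. -/
def IsRelation (a : Fin 6 → ℂ) : Prop := ∀ τ : ℍ, ∑ j, a j * H3 τ j = 0

/-- Only the two `φ`-components grow like `q^{-1/48}` at the cusp, both with leading coefficient 1.
-/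
lemma IsRelation.cusp {a : Fin 6 → ℂ} (h : IsRelation a) : a 0 + a 1 = 0 := by
  have h1 : Tendsto (fun τ : ℍ => ∑ j, a j * (e (τ / 48) * H3 τ j)) atImInfty
      (𝓝 (∑ j, a j * cuspValue j)) :=
    tendsto_finsetSum _ fun j _ => (tendsto_mul_H3 j).const_mul (a j)
  have h2 : ∀ τ : ℍ, ∑ j, a j * (e (τ / 48) * H3 τ j) = 0 := fun τ => by
    rw [← mul_zero (e (τ / 48)), ← h τ, Finset.mul_sum]
    exact Finset.sum_congr rfl fun j _ => by ring
  simp only [h2] at h1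
  have h3 := tendsto_nhds_unique h1 tendsto_const_nhds
  simpa [Fin.sum_univ_six, cuspValue] using h3

lemma IsRelation.T {a : Fin 6 → ℂ} (h : IsRelation a) :
    IsRelation fun j => tMult j * a (tPerm j) := by
  intro τ
  have h1 := h (ModularGroup.T • τ)
  simp only [H3_T_apply] at h1
  rw [← h1, Fin.sum_univ_six, Fin.sum_univ_six]
  simp only [tPerm, tMult, Matrix.cons_val]
  norm_num
  ring

lemma IsRelation.S {a : Fin 6 → ℂ} (h : IsRelation a) : IsRelation fun j => a (sPerm j) := by
  intro τ
  have h1 := h (ModularGroup.S • τ)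
  simp only [H3_S_apply] at h1
  have hc := csqrt_ne_zero (z := -Complex.I * τ) (by simp [τ.ne_zero])
  have h2 : csqrt (-Complex.I * τ) * ∑ j, a (sPerm j) * H3 τ j = 0 := by
    rw [← h1, Fin.sum_univ_six, Fin.sum_univ_six]
    simp only [sPerm, Matrix.cons_val]
    ring
  exact (mul_eq_zero.mp h2).resolve_left hc

lemma tMult_sq_ne : e (-1 / 48) ^ 2 ≠ e (1 / 6) ^ 2 := by
  rw [e_pow, e_pow]
  intro h
  have h1 : e (2 * (-1 / 48) - 2 * (1 / 6)) = 1 := by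
    rw [e_sub]
    norm_num at h ⊢
    rw [h, div_self (e_ne_zero _)]
  obtain ⟨n, hn⟩ := e_eq_one_iff.mp h1
  have h2 : (8 * n : ℤ) = -3 := by
    have : (8 * n : ℂ) = -3 := by rw [← hn]; norm_num
    exact_mod_cast this
  omega

/-- Two words in `S` and `T` move the coefficients 3 and 4 to the positions seen at the cusp, in
both orders. The resulting system has determinant `e (-1/48)² - e (1/6)² ≠ 0`. -/
lemma IsRelation.three_four {a : Fin 6 → ℂ} (h : IsRelation a) : a 3 = 0 ∧ a 4 = 0 := by
  have h1 : e (-1 / 48) * a 3 + e (1 / 6) * a 4 = 0 := h.T.S.cusp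
  have h2 : e (-1 / 48) * a 4 + e (1 / 6) * a 3 = 0 := h.S.T.S.cusp
  have hne := sub_ne_zero.mpr tMult_sq_ne
  constructor
  · refine (mul_eq_zero.mp ?_).resolve_left hne
    linear_combination e (-1 / 48) * h1 - e (1 / 6) * h2
  · refine (mul_eq_zero.mp ?_).resolve_left hne
    linear_combination e (-1 / 48) * h2 - e (1 / 6) * h1

/-- The group action carries the remaining coefficients to positions 3 and 4. -/
lemma IsRelation.eq_zero {a : Fin 6 → ℂ} (h : IsRelation a) : a = 0 := by
  have hz := e_ne_zero (-1 / 48)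
  have hy := e_ne_zero (1 / 6)
  obtain ⟨h3, h4⟩ := h.three_four
  have hT : e (-1 / 48) * a 2 = 0 ∧ e (1 / 6) * a 5 = 0 := h.T.three_four
  have hST : e (-1 / 48) * a 0 = 0 ∧ e (1 / 6) * a 1 = 0 := h.S.T.three_four
  have h2 := (mul_eq_zero.mp hT.1).resolve_left hz
  have h5 := (mul_eq_zero.mp hT.2).resolve_left hy
  have h0 := (mul_eq_zero.mp hST.1).resolve_left hz
  have h1 := (mul_eq_zero.mp hST.2).resolve_left hy
  funext j
  fin_cases j <;> assumption

lemma eq_of_mulVec_H3 {A B : Matrix (Fin 6) (Fin 6) ℂ} (h : ∀ τ, A *ᵥ H3 τ = B *ᵥ H3 τ) :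
    A = B := by
  ext i j
  have : IsRelation fun j => A i j - B i j := fun τ => by
    have := congrFun (h τ) i
    simp only [Matrix.mulVec, dotProduct] at this
    simp only [sub_mul, Finset.sum_sub_distrib, this, sub_self]
  exact sub_eq_zero.mp (congrFun this.eq_zero j)

/-! ### Generators of the metaplectic group -/

/-- A continuous square root of 1 on the connected set `ℍ` is constant. -/
lemma Mp2Z.phi_eq_one_or {k : Mp2Z} (hk : k.mat = 1) :
    (∀ τ, k.phi τ = 1) ∨ ∀ τ, k.phi τ = -1 := by
  have hc : Continuous k.phi := k.holo.continuous
  have h := isPreconnected_univ.eq_or_eq_neg_of_sq_eq (f := k.phi) (g := 1) hc.continuousOn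
    continuousOn_const (fun τ _ => by
      rw [Pi.pow_apply, Pi.pow_apply, k.sq, hk]
      simp) (fun _ => one_ne_zero)
  exact h.imp (fun h τ => h (Set.mem_univ τ)) (fun h τ => h (Set.mem_univ τ))

lemma Mp2Z.S_pow_four_mat : (Mp2Z.S * Mp2Z.S * (Mp2Z.S * Mp2Z.S)).mat = 1 := by
  change ModularGroup.S * ModularGroup.S * (ModularGroup.S * ModularGroup.S) = 1
  decide

lemma Mp2Z.S_pow_four_phi (τ : ℍ) : (Mp2Z.S * Mp2Z.S * (Mp2Z.S * Mp2Z.S)).phi τ = -1 := by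
  have hI : ModularGroup.S • UpperHalfPlane.I = UpperHalfPlane.I := by
    apply UpperHalfPlane.ext
    rw [coe_S_smul, UpperHalfPlane.coe_I, neg_div, one_div, Complex.inv_I, neg_neg]
  -- At the fixed point `i` of `S` the product of the four factors is `(√i)⁴ = -1`.
  have h1 : (Mp2Z.S * Mp2Z.S * (Mp2Z.S * Mp2Z.S)).phi UpperHalfPlane.I = -1 := by
    have hS : Mp2Z.S.mat = ModularGroup.S := rfl
    have hphi : Mp2Z.S.phi UpperHalfPlane.I = csqrt Complex.I := rfl
    have hsq := csqrt_sq Complex.I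
    simp only [Mp2Z.mul_phi, Mp2Z.mul_mat, hS, mul_smul, hI, hphi]
    linear_combination (csqrt Complex.I ^ 2 + Complex.I) * hsq + Complex.I_sq
  rcases Mp2Z.phi_eq_one_or Mp2Z.S_pow_four_mat with h | h
  · rw [h] at h1
    norm_num at h1
  · exact h τ

/-- The images generate `SL(2, ℤ)`, and the nontrivial element `(1, -1)` of the kernel of the
projection is `S⁴`. -/
lemma Mp2Z.closure_S_T : Subgroup.closure ({Mp2Z.S, Mp2Z.T} : Set Mp2Z) = ⊤ := by
  have hS : Mp2Z.S ∈ Subgroup.closure ({Mp2Z.S, Mp2Z.T} : Set Mp2Z) :=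
    Subgroup.subset_closure (by simp)
  rw [eq_top_iff]
  intro g _
  have hmap : (Subgroup.closure ({Mp2Z.S, Mp2Z.T} : Set Mp2Z)).map Mp2Z.proj = ⊤ := by
    rw [MonoidHom.map_closure, Set.image_pair]
    exact SpecialLinearGroup.SL2Z_generators
  obtain ⟨h, hh, hg⟩ : g.mat ∈ (Subgroup.closure ({Mp2Z.S, Mp2Z.T} : Set Mp2Z)).map Mp2Z.proj := by
    rw [hmap]; trivial
  have hg' : h.mat = g.mat := hg
  have hk : (h⁻¹ * g).mat = 1 := by
    rw [Mp2Z.mul_mat, Mp2Z.inv_mat, hg', inv_mul_cancel]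
  have hmem : h⁻¹ * g ∈ Subgroup.closure ({Mp2Z.S, Mp2Z.T} : Set Mp2Z) := by
    rcases Mp2Z.phi_eq_one_or hk with h1 | h1
    · have : h⁻¹ * g = 1 := Mp2Z.ext hk (funext fun τ => by rw [h1 τ, Mp2Z.one_phi])
      rw [this]
      exact one_mem _
    · have : h⁻¹ * g = Mp2Z.S * Mp2Z.S * (Mp2Z.S * Mp2Z.S) :=
        Mp2Z.ext (hk.trans Mp2Z.S_pow_four_mat.symm)
          (funext fun τ => by rw [h1 τ, Mp2Z.S_pow_four_phi])
      rw [this]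
      exact mul_mem (mul_mem hS hS) (mul_mem hS hS)
  simpa using mul_mem hh hmem

/-! ### The representation -/

lemma T3_entry (i j : Fin 6) : T3 i j = if j = tPerm i then tMult i else 0 := by
  fin_cases i <;> fin_cases j <;> simp [T3, tPerm, tMult]

lemma S3_entry (i j : Fin 6) : S3 i j = if j = sPerm i then 1 else 0 := by
  fin_cases i <;> fin_cases j <;> simp [S3, sPerm]

lemma tPerm_tPerm (i : Fin 6) : tPerm (tPerm i) = i := by fin_cases i <;> rfl

lemma sPerm_sPerm (i : Fin 6) : sPerm (sPerm i) = i := by fin_cases i <;> rfl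

lemma mem_unitaryGroup_of_entry {A : Matrix (Fin 6) (Fin 6) ℂ} {p : Fin 6 → Fin 6}
    {m : Fin 6 → ℂ} (hp : Function.Injective p) (hm : ∀ i, ‖m i‖ = 1)
    (hA : ∀ i j, A i j = if j = p i then m i else 0) : A ∈ Matrix.unitaryGroup (Fin 6) ℂ := by
  rw [Matrix.mem_unitaryGroup_iff]
  ext i k
  rw [Matrix.mul_apply]
  simp only [Matrix.star_apply, hA, ite_mul, zero_mul, Finset.sum_ite_eq', Finset.mem_univ, if_true,
    hp.eq_iff, Matrix.one_apply]
  split_ifs with h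
  · subst h
    rw [← starRingEnd_apply, Complex.mul_conj, Complex.normSq_eq_norm_sq, hm]
    simp
  · simp

lemma tMult_pow (j : Fin 6) : tMult j ^ 48 = 1 := by
  rw [tMult]
  split_ifs
  · rw [e_pow, show ((48 : ℕ) : ℂ) * (-1 / 48) = ((-1 : ℤ) : ℂ) by push_cast; norm_num, e_int]
  · rw [e_pow, show ((48 : ℕ) : ℂ) * (1 / 6) = ((8 : ℤ) : ℂ) by push_cast; norm_num, e_int]

lemma e_neg_eighth_pow : e (-1 / 8) ^ 48 = 1 := by
  rw [e_pow, show ((48 : ℕ) : ℂ) * (-1 / 8) = ((-6 : ℤ) : ℂ) by push_cast; norm_num, e_int]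

lemma T3_mem_unitaryGroup : T3 ∈ Matrix.unitaryGroup (Fin 6) ℂ :=
  mem_unitaryGroup_of_entry (Function.LeftInverse.injective tPerm_tPerm)
    (fun j => Complex.norm_eq_one_of_pow_eq_one (tMult_pow j) (by norm_num)) T3_entry

lemma S3_entry' (i j : Fin 6) :
    (e (-1 / 8) • S3) i j = if j = sPerm i then e (-1 / 8) else 0 := by
  rw [Matrix.smul_apply, S3_entry]
  split_ifs <;> simp

lemma S3_mem_unitaryGroup : e (-1 / 8) • S3 ∈ Matrix.unitaryGroup (Fin 6) ℂ :=
  mem_unitaryGroup_of_entry (m := fun _ => e (-1 / 8))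
    (Function.LeftInverse.injective sPerm_sPerm)
    (fun _ => Complex.norm_eq_one_of_pow_eq_one e_neg_eighth_pow (by norm_num)) S3_entry'

/-- `√τ` lies in the open first quadrant, so turning it by `-π/4` keeps the real part positive. This
is the source of `e (-1/8)` in the matrix of `S`. -/
lemma csqrt_neg_I_mul (τ : ℍ) : csqrt (-Complex.I * τ) = e (-1 / 8) * csqrt τ := by
  have hslit : (τ : ℂ) ∈ Complex.slitPlane := Complex.mem_slitPlane_iff.mpr (Or.inr τ.im_pos.ne')
  have hre := re_csqrt_pos hslit
  have him : 0 < (csqrt τ).im := by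
    have h2 := congrArg Complex.im (csqrt_sq (τ : ℂ))
    rw [sq, Complex.mul_im] at h2
    have h3 : 0 < (τ : ℂ).im := τ.im_pos
    by_contra! H
    nlinarith
  refine csqrt_eq ?_ ?_
  · rw [mul_pow, csqrt_sq, e_pow, ← Complex.inv_I, ← e_quarter, ← e_neg]
    congr 2
    push_cast
    norm_num
  · have h4 : e (-1 / 8) * csqrt τ * (√2 : ℝ) = (1 - Complex.I) * csqrt τ := by
      have h5 : e (-1 / 8) * e (1 / 8) = 1 := by
        rw [← e_add, show (-1 / 8 : ℂ) + 1 / 8 = 0 by norm_num, e_zero]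
      have h6 := e_eighth
      have hI := Complex.I_sq
      have h7 : e (-1 / 8) * (1 + Complex.I) = (√2 : ℝ) := by
        rw [← h6, ← mul_assoc, h5, one_mul]
      have h8 := sqrt_two_sq
      linear_combination (1 / 2 * e (-1 / 8) * (√2 : ℝ) * csqrt τ) * hI +
        (1 / 2 * (√2 : ℝ) * (1 - Complex.I) * csqrt τ) * h7 +
        (1 / 2 * (1 - Complex.I) * csqrt τ) * h8
    have h9 := congrArg Complex.re h4
    rw [Complex.re_mul_ofReal, Complex.mul_re (1 - Complex.I)] at h9
    simp only [Complex.sub_re, Complex.one_re, Complex.I_re, Complex.sub_im, Complex.one_im,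
      Complex.I_im] at h9
    have h10 : 0 < √(2 : ℝ) := Real.sqrt_pos.mpr two_pos
    by_contra! H
    nlinarith

/-- The matrix `A` describes the action of the metaplectic element `g` on `H3`. -/
def Describes (g : Mp2Z) (A : Matrix (Fin 6) (Fin 6) ℂ) : Prop :=
  ∀ τ : ℍ, H3 (g.mat • τ) = g.phi τ • (A *ᵥ H3 τ)

lemma Describes.mul {g h : Mp2Z} {A B : Matrix (Fin 6) (Fin 6) ℂ} (hA : Describes g A)
    (hB : Describes h B) : Describes (g * h) (A * B) := by
  intro τ
  rw [Mp2Z.mul_mat, mul_smul, hA, hB, Mp2Z.mul_phi, Matrix.mulVec_smul, smul_smul,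
    Matrix.mulVec_mulVec]

lemma Describes.one : Describes 1 1 := by
  intro τ
  rw [Mp2Z.one_mat, one_smul, Mp2Z.one_phi, one_smul, Matrix.one_mulVec]

lemma Describes.inv {g : Mp2Z} {A B : Matrix (Fin 6) (Fin 6) ℂ} (hA : Describes g A)
    (hB : B * A = 1) : Describes g⁻¹ B := by
  intro τ
  have h1 := hA (g.mat⁻¹ • τ)
  rw [smul_inv_smul] at h1
  rw [Mp2Z.inv_mat, Mp2Z.inv_phi, h1, Matrix.mulVec_smul, smul_smul,
    inv_mul_cancel₀ (Mp2Z.phi_ne_zero _ _), one_smul, Matrix.mulVec_mulVec, hB, Matrix.one_mulVec]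

/-- Linear independence enters here; uniqueness makes `rhoFun`, a mere choice of matrices,
multiplicative. -/
lemma Describes.unique {g : Mp2Z} {A B : Matrix (Fin 6) (Fin 6) ℂ} (hA : Describes g A)
    (hB : Describes g B) : A = B :=
  eq_of_mulVec_H3 fun τ =>
    smul_right_injective _ (g.phi_ne_zero τ) ((hA τ).symm.trans (hB τ))

lemma describes_T : Describes Mp2Z.T T3 := by
  intro τ
  change H3 (ModularGroup.T • τ) = (1 : ℂ) • (T3 *ᵥ H3 τ)
  rw [H3_T, one_smul]

lemma describes_S : Describes Mp2Z.S (e (-1 / 8) • S3) := by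
  intro τ
  change H3 (ModularGroup.S • τ) = csqrt τ • ((e (-1 / 8) • S3) *ᵥ H3 τ)
  rw [H3_S, csqrt_neg_I_mul, Matrix.smul_mulVec, smul_smul, mul_comm]

lemma unitaryGroup_inv_mul (A : Matrix.unitaryGroup (Fin 6) ℂ) : (A⁻¹).1 * A.1 = 1 :=
  congrArg Subtype.val (inv_mul_cancel A)

lemma exists_describes (g : Mp2Z) : ∃ A : Matrix.unitaryGroup (Fin 6) ℂ, Describes g A.1 := by
  have hg : g ∈ Subgroup.closure ({Mp2Z.S, Mp2Z.T} : Set Mp2Z) := by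
    rw [Mp2Z.closure_S_T]; trivial
  induction hg using Subgroup.closure_induction with
  | mem x hx =>
    rcases hx with rfl | rfl
    · exact ⟨⟨_, S3_mem_unitaryGroup⟩, describes_S⟩
    · exact ⟨⟨_, T3_mem_unitaryGroup⟩, describes_T⟩
  | one => exact ⟨1, Describes.one⟩
  | mul x y _ _ hx hy =>
    obtain ⟨A, hA⟩ := hx
    obtain ⟨B, hB⟩ := hy
    exact ⟨A * B, hA.mul hB⟩
  | inv x _ hx =>
    obtain ⟨A, hA⟩ := hx
    exact ⟨A⁻¹, hA.inv (unitaryGroup_inv_mul A)⟩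

/-- The unitary matrix describing the action of a metaplectic element on `H3`. -/
def rhoFun (g : Mp2Z) : Matrix.unitaryGroup (Fin 6) ℂ := (exists_describes g).choose

lemma describes_rhoFun (g : Mp2Z) : Describes g (rhoFun g).1 := (exists_describes g).choose_spec

lemma rhoFun_mul (g h : Mp2Z) : rhoFun (g * h) = rhoFun g * rhoFun h :=
  Subtype.ext ((describes_rhoFun (g * h)).unique ((describes_rhoFun g).mul (describes_rhoFun h)))

/-- The unitary representation of the metaplectic group under which `H3` transforms. -/
def rho : Mp2Z →* Matrix.unitaryGroup (Fin 6) ℂ := MonoidHom.mk' rhoFun rhoFun_mul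

lemma describes_rho (g : Mp2Z) : Describes g (rho g).1 := describes_rhoFun g

lemma H3_smul (g : Mp2Z) (τ : ℍ) : H3 (g.mat • τ) = g.phi τ • ((rho g).1 *ᵥ H3 τ) :=
  describes_rho g τ

lemma rho_T : (rho Mp2Z.T).1 = T3 := (describes_rho Mp2Z.T).unique describes_T

lemma rho_S : (rho Mp2Z.S).1 = e (-1 / 8) • S3 := (describes_rho Mp2Z.S).unique describes_S

lemma T3_sq : T3 ^ 2 = Matrix.diagonal fun j => tMult j ^ 2 := by
  refine eq_of_mulVec_H3 fun τ => ?_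
  rw [sq, ← Matrix.mulVec_mulVec, T3_mulVec, T3_mulVec]
  funext j
  rw [Matrix.mulVec_diagonal]
  simp only [tPerm_tPerm]
  have : tMult (tPerm j) = tMult j := by fin_cases j <;> rfl
  rw [this]
  ring

lemma rho_T_pow : rho Mp2Z.T ^ 48 = 1 := by
  refine Subtype.ext ?_
  rw [SubmonoidClass.coe_pow, rho_T, show 48 = 2 * 24 by norm_num, pow_mul, T3_sq,
    Matrix.diagonal_pow]
  have : ((fun j => tMult j ^ 2) ^ 24 : Fin 6 → ℂ) = 1 := by
    funext j
    rw [Pi.pow_apply, ← pow_mul, tMult_pow, Pi.one_apply]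
  rw [this]
  exact Matrix.diagonal_one

lemma rho_inv_mul (g : Mp2Z) :
    ((rho g)⁻¹ : Matrix.unitaryGroup (Fin 6) ℂ).1 * (rho g).1 = 1 :=
  unitaryGroup_inv_mul (rho g)

lemma isVectorHarmonicWeakMaassForm_H3 : IsVectorHarmonicWeakMaassForm 1 rho ⊤ H3 where
  finiteIndex := inferInstance
  finite_order_T := ⟨48, by norm_num, rho_T_pow⟩
  smooth := isC2_H3
  transform g _ τ := by rw [zpow_one, H3_smul]
  growth := by
    refine ⟨1, one_pos, fun g i => ?_⟩
    -- The transformation law undoes `g`, so every cusp sees `H3` itself and one estimate suffices.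
    refine (isBigO_H3 i).congr_left fun τ => ?_
    rw [H3_smul, Matrix.mulVec_smul, Matrix.mulVec_mulVec, rho_inv_mul, Matrix.one_mulVec,
      Pi.smul_apply, smul_eq_mul, ← mul_assoc, zpow_neg, zpow_one,
      inv_mul_cancel₀ (g.phi_ne_zero τ), one_mul]
  harmonic := hypLaplacian_H3

/-! ### Restriction to the preimage of `Γ(2)` -/

/-- The reduction of a metaplectic element modulo `2`. -/
def reduction : Mp2Z →* SL(2, ZMod 2) :=
  (Matrix.SpecialLinearGroup.map (Int.castRingHom (ZMod 2))).comp Mp2Z.proj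

/-- The elements of `SL(2, ZMod 2)` labelling the components of `H3`. -/
def label : Fin 6 → SL(2, ZMod 2) :=
  ![1, ⟨!![1, 1; 0, 1], by decide⟩, ⟨!![0, 1; 1, 0], by decide⟩, ⟨!![0, 1; 1, 1], by decide⟩,
    ⟨!![1, 0; 1, 1], by decide⟩, ⟨!![1, 1; 1, 0], by decide⟩]

lemma reduction_T : reduction Mp2Z.T = ⟨!![1, 1; 0, 1], by decide⟩ := by
  refine Subtype.ext ?_
  change ModularGroup.T.1.map (Int.castRingHom (ZMod 2)) = _
  decide

lemma reduction_S : reduction Mp2Z.S = ⟨!![0, 1; 1, 0], by decide⟩ := by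
  refine Subtype.ext ?_
  change ModularGroup.S.1.map (Int.castRingHom (ZMod 2)) = _
  decide

/-- With `label_mul_S`: the permutations underlying `T3` and `S3` are right multiplications in a
group of order 6. -/
lemma label_mul_T (i : Fin 6) : label i * reduction Mp2Z.T = label (tPerm i) := by
  rw [reduction_T]
  revert i
  decide

lemma label_mul_S (i : Fin 6) : label i * reduction Mp2Z.S = label (sPerm i) := by
  rw [reduction_S]
  revert i
  decide

lemma label_injective : Function.Injective label := by decide

/-- Every matrix of the representation is monomial with 48th roots of unity as entries, and the
reduction of `g` modulo 2 determines where they stand. Both properties pass from the generators to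
products and inverses. -/
lemma rho_entry (g : Mp2Z) : ∀ i j, (rho g).1 i j ≠ 0 →
    (rho g).1 i j ^ 48 = 1 ∧ label i * reduction g = label j := by
  have hg : g ∈ Subgroup.closure ({Mp2Z.S, Mp2Z.T} : Set Mp2Z) := by
    rw [Mp2Z.closure_S_T]; trivial
  induction hg using Subgroup.closure_induction with
  | mem x hx =>
    intro i j hij
    rcases hx with rfl | rfl
    · rw [rho_S, S3_entry'] at hij ⊢
      split_ifs at hij ⊢ with h
      · exact ⟨e_neg_eighth_pow, by rw [label_mul_S, h]⟩
      · exact absurd rfl hij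
    · rw [rho_T, T3_entry] at hij ⊢
      split_ifs at hij ⊢ with h
      · exact ⟨tMult_pow i, by rw [label_mul_T, h]⟩
      · exact absurd rfl hij
  | one =>
    intro i j hij
    rw [map_one, Matrix.UnitaryGroup.one_val, Matrix.one_apply] at hij ⊢
    split_ifs at hij ⊢ with h
    · exact ⟨one_pow _, by rw [map_one, mul_one, h]⟩
    · exact absurd rfl hij
  | mul x y _ _ hx hy =>
    intro i k hik
    rw [map_mul, Matrix.UnitaryGroup.mul_val, Matrix.mul_apply] at hik ⊢
    obtain ⟨j, -, hj⟩ := Finset.exists_ne_zero_of_sum_ne_zero hik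
    have h1 := hx i j (left_ne_zero_of_mul hj)
    have h2 := hy j k (right_ne_zero_of_mul hj)
    -- The labels determine the intermediate index, so only one product contributes to the entry.
    rw [Finset.sum_eq_single_of_mem j (Finset.mem_univ j) fun l _ hl => by
      by_contra H
      have h3 := hx i l (left_ne_zero_of_mul H)
      exact hl (label_injective (h3.2.symm.trans h1.2))]
    exact ⟨by rw [mul_pow, h1.1, h2.1, one_mul], by rw [map_mul, ← mul_assoc, h1.2, h2.2]⟩
  | inv x _ hx =>
    intro i j hij
    have h0 : (rho x⁻¹).1 i j = star ((rho x).1 j i) := by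
      rw [map_inv, Matrix.UnitaryGroup.inv_val, Matrix.star_apply]
    rw [h0] at hij ⊢
    have h1 := hx j i (star_ne_zero.mp hij)
    exact ⟨by rw [← star_pow, h1.1, star_one], by rw [map_inv, ← h1.2, mul_inv_cancel_right]⟩

lemma rho_entry_of_mem {g : Mp2Z} (hg : g ∈ Gamma2Tilde) {i j : Fin 6} (hij : i ≠ j) :
    (rho g).1 i j = 0 := by
  by_contra h
  have h1 := (rho_entry g i j h).2
  have h2 : reduction g = 1 := hg
  rw [h2, mul_one] at h1
  exact hij (label_injective h1)

lemma rho_diag_pow {g : Mp2Z} (hg : g ∈ Gamma2Tilde) (j : Fin 6) : (rho g).1 j j ^ 48 = 1 := by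
  refine (rho_entry g j j fun h => ?_).1
  -- If the diagonal entry were zero, the whole column `j` would vanish, against invertibility.
  have h1 := congrFun (congrFun (rho_inv_mul g) j) j
  rw [Matrix.mul_apply, Matrix.one_apply_eq, Finset.sum_eq_zero fun k _ => by
    rcases eq_or_ne k j with rfl | hk
    · rw [h, mul_zero]
    · rw [rho_entry_of_mem hg hk, mul_zero]] at h1
  exact zero_ne_one h1

/-- The diagonal entries of `rho` on the preimage of `Γ(2)` as characters. -/
def diagCharacter (j : Fin 6) : Gamma2Tilde →* Circle :=
  MonoidHom.mk' (fun g => ⟨(rho g.1).1 j j, mem_sphere_zero_iff_norm.mpr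
    (Complex.norm_eq_one_of_pow_eq_one (rho_diag_pow g.2 j) (by norm_num))⟩) fun g h => by
    refine Circle.ext ?_
    change (rho (g.1 * h.1)).1 j j = (rho g.1).1 j j * (rho h.1).1 j j
    rw [map_mul, Matrix.UnitaryGroup.mul_val, Matrix.mul_apply]
    exact Finset.sum_eq_single_of_mem j (Finset.mem_univ j) fun k _ hk => by
      rw [rho_entry_of_mem g.2 hk.symm, zero_mul]

lemma diagCharacter_apply (j : Fin 6) (g : Gamma2Tilde) :
    (diagCharacter j g : ℂ) = (rho g.1).1 j j := rfl

instance : Gamma2Tilde.FiniteIndex := by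
  refine ⟨?_⟩
  rw [Gamma2Tilde, Subgroup.index_comap]
  exact (inferInstance : ((CongruenceSubgroup.Gamma 2).subgroupOf _).FiniteIndex).index_ne_zero

lemma isScalarHarmonicWeakMaassForm_H3 (j : Fin 6) :
    IsScalarHarmonicWeakMaassForm 1 Gamma2Tilde (diagCharacter j) (fun τ => H3 τ j) where
  finiteIndex := inferInstance
  finite_order := ⟨48, by norm_num, fun g => Circle.ext (by
    rw [Circle.coe_pow, diagCharacter_apply, rho_diag_pow g.2, Circle.coe_one])⟩
  smooth := isC2_H3 j
  transform g τ := by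
    rw [H3_smul, Pi.smul_apply, smul_eq_mul, zpow_one, diagCharacter_apply, mul_assoc]
    congr 1
    rw [Matrix.mulVec, dotProduct]
    exact Finset.sum_eq_single_of_mem j (Finset.mem_univ j) fun k _ hk => by
      rw [rho_entry_of_mem g.2 hk.symm, zero_mul]
  growth := by
    refine ⟨1, one_pos, fun g => ?_⟩
    -- The growth condition ranges over all of `Mp₂(ℤ)`, where `g` mixes the components; all six
    -- bounds are needed.
    have h : (fun τ : ℍ => ∑ k, (rho g).1 j k * H3 τ k) =O[atImInfty]
        fun τ : ℍ => Real.exp (1 * τ.im) := by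
      have h1 := Asymptotics.IsBigO.sum (s := Finset.univ) fun k _ =>
        (isBigO_H3 k).const_mul_left ((rho g).1 j k)
      exact h1.congr_left fun τ => Finset.sum_apply _ _ _
    refine h.congr_left fun τ => ?_
    rw [H3_smul, Pi.smul_apply, smul_eq_mul, ← mul_assoc, zpow_neg, zpow_one,
      inv_mul_cancel₀ (g.phi_ne_zero τ), one_mul]
    rfl
  harmonic := hypLaplacian_H3 j

end MockThetaThree

end

theorem mainTheorem12 :
    -- all series and integrals in the definition of `H3` converge absolutely
    ((∀ x : ℂ, ‖x‖ < 1 → Summable (MockThetaThree.mockPhiTerm x) ∧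
        Summable (MockThetaThree.mockPsiTerm x) ∧ Summable (MockThetaThree.mockNuTerm x)) ∧
      (∀ z : ℂ, 0 < z.im → Summable (MockThetaThree.thetaTerm 12 z)) ∧
      (∀ (τ : ℍ) (j : Fin 6), MeasureTheory.IntegrableOn
        (fun t : ℝ => MockThetaThree.G3Integrand τ j (MockThetaThree.ray τ t)) (Set.Ioi 0))) ∧
    -- the transformation under `τ ↦ τ + 1` and `τ ↦ -1/τ`
    (∀ τ : ℍ, MockThetaThree.H3 (ModularGroup.T • τ) =
      MockThetaThree.T3 *ᵥ MockThetaThree.H3 τ) ∧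
    (∀ τ : ℍ, MockThetaThree.H3 (ModularGroup.S • τ) =
      MockThetaThree.csqrt (-Complex.I * τ) • (MockThetaThree.S3 *ᵥ MockThetaThree.H3 τ)) ∧
    -- `H3` is a vector valued harmonic weak Maass form of weight `1/2` for `Mp₂(ℤ)`
    (∃ ρ : MockThetaThree.Mp2Z →* Matrix.unitaryGroup (Fin 6) ℂ,
      (ρ MockThetaThree.Mp2Z.T : Matrix (Fin 6) (Fin 6) ℂ) = MockThetaThree.T3 ∧
      (ρ MockThetaThree.Mp2Z.S : Matrix (Fin 6) (Fin 6) ℂ) =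
        MockThetaThree.e (-1 / 8) • MockThetaThree.S3 ∧
      MockThetaThree.IsVectorHarmonicWeakMaassForm 1 ρ ⊤ MockThetaThree.H3) ∧
    -- its components are scalar valued harmonic weak Maass forms for the preimage of `Γ(2)`
    (∀ j : Fin 6, ∃ χ : MockThetaThree.Gamma2Tilde →* Circle,
      MockThetaThree.IsScalarHarmonicWeakMaassForm 1 MockThetaThree.Gamma2Tilde χ
        (fun τ => MockThetaThree.H3 τ j)) := by
  open MockThetaThree in
  exact ⟨⟨fun x hx => ⟨summable_mockPhiTerm hx, summable_mockPsiTerm hx, summable_mockNuTerm hx⟩,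
    fun z hz => summable_thetaTerm hz, fun τ j => integrableOn_G3Integrand τ j⟩, H3_T, H3_S,
    ⟨rho, rho_T, rho_S, isVectorHarmonicWeakMaassForm_H3⟩,
    fun j => ⟨diagCharacter j, isScalarHarmonicWeakMaassForm_H3 j⟩⟩
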